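/- All vector spaces are over $\mathbb{C}$. Let $A$ be a unital commutative associative algebra and let $B$ be a vertex $A$-algebroid: a vector space with a bilinear map $A\times B\to B$, $(a,v)\mapsto a\cdot v$, with $1_A\cdot v=v$; a left Leibniz bracket $u_0v=[u,v]$; a homomorphism of Leibniz algebras $\pi:B\to\mathrm{Der}(A)$, written $u_0a=\pi(u)(a)$; a symmetric bilinear pairing $u_1v=\langle u,v\rangle\in A$; and a linear map $\partial:A\to B$ with $\pi\circ\partial=0$, such that for all $a,a'\in A$, $u,v,v_1,v_2\in B$: $a\cdot(a'\cdot v)-(aa')\cdot v=\pi(v)(a)\cdot\partial a'+\pi(v)(a')\cdot\partial a$; $[u,a\cdot v]=\pi(u)(a)\cdot v+a\cdot[u,v]$; $[u,v]+[v,u]=\partial\langle u,v\rangle$; $\pi(a\cdot v)=a\pi(v)$; $\langle a\cdot u,v\rangle=a\langle u,v\rangle-\pi(u)(\pi(v)(a))$; $\pi(v)\langle v_1,v_2\rangle=\langle[v,v_1],v_2\rangle+\langle v_1,[v,v_2]\rangle$; $\partial(aa')=a\cdot\partial a'+a'\cdot\partial a$; $[v,\partial a]=\partial(\pi(v)(a))$;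 $\langle v,\partial a\rangle=\pi(v)(a)$. Assume that $B$ is a cyclic left Leibniz algebra (spanned by $u,[u,u],[u,[u,u]],\dots$ for some $u$) that is not a Lie algebra, that $B\neq A\partial(A):=\mathrm{span}\{a\cdot\partial a'\}$, that $\mathrm{Ker}(\partial)=\mathbb{C}1_A$, and that one of the following holds. 1. $\dim B=2$ and there is $b\in B$ such that $\{b,b_0b\}$ is a basis of $B$, $b_0(b_0b)=b_0b$, and, with $a=b_1b$, $a^2=\alpha_11_A+\alpha_2a$ for some $\alpha_1,\alpha_2\in\mathbb{C}$ with $\alpha_2\neq0$. 2. $\dim B=3$ and there is $b\in B$ such that $\{b,b_0b,b_0(b_0b)\}$ is a basis of $B$ and, with $a=b_1b$, one has $a\cdot b=\beta b+\gamma_0\partial(a)+\gamma_1\partial(b_0a)$ with $\beta,\gamma_0,\gamma_1\in\mathbb{C}$, and one of the following: (i) $b_0\partial(b_0a)=\partial(a)-\frac{\alpha+1}{\sqrt\alpha}\,i\,\partial(b_0a)$ for some $\alpha\in\mathbb{C}\setminus\{0,1\}$ and some square root $\sqrt\alpha$, and $\gamma_1+1\neq0$; (ii) $b_0\partial(b_0a)=\partial(a)+2i\,\partial(b_0a)$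 and $\gamma_1+1\neq0$; (iii) $b_0\partial(b_0a)=\partial(b_0a)$ and $\gamma_0+\gamma_1+1\neq0$. Let $\mathcal{L}$ be the quotient of $(A\oplus B)\otimes\mathbb{C}[t,t^{-1}]$ by the span of all $\partial(a)\otimes t^n+na\otimes t^{n-1}$ ($a\in A$, $n\in\mathbb{Z}$), let $u(n)$ be the class of $u\otimes t^n$, and make $\mathcal{L}$ a Lie algebra by $[a(m),a'(n)]=0$, $[b(m),a(n)]=(b_0a)(m+n)$, $[b(m),b'(n)]=(b_0b')(m+n)+m(b_1b')(m+n-1)$. Let $V_{\mathcal{L}}$ be the $\mathcal{L}$-module induced from the trivial module $\mathbb{C}\mathbf{1}$ of the subalgebra spanned by the $u(n)$ with $n\geq0$, let $D$ be the operator on $V_{\mathcal{L}}$ with $D\mathbf{1}=0$ and $[D,u(n)]=-nu(n-1)$, and let $E\subset V_{\mathcal L}$ be the span of $1_A(-1)\mathbf{1}-\mathbf{1}$ and all $a(-1)a'(-1)\mathbf{1}-(aa')(-1)\mathbf{1}$ and $a(-1)b(-1)\mathbf{1}-(a\cdot b)(-1)\mathbf{1}$. Put $V_B=V_{\mathcal{L}}/U(\mathcal{L})\mathbb{C}[D]E$,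 with the vertex algebra structure in which $\mathbf{1}$ is the vacuum and $Y(u(-1)\mathbf{1},z)=\sum_{n\in\mathbb{Z}}u(n)z^{-n-1}$ for all $u\in A\oplus B$. Let $M(1)$ be the rank one Heisenberg vertex algebra: the module induced over the Lie algebra with basis $h(n)$ ($n\in\mathbb{Z}$), $\mathbf{k}$ and brackets $[h(m),h(n)]=m\delta_{m+n,0}\mathbf{k}$, $[\mathbf{k},h(m)]=0$, from the one-dimensional module $\mathbb{C}\mathbf{1}$ on which $h(n)$, $n\geq0$, acts as $0$ and $\mathbf{k}$ as $1$, with vacuum $\mathbf{1}$ and $Y(h(-1)\mathbf{1},z)=\sum_{n}h(n)z^{-n-1}$. Then these vertex algebra structures on $V_B$ and $M(1)$ exist, and $A$ is a local algebra. If $\mathfrak{a}'$ is its unique maximal ideal and $(\mathfrak{a}')$ is the ideal of the vertex algebra $V_B$ generated by $\{a(-1)\mathbf{1}: a\in\mathfrak{a}'\}$, then $(\mathfrak{a}')$ is the maximal ideal of $V_B$ (it is a maximal ideal, and the only one), and the quotient $V_B/(\mathfrak{a}')$ is isomorphic, as a vertex algebra, to $M(1)$. -/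

import Mathlib

attribute [local instance 100] LieRing.ofAssociativeRing

noncomputable section

/-! ## Vertex algebras -/

/-- A vertex algebra structure on a complex vector space `V`: a vacuum vector and, for every
integer `n`, a bilinear product `u_n v` (that is, `Y(u,z) v = ∑ u_n v z^(-n-1)`), subject to
truncation, the vacuum and creation axioms and the Jacobi identity in component form
(all the sums are finite by truncation). -/
@[ext]
structure VertexAlgebra (V : Type*) [AddCommGroup V] [Module ℂ V] where
  /-- the vacuum vector -/
  vac : V
  /-- `prod n u v` is `u_n v` -/
  prod : ℤ → V →ₗ[ℂ] V →ₗ[ℂ] V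
  truncation : ∀ u v, ∃ N : ℤ, ∀ n, N ≤ n → prod n u v = 0
  vac_prod : ∀ (n : ℤ) (v : V), prod n vac v = if n = -1 then v else 0
  prod_vac_of_nonneg : ∀ (n : ℤ) (v : V), 0 ≤ n → prod n v vac = 0
  prod_vac : ∀ v : V, prod (-1) v vac = v
  jacobi : ∀ (u v w : V) (l m n : ℤ),
    ∑ᶠ i : ℕ, ((Ring.choose m i : ℤ) : ℂ) • prod (m + n - i) (prod (l + i) u v) w =
      ∑ᶠ i : ℕ, ((-1 : ℂ) ^ i * ((Ring.choose l i : ℤ) : ℂ)) •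
        (prod (m + l - i) u (prod (n + i) v w)
          - (-1 : ℂ) ^ l • prod (n + l - i) v (prod (m + i) u w))

namespace VertexAlgebra

section

variable {V W : Type*} [AddCommGroup V] [Module ℂ V] [AddCommGroup W] [Module ℂ W]

/-- Two-sided ideals of a vertex algebra. -/
def IsIdeal (S : VertexAlgebra V) (I : Submodule ℂ V) : Prop :=
  ∀ (n : ℤ) (u v : V), v ∈ I → S.prod n u v ∈ I ∧ S.prod n v u ∈ I

/-- The ideal generated by a set of vectors. -/
def idealSpan (S : VertexAlgebra V) (X : Set V) : Submodule ℂ V :=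
  sInf {I : Submodule ℂ V | S.IsIdeal I ∧ X ⊆ I}

theorem isIdeal_idealSpan (S : VertexAlgebra V) (X : Set V) : S.IsIdeal (S.idealSpan X) := by
  intro n u v hv
  simp only [idealSpan, Submodule.mem_sInf] at hv ⊢
  exact ⟨fun I hI => (hI.1 n u v (hv I hI)).1, fun I hI => (hI.1 n u v (hv I hI)).2⟩

/-- Maximal (proper) ideals of a vertex algebra. -/
def IsMaximalIdeal (S : VertexAlgebra V) (I : Submodule ℂ V) : Prop :=
  S.IsIdeal I ∧ I ≠ ⊤ ∧ ∀ J : Submodule ℂ V, S.IsIdeal J → I ≤ J → J ≠ ⊤ → J = I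

/-- An isomorphism of vertex algebras exists. -/
def Isomorphic (S : VertexAlgebra V) (T : VertexAlgebra W) : Prop :=
  ∃ e : V ≃ₗ[ℂ] W, e S.vac = T.vac ∧
    ∀ (n : ℤ) (u v : V), e (S.prod n u v) = T.prod n (e u) (e v)

/-- The products on the quotient by an ideal: `[u]_n [v] = [u_n v]`. -/
def quotientProd (S : VertexAlgebra V) (I : Submodule ℂ V) (hI : S.IsIdeal I) (n : ℤ) :
    (V ⧸ I) →ₗ[ℂ] (V ⧸ I) →ₗ[ℂ] (V ⧸ I) :=
  I.liftQ
    { toFun := fun u => I.mapQ I (S.prod n u) (fun v hv => (hI n u v hv).1)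
      map_add' := fun u u' => by
        ext v
        simp
      map_smul' := fun c u => by
        ext v
        simp }
    (fun u hu => by
      rw [LinearMap.mem_ker]
      ext v
      simpa using (hI n v u hu).2)

theorem quotientProd_mk (S : VertexAlgebra V) (I : Submodule ℂ V) (hI : S.IsIdeal I) (n : ℤ)
    (u v : V) :
    S.quotientProd I hI n (I.mkQ u) (I.mkQ v) = I.mkQ (S.prod n u v) := by
  simp [quotientProd]

/-- The quotient of a vertex algebra by an ideal. -/
def quotient (S : VertexAlgebra V) (I : Submodule ℂ V) (hI : S.IsIdeal I) :
    VertexAlgebra (V ⧸ I) where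
  vac := I.mkQ S.vac
  prod := S.quotientProd I hI
  truncation := by
    intro u v
    obtain ⟨u, rfl⟩ := I.mkQ_surjective u
    obtain ⟨v, rfl⟩ := I.mkQ_surjective v
    obtain ⟨N, hN⟩ := S.truncation u v
    exact ⟨N, fun n hn => by rw [quotientProd_mk, hN n hn, map_zero]⟩
  vac_prod := by
    intro n v
    obtain ⟨v, rfl⟩ := I.mkQ_surjective v
    rw [quotientProd_mk, S.vac_prod]
    split_ifs <;> simp
  prod_vac_of_nonneg := by
    intro n v hn
    obtain ⟨v, rfl⟩ := I.mkQ_surjective v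
    rw [quotientProd_mk, S.prod_vac_of_nonneg n v hn, map_zero]
  prod_vac := by
    intro v
    obtain ⟨v, rfl⟩ := I.mkQ_surjective v
    rw [quotientProd_mk, S.prod_vac]
  jacobi := by
    intro u v w l m n
    obtain ⟨u, rfl⟩ := I.mkQ_surjective u
    obtain ⟨v, rfl⟩ := I.mkQ_surjective v
    obtain ⟨w, rfl⟩ := I.mkQ_surjective w
    simp only [quotientProd_mk, ← LinearMap.map_smul I.mkQ, ← LinearMap.map_sub I.mkQ]
    have fin : ∀ f : ℕ → V, (∃ N : ℕ, ∀ i, N ≤ i → f i = 0) →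
        ∑ᶠ i, I.mkQ (f i) = I.mkQ (∑ᶠ i, f i) := by
      rintro f ⟨N, hN⟩
      refine (AddMonoidHom.map_finsum (I.mkQ : V →+ V ⧸ I) ?_).symm
      refine (Set.finite_lt_nat N).subset fun i hi => ?_
      by_contra h
      exact hi (hN i (not_lt.mp h))
    rw [fin, fin, S.jacobi]
    · obtain ⟨N, hN⟩ := S.truncation v w
      obtain ⟨M, hM⟩ := S.truncation u w
      refine ⟨max (N - n).toNat (M - m).toNat, fun i hi => ?_⟩
      rw [hN (n + i) (by omega), hM (m + i) (by omega)]
      simp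
    · obtain ⟨N, hN⟩ := S.truncation u v
      refine ⟨(N - l).toNat, fun i hi => ?_⟩
      rw [hN (l + i) (by omega)]
      simp

end

end VertexAlgebra

/-! ## Vertex algebroids -/

/-- A vertex `A`-algebroid structure on `B`.  In the notation of 1-truncated conformal algebras,
`bracket u v` is `u_0 v`, `pairing u v` is `u_1 v` and `anchor u a` is `u_0 a`. -/
structure VertexAlgebroid (A B : Type*) [CommRing A] [Algebra ℂ A]
    [AddCommGroup B] [Module ℂ B] where
  /-- the (nonassociative) action `a · v` -/
  act : A →ₗ[ℂ] B →ₗ[ℂ] B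
  /-- the left Leibniz bracket -/
  bracket : B →ₗ[ℂ] B →ₗ[ℂ] B
  /-- the map `π` to the derivations of `A` -/
  anchor : B →ₗ[ℂ] Derivation ℂ A A
  /-- the pairing `⟨u, v⟩` -/
  pairing : B →ₗ[ℂ] B →ₗ[ℂ] A
  /-- the map `∂` -/
  del : A →ₗ[ℂ] B
  one_act : ∀ v, act 1 v = v
  leibniz : ∀ u v w, bracket u (bracket v w) = bracket (bracket u v) w + bracket v (bracket u w)
  anchor_bracket : ∀ u v, anchor (bracket u v) = ⁅anchor u, anchor v⁆
  pairing_symm : ∀ u v, pairing u v = pairing v u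
  anchor_del : ∀ a, anchor (del a) = 0
  act_act : ∀ a a' v, act a (act a' v) - act (a * a') v =
    act (anchor v a) (del a') + act (anchor v a') (del a)
  bracket_act : ∀ u a v, bracket u (act a v) = act (anchor u a) v + act a (bracket u v)
  bracket_add_bracket : ∀ u v, bracket u v + bracket v u = del (pairing u v)
  anchor_act : ∀ a v, anchor (act a v) = a • anchor v
  pairing_act : ∀ a u v, pairing (act a u) v = a * pairing u v - anchor u (anchor v a)
  anchor_pairing : ∀ v v₁ v₂,
    anchor v (pairing v₁ v₂) = pairing (bracket v v₁) v₂ + pairing v₁ (bracket v v₂)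
  del_mul : ∀ a a', del (a * a') = act a (del a') + act a' (del a)
  bracket_del : ∀ v a, bracket v (del a) = del (anchor v a)
  pairing_del : ∀ v a, pairing v (del a) = anchor v a

namespace VertexAlgebroid

section

variable {A B : Type*} [CommRing A] [Algebra ℂ A] [AddCommGroup B] [Module ℂ B]

/-! ### Cyclic non-Lie vertex algebroids of dimension two and three -/

/-- The left Leibniz algebra `B` is spanned by the left powers `u, [u,u], [u,[u,u]], …` of one
element. -/
def IsCyclic (Γ : VertexAlgebroid A B) : Prop :=
  ∃ u : B, Submodule.span ℂ (Set.range fun k : ℕ => (Γ.bracket u)^[k] u) = ⊤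

/-- The left Leibniz algebra `B` is a Lie algebra. -/
def IsLie (Γ : VertexAlgebroid A B) : Prop := ∀ u : B, Γ.bracket u u = 0

/-- The subspace `A∂(A)` of `B`. -/
def actDel (Γ : VertexAlgebroid A B) : Submodule ℂ B :=
  Submodule.span ℂ {v | ∃ a a' : A, v = Γ.act a (Γ.del a')}

/-- `B` is a cyclic non-Lie left Leibniz algebra of dimension `n`, `B ≠ A∂(A)` and
`Ker ∂ = ℂ 1`. -/
def IsCyclicNonLie (Γ : VertexAlgebroid A B) (n : ℕ) : Prop :=
  Γ.IsCyclic ∧ ¬ Γ.IsLie ∧ Module.finrank ℂ B = n ∧ Γ.actDel ≠ ⊤ ∧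
    LinearMap.ker Γ.del = Submodule.span ℂ {(1 : A)}

/-- Dimension two, `b_0 b_0 b = b_0 b`, and `a * a = α₁ 1 + α₂ a` with `α₂ ≠ 0`,
where `a = b_1 b`. -/
def SolvableTwo (Γ : VertexAlgebroid A B) : Prop :=
  Γ.IsCyclicNonLie 2 ∧ ∃ (b : B) (a : A) (α₁ α₂ : ℂ),
    LinearIndependent ℂ ![b, Γ.bracket b b] ∧
    Submodule.span ℂ {b, Γ.bracket b b} = ⊤ ∧
    a = Γ.pairing b b ∧
    Γ.bracket b (Γ.bracket b b) = Γ.bracket b b ∧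
    a * a = α₁ • (1 : A) + α₂ • a ∧
    α₂ ≠ 0

/-- Dimension three: `b, b_0 b, b_0 b_0 b` is a basis of `B` and, with `a = b_1 b`,
`a · b = β b + γ₀ ∂(a) + γ₁ ∂(b_0 a)` and `b_0 ∂(b_0 a) = c₀ ∂(a) + c₁ ∂(b_0 a)`. -/
def ThreeData (Γ : VertexAlgebroid A B) (b : B) (β γ₀ γ₁ c₀ c₁ : ℂ) : Prop :=
  Γ.IsCyclicNonLie 3 ∧
  LinearIndependent ℂ ![b, Γ.bracket b b, Γ.bracket b (Γ.bracket b b)] ∧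
  Submodule.span ℂ {b, Γ.bracket b b, Γ.bracket b (Γ.bracket b b)} = ⊤ ∧
  ∃ a : A, a = Γ.pairing b b ∧
    Γ.act a b = β • b + γ₀ • Γ.del a + γ₁ • Γ.del (Γ.anchor b a) ∧
    Γ.bracket b (Γ.del (Γ.anchor b a)) = c₀ • Γ.del a + c₁ • Γ.del (Γ.anchor b a)

/-- `b_0 ∂(b_0 a) = ∂(a) - ((α + 1)/√α) i ∂(b_0 a)` with `α ∉ {0, 1}`, and `γ₁ + 1 ≠ 0`.
Here `s` is either of the two square roots of `α`. -/
def SolvableThreeOne (Γ : VertexAlgebroid A B) : Prop :=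
  ∃ (b : B) (β γ₀ γ₁ α s : ℂ), α ≠ 0 ∧ α ≠ 1 ∧ s ^ 2 = α ∧
    Γ.ThreeData b β γ₀ γ₁ 1 (-((α + 1) / s * Complex.I)) ∧ γ₁ + 1 ≠ 0

/-- `b_0 ∂(b_0 a) = ∂(a) + 2 i ∂(b_0 a)` and `γ₁ + 1 ≠ 0`. -/
def SolvableThreeTwo (Γ : VertexAlgebroid A B) : Prop :=
  ∃ (b : B) (β γ₀ γ₁ : ℂ), Γ.ThreeData b β γ₀ γ₁ 1 (2 * Complex.I) ∧ γ₁ + 1 ≠ 0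

/-- `b_0 ∂(b_0 a) = ∂(b_0 a)` and `γ₀ + γ₁ + 1 ≠ 0`. -/
def SolvableThreeThree (Γ : VertexAlgebroid A B) : Prop :=
  ∃ (b : B) (β γ₀ γ₁ : ℂ), Γ.ThreeData b β γ₀ γ₁ 0 1 ∧ γ₀ + γ₁ + 1 ≠ 0

/-! ### The Lie algebra `𝓛 = L(A ⊕ B) / ∂̂ L(A)`

An element of `L(A ⊕ B) = (A ⊕ B) ⊗ ℂ[t, t⁻¹]` is stored as its finitely supported family of
coefficients: `Finsupp.single n u` is `u ⊗ t^n`. -/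

/-- The degree-zero product `u_0 v` on `A ⊕ B`, with `a_0 a' = 0` and `a_0 b = - b_0 a`. -/
def zeroProd (Γ : VertexAlgebroid A B) : (A × B) →ₗ[ℂ] (A × B) →ₗ[ℂ] (A × B) :=
  LinearMap.mk₂ ℂ (fun u v => (Γ.anchor u.2 v.1 - Γ.anchor v.2 u.1, Γ.bracket u.2 v.2))
    (fun u u' v => by ext <;> simp; abel)
    (fun c u v => by ext <;> simp [smul_sub])
    (fun u v v' => by ext <;> simp; abel)
    (fun c u v => by ext <;> simp [smul_sub])

/-- The product `u_1 v` on `A ⊕ B`, which is `⟨u, v⟩` on `B` and vanishes otherwise. -/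
def oneProd (Γ : VertexAlgebroid A B) : (A × B) →ₗ[ℂ] (A × B) →ₗ[ℂ] (A × B) :=
  LinearMap.mk₂ ℂ (fun u v => (Γ.pairing u.2 v.2, 0))
    (fun u u' v => by ext <;> simp)
    (fun c u v => by ext <;> simp)
    (fun u v v' => by ext <;> simp)
    (fun c u v => by ext <;> simp)

/-- The bracket on `L(A ⊕ B)`:
`[u ⊗ t^m, v ⊗ t^n] = u_0 v ⊗ t^(m+n) + m u_1 v ⊗ t^(m+n-1)`. -/
def loopBracket (Γ : VertexAlgebroid A B) :
    (ℤ →₀ A × B) →ₗ[ℂ] (ℤ →₀ A × B) →ₗ[ℂ] (ℤ →₀ A × B) :=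
  Finsupp.lsum ℂ fun m : ℤ => LinearMap.flip <| Finsupp.lsum ℂ fun n : ℤ => LinearMap.flip <|
    Γ.zeroProd.compr₂ (Finsupp.lsingle (m + n)) +
      (m : ℂ) • Γ.oneProd.compr₂ (Finsupp.lsingle (m + n - 1))

/-- `∂̂(a ⊗ t^n) = ∂(a) ⊗ t^n + n a ⊗ t^(n-1)`. -/
def hatDel (Γ : VertexAlgebroid A B) : (ℤ →₀ A) →ₗ[ℂ] (ℤ →₀ A × B) :=
  Finsupp.lsum ℂ fun n : ℤ =>
    (Finsupp.lsingle n ∘ₗ LinearMap.inr ℂ A B ∘ₗ Γ.del) +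
      (n : ℂ) • (Finsupp.lsingle (n - 1) ∘ₗ LinearMap.inl ℂ A B)

theorem loopBracket_single (Γ : VertexAlgebroid A B) (m n : ℤ) (u v : A × B) :
    Γ.loopBracket (Finsupp.single m u) (Finsupp.single n v) =
      Finsupp.single (m + n) (Γ.anchor u.2 v.1 - Γ.anchor v.2 u.1, Γ.bracket u.2 v.2) +
        (m : ℂ) • Finsupp.single (m + n - 1) (Γ.pairing u.2 v.2, (0 : B)) := by
  simp [loopBracket, zeroProd, oneProd]

theorem hatDel_single (Γ : VertexAlgebroid A B) (n : ℤ) (a : A) :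
    Γ.hatDel (Finsupp.single n a) =
      Finsupp.single n ((0 : A), Γ.del a) + (n : ℂ) • Finsupp.single (n - 1) (a, (0 : B)) := by
  rw [hatDel, Finsupp.lsum_single]
  simp

/-- `L(A ⊕ B)` is a left Leibniz algebra. -/
theorem loopBracket_leibniz (Γ : VertexAlgebroid A B) (x y z : ℤ →₀ A × B) :
    Γ.loopBracket x (Γ.loopBracket y z) =
      Γ.loopBracket (Γ.loopBracket x y) z + Γ.loopBracket y (Γ.loopBracket x z) := by
  induction x using Finsupp.induction_linear with
  | zero => simp
  | add x x' hx hx' =>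
    simp only [map_add, LinearMap.add_apply, hx, hx']
    abel
  | single m u =>
  induction y using Finsupp.induction_linear with
  | zero => simp
  | add y y' hy hy' =>
    simp only [map_add, LinearMap.add_apply, hy, hy']
    abel
  | single n v =>
  induction z using Finsupp.induction_linear with
  | zero => simp
  | add z z' hz hz' =>
    simp only [map_add, hz, hz']
    abel
  | single k w =>
  obtain ⟨a, u⟩ := u
  obtain ⟨a', v⟩ := v
  obtain ⟨a'', w⟩ := w
  have h1 : Γ.pairing u (Γ.bracket v w) = Γ.pairing (Γ.bracket u v) w
      - Γ.anchor w (Γ.pairing u v) + Γ.anchor v (Γ.pairing u w) := by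
    have e1 := Γ.anchor_pairing v u w
    have e2 : Γ.pairing (Γ.bracket u v) w + Γ.pairing (Γ.bracket v u) w
        = Γ.anchor w (Γ.pairing u v) := by
      rw [← LinearMap.add_apply, ← map_add, Γ.bracket_add_bracket, Γ.pairing_symm, Γ.pairing_del]
    rw [e1, ← e2]
    abel
  have h2 := Γ.anchor_pairing u v w
  simp only [loopBracket_single, map_add, map_smul, LinearMap.add_apply, LinearMap.smul_apply,
    map_zero, LinearMap.zero_apply, Derivation.coe_zero, Pi.zero_apply, map_sub,
    Γ.anchor_bracket, Derivation.commutator_apply, h1, h2, Γ.leibniz u v w]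
  have i1 : m + (n + k) = m + n + k := by ring
  have i2 : n + (m + k) = m + n + k := by ring
  have i3 : m + (n + k - 1) = m + n + k - 1 := by ring
  have i4 : n + (m + k - 1) = m + n + k - 1 := by ring
  have i5 : m + n - 1 + k = m + n + k - 1 := by ring
  simp only [i1, i2, i3, i4, i5]
  ext j
  · simp only [Finsupp.add_apply, Finsupp.smul_apply, Finsupp.single_apply]
    split_ifs <;> simp <;> module
  · simp only [Finsupp.add_apply, Finsupp.smul_apply, Finsupp.single_apply]
    split_ifs <;> simp

theorem loopBracket_hatDel_left (Γ : VertexAlgebroid A B) (f : ℤ →₀ A) (y : ℤ →₀ A × B) :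
    Γ.loopBracket (Γ.hatDel f) y = 0 := by
  induction f using Finsupp.induction_linear with
  | zero => simp
  | add f f' hf hf' => simp only [map_add, LinearMap.add_apply, hf, hf', add_zero]
  | single n a =>
  induction y using Finsupp.induction_linear with
  | zero => simp
  | add y y' hy hy' => simp only [map_add, hy, hy', add_zero]
  | single k w =>
  obtain ⟨a', w⟩ := w
  have h : Γ.bracket (Γ.del a) w = 0 := by
    have h := Γ.bracket_add_bracket (Γ.del a) w
    rw [Γ.bracket_del, Γ.pairing_symm, Γ.pairing_del] at h
    simpa using h
  have i1 : n - 1 + k = n + k - 1 := by ring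
  simp only [hatDel_single, map_add, map_smul, LinearMap.add_apply, LinearMap.smul_apply,
    loopBracket_single, Γ.anchor_del, h, Γ.pairing_symm (Γ.del a) w, Γ.pairing_del, i1]
  ext j
  · simp only [Finsupp.add_apply, Finsupp.smul_apply, Finsupp.single_apply]
    split_ifs <;> simp
  · simp only [Finsupp.add_apply, Finsupp.smul_apply, Finsupp.single_apply]
    split_ifs <;> simp

theorem loopBracket_add_swap_mem (Γ : VertexAlgebroid A B) (x y : ℤ →₀ A × B) :
    Γ.loopBracket x y + Γ.loopBracket y x ∈ LinearMap.range Γ.hatDel := by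
  induction x using Finsupp.induction_linear with
  | zero => simp
  | add x x' hx hx' =>
    have := add_mem hx hx'
    simp only [map_add, LinearMap.add_apply]
    convert this using 1
    abel
  | single m u =>
  induction y using Finsupp.induction_linear with
  | zero => simp
  | add y y' hy hy' =>
    have := add_mem hy hy'
    simp only [map_add, LinearMap.add_apply]
    convert this using 1
    abel
  | single n v =>
  refine ⟨Finsupp.single (m + n) (Γ.pairing u.2 v.2), ?_⟩
  rw [hatDel_single, loopBracket_single, loopBracket_single, ← Γ.bracket_add_bracket,
    Γ.pairing_symm v.2 u.2, add_comm n m]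
  ext j
  · simp only [Finsupp.add_apply, Finsupp.smul_apply, Finsupp.single_apply]
    split_ifs <;> simp <;> module
  · simp only [Finsupp.add_apply, Finsupp.smul_apply, Finsupp.single_apply]
    split_ifs <;> simp

theorem loopBracket_hatDel_right_mem (Γ : VertexAlgebroid A B) (x : ℤ →₀ A × B)
    (f : ℤ →₀ A) : Γ.loopBracket x (Γ.hatDel f) ∈ LinearMap.range Γ.hatDel := by
  have := Γ.loopBracket_add_swap_mem x (Γ.hatDel f)
  rwa [loopBracket_hatDel_left, add_zero] at this

/-- The quotient `𝓛 = L(A ⊕ B) / ∂̂ L(A)`. -/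
def LieAlg (Γ : VertexAlgebroid A B) : Type _ := (ℤ →₀ A × B) ⧸ LinearMap.range Γ.hatDel

instance (Γ : VertexAlgebroid A B) : AddCommGroup Γ.LieAlg :=
  inferInstanceAs (AddCommGroup ((ℤ →₀ A × B) ⧸ LinearMap.range Γ.hatDel))

instance (Γ : VertexAlgebroid A B) : Module ℂ Γ.LieAlg :=
  inferInstanceAs (Module ℂ ((ℤ →₀ A × B) ⧸ LinearMap.range Γ.hatDel))

/-- The projection `ρ : L(A ⊕ B) → 𝓛`. -/
def proj (Γ : VertexAlgebroid A B) : (ℤ →₀ A × B) →ₗ[ℂ] Γ.LieAlg :=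
  (LinearMap.range Γ.hatDel).mkQ

theorem proj_surjective (Γ : VertexAlgebroid A B) : Function.Surjective Γ.proj :=
  (LinearMap.range Γ.hatDel).mkQ_surjective

theorem proj_eq_zero (Γ : VertexAlgebroid A B) (x : ℤ →₀ A × B) :
    Γ.proj x = 0 ↔ x ∈ LinearMap.range Γ.hatDel :=
  Submodule.Quotient.mk_eq_zero _

/-- The bracket induced on `𝓛`. -/
def lieBracket (Γ : VertexAlgebroid A B) : Γ.LieAlg →ₗ[ℂ] Γ.LieAlg →ₗ[ℂ] Γ.LieAlg :=
  (LinearMap.range Γ.hatDel).liftQ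
    { toFun := fun x => (LinearMap.range Γ.hatDel).liftQ (Γ.proj ∘ₗ Γ.loopBracket x) (by
        rintro _ ⟨f, rfl⟩
        rw [LinearMap.mem_ker, LinearMap.comp_apply, proj_eq_zero]
        exact Γ.loopBracket_hatDel_right_mem x f)
      map_add' := fun x x' => by
        apply Submodule.linearMap_qext
        refine LinearMap.ext fun y => ?_
        change Γ.proj (Γ.loopBracket _ y) = _
        rw [map_add, LinearMap.add_apply, map_add]
        rfl
      map_smul' := fun c x => by
        apply Submodule.linearMap_qext
        refine LinearMap.ext fun y => ?_
        change Γ.proj (Γ.loopBracket _ y) = _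
        rw [map_smul, LinearMap.smul_apply, map_smul]
        rfl }
    (by
      rintro _ ⟨f, rfl⟩
      rw [LinearMap.mem_ker]
      apply Submodule.linearMap_qext
      refine LinearMap.ext fun y => ?_
      change Γ.proj (Γ.loopBracket _ y) = 0
      rw [loopBracket_hatDel_left, map_zero])

theorem lieBracket_proj (Γ : VertexAlgebroid A B) (x y : ℤ →₀ A × B) :
    Γ.lieBracket (Γ.proj x) (Γ.proj y) = Γ.proj (Γ.loopBracket x y) := rfl

instance (Γ : VertexAlgebroid A B) : LieRing Γ.LieAlg where
  bracket x y := Γ.lieBracket x y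
  add_lie x y z := by
    change Γ.lieBracket (x + y) z = Γ.lieBracket x z + Γ.lieBracket y z
    simp
  lie_add x y z := by
    change Γ.lieBracket x (y + z) = Γ.lieBracket x y + Γ.lieBracket x z
    simp
  lie_self x := by
    change Γ.lieBracket x x = 0
    obtain ⟨x, rfl⟩ := Γ.proj_surjective x
    have h := (Γ.proj_eq_zero _).2 (Γ.loopBracket_add_swap_mem x x)
    rw [map_add, ← two_smul ℂ] at h
    rw [lieBracket_proj]
    exact (smul_eq_zero.1 h).resolve_left two_ne_zero
  leibniz_lie x y z := by
    change Γ.lieBracket x (Γ.lieBracket y z) =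
      Γ.lieBracket (Γ.lieBracket x y) z + Γ.lieBracket y (Γ.lieBracket x z)
    obtain ⟨x, rfl⟩ := Γ.proj_surjective x
    obtain ⟨y, rfl⟩ := Γ.proj_surjective y
    obtain ⟨z, rfl⟩ := Γ.proj_surjective z
    simp only [lieBracket_proj]
    rw [loopBracket_leibniz, map_add]

instance (Γ : VertexAlgebroid A B) : LieAlgebra ℂ Γ.LieAlg where
  lie_smul c x y := by
    change Γ.lieBracket x (c • y) = c • Γ.lieBracket x y
    simp

/-- The element `u(n) = ρ(u ⊗ t^n)` of `𝓛`. -/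
def mode (Γ : VertexAlgebroid A B) (u : A × B) (n : ℤ) : Γ.LieAlg :=
  Γ.proj (Finsupp.single n u)

/-! ### The translation derivation `u(n) ↦ -n u(n-1)` -/

/-- The operator `-d/dt` on `L(A ⊕ B)`: `u ⊗ t^n ↦ -n u ⊗ t^(n-1)`. -/
def loopD : (ℤ →₀ A × B) →ₗ[ℂ] (ℤ →₀ A × B) :=
  Finsupp.lsum ℂ fun n : ℤ => (-(n : ℂ)) • Finsupp.lsingle (n - 1)

theorem loopD_single (n : ℤ) (u : A × B) :
    loopD (Finsupp.single n u) = (-(n : ℂ)) • Finsupp.single (n - 1) u := by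
  rw [loopD, Finsupp.lsum_single]
  simp

theorem loopD_hatDel_mem (Γ : VertexAlgebroid A B) (f : ℤ →₀ A) :
    loopD (Γ.hatDel f) ∈ LinearMap.range Γ.hatDel := by
  induction f using Finsupp.induction_linear with
  | zero => simp
  | add f f' hf hf' =>
    simp only [map_add]
    exact add_mem hf hf'
  | single n a =>
  refine ⟨(-(n : ℂ)) • Finsupp.single (n - 1) a, ?_⟩
  simp only [map_smul, hatDel_single, map_add, loopD_single, smul_add, smul_smul]
  push_cast
  congr 2
  ring

theorem loopD_loopBracket (Γ : VertexAlgebroid A B) (x y : ℤ →₀ A × B) :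
    loopD (Γ.loopBracket x y) = Γ.loopBracket (loopD x) y + Γ.loopBracket x (loopD y) := by
  induction x using Finsupp.induction_linear with
  | zero => simp
  | add x x' hx hx' =>
    simp only [map_add, LinearMap.add_apply, hx, hx']
    abel
  | single m u =>
  induction y using Finsupp.induction_linear with
  | zero => simp
  | add y y' hy hy' =>
    simp only [map_add, hy, hy']
    abel
  | single n v =>
  have i1 : m - 1 + n = m + n - 1 := by ring
  have i2 : m + (n - 1) = m + n - 1 := by ring
  simp only [loopBracket_single, loopD_single, map_add, map_smul, LinearMap.smul_apply, i1, i2]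
  push_cast
  module

/-- The derivation of `𝓛` with `u(n) ↦ -n u(n-1)`. -/
def lieD (Γ : VertexAlgebroid A B) : Γ.LieAlg →ₗ[ℂ] Γ.LieAlg :=
  (LinearMap.range Γ.hatDel).mapQ (LinearMap.range Γ.hatDel) loopD (by
    rintro _ ⟨f, rfl⟩
    exact Γ.loopD_hatDel_mem f)

theorem lieD_proj (Γ : VertexAlgebroid A B) (x : ℤ →₀ A × B) :
    Γ.lieD (Γ.proj x) = Γ.proj (loopD x) := rfl

theorem lieD_lie (Γ : VertexAlgebroid A B) (x y : Γ.LieAlg) :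
    Γ.lieD ⁅x, y⁆ = ⁅Γ.lieD x, y⁆ + ⁅x, Γ.lieD y⁆ := by
  obtain ⟨x, rfl⟩ := Γ.proj_surjective x
  obtain ⟨y, rfl⟩ := Γ.proj_surjective y
  change Γ.lieD (Γ.lieBracket _ _) = Γ.lieBracket _ _ + Γ.lieBracket _ _
  simp only [lieD_proj, lieBracket_proj, loopD_loopBracket, map_add]

theorem lieD_mode (Γ : VertexAlgebroid A B) (u : A × B) (n : ℤ) :
    Γ.lieD (Γ.mode u n) = (-(n : ℂ)) • Γ.mode u (n - 1) := by
  rw [mode, lieD_proj, loopD_single, map_smul, mode]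

/-- The universal enveloping algebra `U(𝓛)`. -/
abbrev Env (Γ : VertexAlgebroid A B) : Type _ := UniversalEnvelopingAlgebra ℂ Γ.LieAlg

/-- The element `u(n)` of `U(𝓛)`. -/
def envMode (Γ : VertexAlgebroid A B) (u : A × B) (n : ℤ) : Γ.Env :=
  UniversalEnvelopingAlgebra.ι ℂ (Γ.mode u n)

/-- The algebra homomorphism `x ↦ x + ε D(x)` from `U(𝓛)` to the dual numbers over `U(𝓛)`
whose `ε`-component is the derivation of `U(𝓛)` extending `lieD`. -/
def envDHom (Γ : VertexAlgebroid A B) : Γ.Env →ₐ[ℂ] TrivSqZeroExt Γ.Env Γ.Env :=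
  UniversalEnvelopingAlgebra.lift ℂ
    { toFun := fun x => TrivSqZeroExt.inl (UniversalEnvelopingAlgebra.ι ℂ x) +
        TrivSqZeroExt.inr (UniversalEnvelopingAlgebra.ι ℂ (Γ.lieD x))
      map_add' := fun x y => by
        ext <;> simp
      map_smul' := fun c x => by
        ext <;> simp
      map_lie' := fun {x y} => by
        ext
        · simp [LieRing.of_associative_ring_bracket]
        · simp only [lieD_lie, map_add, LieHom.map_lie, LieRing.of_associative_ring_bracket,
            TrivSqZeroExt.snd_add, TrivSqZeroExt.snd_sub, TrivSqZeroExt.snd_mul,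
            TrivSqZeroExt.fst_add, TrivSqZeroExt.fst_inl, TrivSqZeroExt.fst_inr,
            TrivSqZeroExt.snd_inl, TrivSqZeroExt.snd_inr, zero_add, add_zero, smul_eq_mul,
            MulOpposite.smul_eq_mul_unop, MulOpposite.unop_op]
          abel }

/-- The derivation `D` of `U(𝓛)` with `D(u(n)) = -n u(n-1)`. -/
def envD (Γ : VertexAlgebroid A B) : Γ.Env →ₗ[ℂ] Γ.Env where
  toFun x := (Γ.envDHom x).snd
  map_add' x y := by simp
  map_smul' c x := by simp

theorem envDHom_fst (Γ : VertexAlgebroid A B) (x : Γ.Env) : (Γ.envDHom x).fst = x := by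
  have h : (TrivSqZeroExt.fstHom ℂ Γ.Env Γ.Env).comp Γ.envDHom = AlgHom.id ℂ Γ.Env := by
    apply UniversalEnvelopingAlgebra.hom_ext
    ext y
    change (Γ.envDHom (UniversalEnvelopingAlgebra.ι ℂ y)).fst = UniversalEnvelopingAlgebra.ι ℂ y
    rw [envDHom, UniversalEnvelopingAlgebra.lift_ι_apply]
    simp
  exact DFunLike.congr_fun h x

theorem envD_mul (Γ : VertexAlgebroid A B) (x y : Γ.Env) :
    Γ.envD (x * y) = Γ.envD x * y + x * Γ.envD y := by
  change (Γ.envDHom (x * y)).snd = _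
  rw [map_mul, TrivSqZeroExt.snd_mul, envDHom_fst, envDHom_fst]
  simp only [smul_eq_mul, MulOpposite.smul_eq_mul_unop, MulOpposite.unop_op]
  exact add_comm _ _

theorem envD_envMode (Γ : VertexAlgebroid A B) (u : A × B) (n : ℤ) :
    Γ.envD (Γ.envMode u n) = (-(n : ℂ)) • Γ.envMode u (n - 1) := by
  change (Γ.envDHom (UniversalEnvelopingAlgebra.ι ℂ (Γ.mode u n))).snd = _
  rw [envDHom, UniversalEnvelopingAlgebra.lift_ι_apply]
  change (TrivSqZeroExt.inl _ + TrivSqZeroExt.inr _ : TrivSqZeroExt Γ.Env Γ.Env).snd = _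
  rw [TrivSqZeroExt.snd_add, TrivSqZeroExt.snd_inl, TrivSqZeroExt.snd_inr, zero_add, lieD_mode,
    map_smul, envMode]

/-! ### The module `V_𝓛` and the vertex algebra `V_B`

The module induced from the trivial module of the subalgebra `𝓛^{≥0}` spanned by the `u(n)` with
`n ≥ 0` is realized as `U(𝓛) / U(𝓛) 𝓛^{≥0}`. -/

/-- The left ideal `U(𝓛) 𝓛^{≥0}`. -/
def nonnegIdeal (Γ : VertexAlgebroid A B) : Submodule Γ.Env Γ.Env :=
  Submodule.span Γ.Env {x | ∃ (u : A × B) (n : ℤ), 0 ≤ n ∧ x = Γ.envMode u n}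

/-- `V_𝓛 = U(𝓛) ⊗_{U(𝓛^{≥0})} ℂ`. -/
abbrev VL (Γ : VertexAlgebroid A B) : Type _ := Γ.Env ⧸ Γ.nonnegIdeal

/-- The generating vector of `V_𝓛`. -/
def vlVac (Γ : VertexAlgebroid A B) : Γ.VL := Γ.nonnegIdeal.mkQ 1

theorem envD_nonnegIdeal (Γ : VertexAlgebroid A B) (x : Γ.Env) (hx : x ∈ Γ.nonnegIdeal) :
    Γ.envD x ∈ Γ.nonnegIdeal := by
  induction hx using Submodule.span_induction with
  | zero => simp
  | add x y _ _ hx hy =>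
    rw [map_add]
    exact add_mem hx hy
  | smul p x h hx =>
    rw [smul_eq_mul, envD_mul]
    exact add_mem (Submodule.smul_mem _ _ h) (Submodule.smul_mem _ _ hx)
  | mem x h =>
    obtain ⟨u, n, hn, rfl⟩ := h
    rw [envD_envMode]
    rcases hn.eq_or_lt with rfl | hn
    · simp
    · exact Submodule.smul_of_tower_mem _ _ (Submodule.subset_span ⟨u, n - 1, by omega, rfl⟩)

/-- The operator `D` on `V_𝓛`, with `D 𝟏 = 0` and `[D, u(n)] = -n u(n-1)`. -/
def vlD (Γ : VertexAlgebroid A B) : Γ.VL →ₗ[ℂ] Γ.VL :=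
  (Submodule.Quotient.restrictScalarsEquiv ℂ Γ.nonnegIdeal).toLinearMap ∘ₗ
    (Γ.nonnegIdeal.restrictScalars ℂ).mapQ (Γ.nonnegIdeal.restrictScalars ℂ) Γ.envD
      (fun x hx => Γ.envD_nonnegIdeal x hx) ∘ₗ
    (Submodule.Quotient.restrictScalarsEquiv ℂ Γ.nonnegIdeal).symm.toLinearMap

/-- The vector `u(-1) 𝟏` of `V_𝓛`. -/
def vlVec (Γ : VertexAlgebroid A B) (u : A × B) : Γ.VL := Γ.envMode u (-1) • Γ.vlVac

/-- The subspace `E` of `V_𝓛`, spanned by `1_A - 𝟏`, `a(-1)a' - a * a'` and `a(-1)b - a · b`. -/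
def relSpace (Γ : VertexAlgebroid A B) : Submodule ℂ Γ.VL :=
  Submodule.span ℂ
    ({Γ.vlVec (1, 0) - Γ.vlVac} ∪
      {x | ∃ a a' : A, x = Γ.envMode (a, 0) (-1) • Γ.vlVec (a', 0) - Γ.vlVec (a * a', 0)} ∪
      {x | ∃ (a : A) (b : B), x = Γ.envMode (a, 0) (-1) • Γ.vlVec (0, b) -
        Γ.vlVec (0, Γ.act a b)})

/-- `I_B = U(𝓛) ℂ[D] E`. -/
def relIdeal (Γ : VertexAlgebroid A B) : Submodule Γ.Env Γ.VL :=
  Submodule.span Γ.Env {x | ∃ (k : ℕ) (e : Γ.VL), e ∈ Γ.relSpace ∧ x = (Γ.vlD ^ k) e}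

/-- `V_B = V_𝓛 / I_B`. -/
abbrev VB (Γ : VertexAlgebroid A B) : Type _ := Γ.VL ⧸ Γ.relIdeal

/-- The vacuum vector of `V_B`. -/
def vbVac (Γ : VertexAlgebroid A B) : Γ.VB := Γ.relIdeal.mkQ Γ.vlVac

/-- The map `A ⊕ B → V_B`, `u ↦ u(-1) 𝟏`. -/
def vbVec (Γ : VertexAlgebroid A B) (u : A × B) : Γ.VB := Γ.envMode u (-1) • Γ.vbVac

/-- `S` is the vertex algebra structure of `V_B`: its vacuum is `𝟏`, and `Y(u, z) = u(z)` for
`u ∈ A ⊕ B`. -/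
def IsVBStructure (Γ : VertexAlgebroid A B) (S : VertexAlgebra Γ.VB) : Prop :=
  S.vac = Γ.vbVac ∧
    ∀ (u : A × B) (n : ℤ) (v : Γ.VB), S.prod n (Γ.vbVec u) v = Γ.envMode u n • v

end

end VertexAlgebroid

/-! ## The rank one Heisenberg vertex algebra -/

/-- The affinization `ℂ h ⊗ ℂ[t, t⁻¹] ⊕ ℂ 𝐤`; the first component lists the coefficients of
the `h(n) = h ⊗ t^n`. -/
def HeisenbergAlg : Type := (ℤ →₀ ℂ) × ℂ

namespace HeisenbergAlg

instance : AddCommGroup HeisenbergAlg := inferInstanceAs (AddCommGroup ((ℤ →₀ ℂ) × ℂ))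

instance : Module ℂ HeisenbergAlg := inferInstanceAs (Module ℂ ((ℤ →₀ ℂ) × ℂ))

/-- The cocycle `(h(m), h(n)) ↦ m δ_{m+n,0}`. -/
def cocycle : (ℤ →₀ ℂ) →ₗ[ℂ] (ℤ →₀ ℂ) →ₗ[ℂ] ℂ :=
  Finsupp.lsum ℂ fun m : ℤ => LinearMap.toSpanSingleton ℂ _ ((m : ℂ) • Finsupp.lapply (-m))

theorem cocycle_single (m n : ℤ) (x y : ℂ) :
    cocycle (Finsupp.single m x) (Finsupp.single n y) =
      if m + n = 0 then (m : ℂ) * x * y else 0 := by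
  have h : n = -m ↔ m + n = 0 := by omega
  simp only [cocycle, Finsupp.lsum_single, LinearMap.toSpanSingleton_apply, LinearMap.smul_apply,
    Finsupp.lapply_apply, Finsupp.single_apply, h, smul_eq_mul]
  split_ifs <;> ring

theorem cocycle_swap (f g : ℤ →₀ ℂ) : cocycle f g = - cocycle g f := by
  induction f using Finsupp.induction_linear with
  | zero => simp
  | add f f' hf hf' =>
    simp only [map_add, LinearMap.add_apply, hf, hf']
    ring
  | single m x =>
  induction g using Finsupp.induction_linear with
  | zero => simp
  | add g g' hg hg' =>
    simp only [map_add, LinearMap.add_apply, hg, hg']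
    ring
  | single n y =>
  rw [cocycle_single, cocycle_single, add_comm n m]
  split_ifs with h
  · obtain rfl : n = -m := by omega
    push_cast
    ring
  · simp

instance : LieRing HeisenbergAlg where
  bracket x y := ((0 : ℤ →₀ ℂ), cocycle x.1 y.1)
  add_lie x y z := Prod.ext (by
    change (0 : ℤ →₀ ℂ) = 0 + 0
    simp) (by
    change cocycle (x.1 + y.1) z.1 = cocycle x.1 z.1 + cocycle y.1 z.1
    simp)
  lie_add x y z := Prod.ext (by
    change (0 : ℤ →₀ ℂ) = 0 + 0
    simp) (by
    change cocycle x.1 (y.1 + z.1) = cocycle x.1 y.1 + cocycle x.1 z.1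
    simp)
  lie_self x := Prod.ext rfl (self_eq_neg.1 (cocycle_swap x.1 x.1))
  leibniz_lie x y z := Prod.ext (by
    change (0 : ℤ →₀ ℂ) = 0 + 0
    simp) (by
    change cocycle x.1 0 = cocycle 0 z.1 + cocycle y.1 0
    simp)

instance : LieAlgebra ℂ HeisenbergAlg where
  lie_smul c x y := Prod.ext (by
      change (0 : ℤ →₀ ℂ) = c • 0
      simp) (by
    change cocycle x.1 (c • y.1) = c • cocycle x.1 y.1
    simp)

/-- The element `h(n)` of the universal enveloping algebra. -/
def envMode (n : ℤ) : UniversalEnvelopingAlgebra ℂ HeisenbergAlg :=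
  UniversalEnvelopingAlgebra.ι ℂ ((Finsupp.single n 1, 0) : (ℤ →₀ ℂ) × ℂ)

/-- The central element `𝐤` in the universal enveloping algebra. -/
def envK : UniversalEnvelopingAlgebra ℂ HeisenbergAlg :=
  UniversalEnvelopingAlgebra.ι ℂ ((0, 1) : (ℤ →₀ ℂ) × ℂ)

/-- The left ideal generated by the `h(n)`, `n ≥ 0`, and `𝐤 - 1`. -/
def vacIdeal : Submodule (UniversalEnvelopingAlgebra ℂ HeisenbergAlg)
    (UniversalEnvelopingAlgebra ℂ HeisenbergAlg) :=
  Submodule.span _ ({x | ∃ n : ℤ, 0 ≤ n ∧ x = envMode n} ∪ {envK - 1})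

/-- The module `M(1)` induced from the one-dimensional module on which the `h(n)`, `n ≥ 0`, act
by zero and `𝐤` acts by one. -/
abbrev Fock : Type := UniversalEnvelopingAlgebra ℂ HeisenbergAlg ⧸ vacIdeal

/-- The vacuum vector of `M(1)`. -/
def fockVac : Fock := vacIdeal.mkQ 1

/-- `T` is the vertex algebra structure of `M(1)`: its vacuum is `𝟏`, and
`Y(h(-1)𝟏, z) = ∑ h(n) z^(-n-1)`. -/
def IsFockStructure (T : VertexAlgebra Fock) : Prop :=
  T.vac = fockVac ∧
    ∀ (n : ℤ) (v : Fock), T.prod n (envMode (-1) • fockVac) v = envMode n • v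

end HeisenbergAlg

end

/-! All the admissible algebroids have one shape, `IsSplit`. Let `a = b_1 b`. Differentiating the
formula for `a * a` along `b_0`, and using that `∂` kills idempotents while `Ker ∂ = ℂ`, one finds
`A = ℂ ⊕ N` with `N ≠ 0`, `N² = 0`, `N` stable under `b_0`, and `b_0² = 1 + c b_0` on `N`. Moreover
`B = ℂ b ⊕ ∂(A)`, and correcting `b` by an element of `∂(A)` makes `[b, b] = 0` and `⟨b, b⟩ = β`, a
nonzero scalar. The data of `SolvableThreeThree` would give a nontrivial idempotent and never occur.
So `A` is local with maximal ideal `N = ker χ` for a character `χ`.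

Both vertex algebras come from the reconstruction theorem `exists_vertexAlgebra`, which rests on
Dong's lemma `IsLocal.nthProd` and on the fact that locality implies the Jacobi identity,
`IsLocal.jacobi`.

Let `s² = β`. Letting `a ∈ A` act by `χ a` and `b(n)` by `s h(n)` respects all relations of `V_B`
and gives a homomorphism `φ : V_B → M(1)`; it has a section `ψ` carrying `h(n)` to `s⁻¹ b(n)`. The
modes of `∂(A)` are multiples of modes of `A`, so modulo the ideal `(N)` only the modes of `b`
remain: `V_B = ψ(M(1)) + (N)`, whence `ker φ = (N)` (`exists_hom`). A nonzero subspace of `M(1)`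
stable under the annihilation operators contains the vacuum (`fockVac_mem`), so `(N)` is maximal and
the quotient is `M(1)`.

For uniqueness, let `J` be any maximal ideal, with no grading assumed; one must show `x(-1)𝟏 ∈ J`
for `x ∈ N` (`vbVec_mem`). The operator `b(0)` acts as a derivation, kills `𝟏`, and satisfies `(b_0
- r)(b_0 - t) = 0` on `N` with `r t = -1`. Let `R` be an additive semigroup avoiding `0`, and let
`W` consist of the vectors carried into `J` by a product of operators `b(0) - p`, `p ∈ R`. If `R`
contains the eigenvalues that matter modulo `J`, then `W` is an ideal containing `J` and `N`; it
omits `𝟏`, on which `b(0) - p` is the nonzero scalar `-p`. Hence `W = J` (`vbVec_mem_of_forall`).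

It remains to find `R`. If all `r`-eigenvectors, or all `t`-eigenvectors, lie in `J`, take the
positive ray through the other eigenvalue. Otherwise let `x`, `y` be eigenvectors outside `J`.
Maximal ideals are prime, so `Y(x,z)y` is nonzero modulo `J`; the relation `r b_{-1} x = β ∂x` fixes
its leading exponent as the product of the two eigenvalues divided by `β`, and this is a positive
integer because `x_n y = 0` for `n ≥ -1` (`exists_mul_eq`). So `r²/β` and `r t/β` are positive
integers, `r/t > 0`, and the ray through `t` contains `r` as well. -/

noncomputable section

/-! ## Fields and their products -/

namespace VertexField

open Filter

section Binomial

variable {V : Type*} [AddCommGroup V]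

theorem hasFiniteSupport_of_eventually {f : ℕ → V} (hf : ∀ᶠ i in atTop, f i = 0) :
    f.HasFiniteSupport := by
  obtain ⟨N, hN⟩ := eventually_atTop.1 hf
  refine (Set.finite_lt_nat N).subset fun i hi => ?_
  by_contra h
  exact hi (hN i (not_lt.mp h))

theorem eventually_shift {f : ℕ → V} (hf : ∀ᶠ i in atTop, f i = 0) :
    ∀ᶠ i in atTop, f (i + 1) = 0 :=
  (tendsto_add_atTop_nat 1).eventually hf

theorem finsum_nat_eq_add_shift {f : ℕ → V} (hf : ∀ᶠ i in atTop, f i = 0) :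
    ∑ᶠ i, f i = f 0 + ∑ᶠ i, f (i + 1) := by
  obtain ⟨N, hN⟩ := eventually_atTop.1 hf
  rw [finsum_eq_sum_of_support_subset (s := Finset.range (N + 1)),
    finsum_eq_sum_of_support_subset (s := Finset.range N), Finset.sum_range_succ', add_comm]
  · intro i hi
    by_contra h
    exact hi (hN _ (by simp at h; omega))
  · intro i hi
    by_contra h
    exact hi (hN _ (by simp at h; omega))

variable [Module ℂ V]

/-- The binomial sum `∑ (l choose i) f i` of an eventually vanishing sequence. -/
def binomSum (l : ℤ) (f : ℕ → V) : V := ∑ᶠ i : ℕ, ((Ring.choose l i : ℤ) : ℂ) • f i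

theorem hasFiniteSupport_smul_of_eventually {f : ℕ → V} (c : ℕ → ℂ)
    (hf : ∀ᶠ i in atTop, f i = 0) : (fun i => c i • f i).HasFiniteSupport :=
  hasFiniteSupport_of_eventually (hf.mono fun i hi => by simp [hi])

theorem binomSum_add (l : ℤ) {f g : ℕ → V} (hf : ∀ᶠ i in atTop, f i = 0)
    (hg : ∀ᶠ i in atTop, g i = 0) :
    binomSum l (fun i => f i + g i) = binomSum l f + binomSum l g := by
  simp only [binomSum, smul_add]
  exact finsum_add_distrib (hasFiniteSupport_smul_of_eventually _ hf)
    (hasFiniteSupport_smul_of_eventually _ hg)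

theorem binomSum_smul (l : ℤ) (c : ℂ) (f : ℕ → V) :
    binomSum l (fun i => c • f i) = c • binomSum l f := by
  simp only [binomSum, smul_finsum, smul_comm c]

theorem binomSum_sub (l : ℤ) {f g : ℕ → V} (hf : ∀ᶠ i in atTop, f i = 0)
    (hg : ∀ᶠ i in atTop, g i = 0) :
    binomSum l (fun i => f i - g i) = binomSum l f - binomSum l g := by
  simp only [binomSum, smul_sub]
  exact finsum_sub_distrib (hasFiniteSupport_smul_of_eventually _ hf)
    (hasFiniteSupport_smul_of_eventually _ hg)

theorem map_binomSum {W : Type*} [AddCommGroup W] [Module ℂ W] (φ : V →ₗ[ℂ] W) (l : ℤ)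
    {f : ℕ → V} (hf : ∀ᶠ i in atTop, f i = 0) :
    φ (binomSum l f) = binomSum l (fun i => φ (f i)) := by
  rw [binomSum, ← LinearMap.toAddMonoidHom_coe,
    AddMonoidHom.map_finsum _ (hasFiniteSupport_smul_of_eventually _ hf)]
  simp [binomSum]

theorem binomSum_zero (f : ℕ → V) : binomSum 0 f = f 0 := by
  rw [binomSum, finsum_eq_single _ 0]
  · simp
  · intro i hi
    rw [Ring.choose_zero_pos ℤ (Nat.pos_of_ne_zero hi)]
    simp

theorem binomSum_eq_apply_zero (l : ℤ) {f : ℕ → V} (hf : ∀ i, i ≠ 0 → f i = 0) :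
    binomSum l f = f 0 := by
  rw [binomSum, finsum_eq_single _ 0]
  · simp
  · intro i hi
    rw [hf i hi, smul_zero]

/-- Pascal's rule. -/
theorem binomSum_succ (l : ℤ) {f : ℕ → V} (hf : ∀ᶠ i in atTop, f i = 0) :
    binomSum (l + 1) f = binomSum l f + binomSum l (fun i => f (i + 1)) := by
  have h1 : ∀ (c : ℕ → ℂ), ∀ᶠ i in atTop, c i • f i = 0 :=
    fun c => hf.mono fun i hi => by simp [hi]
  have hf' := eventually_shift hf
  have e1 : binomSum (l + 1) f = f 0 +
      ∑ᶠ i : ℕ, ((Ring.choose (l + 1) (i + 1) : ℤ) : ℂ) • f (i + 1) := by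
    rw [binomSum, finsum_nat_eq_add_shift (h1 _)]
    simp
  have e2 : binomSum l f = f 0 +
      ∑ᶠ i : ℕ, ((Ring.choose l (i + 1) : ℤ) : ℂ) • f (i + 1) := by
    rw [binomSum, finsum_nat_eq_add_shift (h1 _)]
    simp
  rw [e1, e2, binomSum, add_assoc, ← finsum_add_distrib
    (hasFiniteSupport_smul_of_eventually _ hf') (hasFiniteSupport_smul_of_eventually _ hf')]
  congr 2
  ext i
  rw [Ring.choose_succ_succ, ← add_smul]
  push_cast
  rw [add_comm]

/-- Absorption: `i (l choose i) = (l - (i - 1)) (l choose (i - 1))`. -/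
theorem binomSum_absorb (l : ℤ) {f : ℕ → V} (hf : ∀ᶠ i in atTop, f i = 0) :
    binomSum l (fun i => (i : ℂ) • f i) = binomSum l (fun i => ((l : ℂ) - i) • f (i + 1)) := by
  rw [binomSum, finsum_nat_eq_add_shift, binomSum]
  · simp only [Nat.cast_zero, zero_smul, smul_zero, zero_add, smul_smul]
    congr 1
    ext i
    congr 1
    have h := Ring.choose_smul_choose l (Nat.le_succ i)
    rw [Nat.succ_eq_add_one, Nat.choose_succ_self_right, show i + 1 - i = 1 by omega,
      Ring.choose_one_right, nsmul_eq_mul] at h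
    have h' := congrArg (fun z : ℤ => (z : ℂ)) h
    push_cast at h' ⊢
    linear_combination h'
  · exact hf.mono fun i hi => by simp [hi]

end Binomial

section Fields

variable {V : Type*} [AddCommGroup V] [Module ℂ V]

/-- A family of modes `a n` is a field if `a n v = 0` for `n` large, for every `v`. -/
def IsField (a : ℤ → Module.End ℂ V) : Prop := ∀ v, ∀ᶠ n in atTop, a n v = 0

theorem IsField.eventually_nat {a : ℤ → Module.End ℂ V} (ha : IsField a) (n : ℤ) (v : V) :
    ∀ᶠ i : ℕ in atTop, a (n + i) v = 0 :=
  (tendsto_atTop_add_const_left _ n tendsto_natCast_atTop_atTop).eventually (ha v)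

/-- The right-hand side of the Jacobi identity for two families of modes. -/
def borcherds (a b : ℤ → Module.End ℂ V) (l m n : ℤ) (w : V) : V :=
  ∑ᶠ i : ℕ, ((-1 : ℂ) ^ i * ((Ring.choose l i : ℤ) : ℂ)) •
    (a (m + l - i) (b (n + i) w) - (-1 : ℂ) ^ l • b (n + l - i) (a (m + i) w))

variable {a b c : ℤ → Module.End ℂ V}

theorem borcherds_eq_binomSum (a b : ℤ → Module.End ℂ V) (l m n : ℤ) (w : V) :
    borcherds a b l m n w = binomSum l fun i => (-1 : ℂ) ^ i •
      (a (m + l - i) (b (n + i) w) - (-1 : ℂ) ^ l • b (n + l - i) (a (m + i) w)) := by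
  simp only [borcherds, binomSum, smul_smul, mul_comm]

theorem eventually_borcherds_term (ha : IsField a) (hb : IsField b) (l m n : ℤ) (w : V) :
    ∀ᶠ i : ℕ in atTop, (-1 : ℂ) ^ i •
      (a (m + l - i) (b (n + i) w) - (-1 : ℂ) ^ l • b (n + l - i) (a (m + i) w)) = 0 := by
  filter_upwards [ha.eventually_nat m w, hb.eventually_nat n w] with i h1 h2
  simp [h1, h2]

theorem borcherds_zero (a b : ℤ → Module.End ℂ V) (m n : ℤ) (w : V) :
    borcherds a b 0 m n w = a m (b n w) - b n (a m w) := by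
  simp [borcherds_eq_binomSum, binomSum_zero]

theorem borcherds_swap (a b : ℤ → Module.End ℂ V) (l m n : ℤ) (w : V) :
    borcherds a b l m n w = (-(-1 : ℂ) ^ l) • borcherds b a l n m w := by
  rw [borcherds_eq_binomSum, borcherds_eq_binomSum, ← binomSum_smul]
  congr 1
  ext i
  have h : (-1 : ℂ) ^ l * (-1 : ℂ) ^ l = 1 := by
    rw [← mul_zpow]
    simp
  rw [smul_comm]
  congr 1
  rw [smul_sub, smul_smul, neg_mul, h]
  module

/-- The numbers `l, m, n` are the exponents of `z - w`, `z`, `w` in a weighted commutator, so this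
is multiplication by one more factor `z - w`, in other words Pascal's rule. Locality, the Jacobi
identity and Dong's lemma all run on this recurrence. -/
theorem borcherds_succ (ha : IsField a) (hb : IsField b) (l m n : ℤ) (w : V) :
    borcherds a b (l + 1) m n w = borcherds a b l (m + 1) n w - borcherds a b l m (n + 1) w := by
  simp only [borcherds_eq_binomSum]
  have h := eventually_borcherds_term ha hb (l + 1) m n w
  rw [binomSum_succ _ h, ← binomSum_add _ h (eventually_shift h),
    ← binomSum_sub _ (eventually_borcherds_term ha hb _ _ _ _)
      (eventually_borcherds_term ha hb _ _ _ _)]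
  congr 1
  ext i
  have i1 : m + (l + 1) - (i : ℤ) = m + 1 + l - i := by ring
  have i2 : m + (l + 1) - ((i + 1 : ℕ) : ℤ) = m + l - i := by push_cast; ring
  have i3 : n + ((i + 1 : ℕ) : ℤ) = n + 1 + i := by push_cast; ring
  have i4 : n + (l + 1) - (i : ℤ) = n + 1 + l - i := by ring
  have i5 : n + (l + 1) - ((i + 1 : ℕ) : ℤ) = n + l - i := by push_cast; ring
  have i6 : m + ((i + 1 : ℕ) : ℤ) = m + 1 + i := by push_cast; ring
  rw [i1, i2, i3, i4, i5, i6, zpow_add_one₀ (by norm_num), pow_succ]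
  module

/-- Mutual locality of two families of modes. -/
def IsLocal (a b : ℤ → Module.End ℂ V) : Prop :=
  ∃ N : ℕ, ∀ l : ℤ, N ≤ l → ∀ m n w, borcherds a b l m n w = 0

theorem isLocal_of_eq_zero (ha : IsField a) (hb : IsField b) (N : ℕ)
    (h : ∀ m n w, borcherds a b N m n w = 0) : IsLocal a b := by
  refine ⟨N, fun l hl => ?_⟩
  induction l, hl using Int.leInduction with
  | base => exact h
  | succ l _ ih =>
    intro m n w
    rw [borcherds_succ ha hb, ih, ih, sub_zero]

theorem IsLocal.symm (h : IsLocal a b) : IsLocal b a := by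
  obtain ⟨N, hN⟩ := h
  refine ⟨N, fun l hl m n w => ?_⟩
  rw [borcherds_swap, hN l hl, smul_zero]

/-- A commutator that is affine in the first index gives locality. -/
theorem isLocal_of_commutator (ha : IsField a) (hb : IsField b) (c₀ c₁ : ℤ → Module.End ℂ V)
    (h : ∀ m n w, a m (b n w) - b n (a m w) = c₀ (m + n) w + (m : ℂ) • c₁ (m + n - 1) w) :
    IsLocal a b := by
  -- For `l = 1` the value depends on `m + n` only, so the next difference vanishes.
  have h1 : ∀ m n w, borcherds a b 1 m n w = c₁ (m + n) w := by
    intro m n w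
    rw [show (1 : ℤ) = 0 + 1 by norm_num, borcherds_succ ha hb, borcherds_zero, borcherds_zero,
      h, h, show m + 1 + n = m + n + 1 by ring, show m + (n + 1) = m + n + 1 by ring,
      add_sub_cancel_right]
    push_cast
    module
  refine isLocal_of_eq_zero ha hb 2 fun m n w => ?_
  rw [show ((2 : ℕ) : ℤ) = 1 + 1 by norm_num, borcherds_succ ha hb, h1, h1,
    show m + 1 + n = m + (n + 1) by ring, sub_self]

theorem isLocal_of_commute (ha : IsField a) (hb : IsField b)
    (h : ∀ m n w, a m (b n w) = b n (a m w)) : IsLocal a b :=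
  isLocal_of_commutator ha hb 0 0 (by simp [h])

theorem borcherds_add_left {a' : ℤ → Module.End ℂ V} (ha : IsField a) (ha' : IsField a')
    (hb : IsField b) (l m n : ℤ) (w : V) :
    borcherds (a + a') b l m n w = borcherds a b l m n w + borcherds a' b l m n w := by
  simp only [borcherds_eq_binomSum]
  rw [← binomSum_add _ (eventually_borcherds_term ha hb _ _ _ _)
      (eventually_borcherds_term ha' hb _ _ _ _)]
  congr 1
  ext i
  simp only [Pi.add_apply, LinearMap.add_apply, map_add]
  module

theorem borcherds_smul_left (r : ℂ) (a b : ℤ → Module.End ℂ V) (l m n : ℤ) (w : V) :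
    borcherds (r • a) b l m n w = r • borcherds a b l m n w := by
  simp only [borcherds_eq_binomSum]
  rw [← binomSum_smul]
  congr 1
  ext i
  simp only [Pi.smul_apply, LinearMap.smul_apply, map_smul]
  module

theorem isField_zero : IsField (0 : ℤ → Module.End ℂ V) := fun v => by simp

theorem IsField.add {a' : ℤ → Module.End ℂ V} (ha : IsField a) (ha' : IsField a') :
    IsField (a + a') := fun v => by
  filter_upwards [ha v, ha' v] with n h1 h2
  simp [h1, h2]

theorem IsField.smul (r : ℂ) (ha : IsField a) : IsField (r • a) := fun v => by
  filter_upwards [ha v] with n h1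
  simp [h1]

theorem isLocal_zero_left (b : ℤ → Module.End ℂ V) : IsLocal 0 b :=
  ⟨0, fun l _ m n w => by simp [borcherds]⟩

theorem IsLocal.add_left {a' : ℤ → Module.End ℂ V} (ha : IsField a) (ha' : IsField a')
    (hb : IsField b) (h : IsLocal a b) (h' : IsLocal a' b) : IsLocal (a + a') b := by
  obtain ⟨N, hN⟩ := h
  obtain ⟨N', hN'⟩ := h'
  refine ⟨max N N', fun l hl m n w => ?_⟩
  push_cast at hl
  rw [borcherds_add_left ha ha' hb, hN l (by omega), hN' l (by omega), add_zero]

theorem IsLocal.smul_left (r : ℂ) (h : IsLocal a b) : IsLocal (r • a) b := by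
  obtain ⟨N, hN⟩ := h
  exact ⟨N, fun l hl m n w => by rw [borcherds_smul_left, hN l hl, smul_zero]⟩

/-- The `l`-th product of two fields. -/
def nthProd (a b : ℤ → Module.End ℂ V) (ha : IsField a) (hb : IsField b) (l : ℤ) (n : ℤ) :
    Module.End ℂ V where
  toFun w := borcherds a b l 0 n w
  map_add' v w := by
    simp only [borcherds_eq_binomSum]
    rw [← binomSum_add _ (eventually_borcherds_term ha hb _ _ _ _)
      (eventually_borcherds_term ha hb _ _ _ _)]
    congr 1
    ext i
    simp only [map_add]
    module
  map_smul' r v := by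
    simp only [borcherds_eq_binomSum]
    rw [RingHom.id_apply, ← binomSum_smul]
    congr 1
    ext i
    simp only [map_smul]
    module

theorem nthProd_apply (ha : IsField a) (hb : IsField b) (l n : ℤ) (w : V) :
    nthProd a b ha hb l n w = borcherds a b l 0 n w := rfl

/-- As `a i w = 0` for `i ≥ K`, the terms `b (a w)` involve only finitely many vectors, and one
bound on `n` serves them all. -/
theorem isField_nthProd (ha : IsField a) (hb : IsField b) (l : ℤ) :
    IsField (nthProd a b ha hb l) := by
  intro w
  obtain ⟨K, hK⟩ := eventually_atTop.1 (ha.eventually_nat 0 w)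
  have h2 : ∀ᶠ n in atTop, ∀ i ∈ Finset.range K, b (n + l - i) (a (0 + i) w) = 0 := by
    rw [Finset.eventually_all]
    intro i _
    have : Tendsto (fun n : ℤ => n + (l - i)) atTop atTop :=
      tendsto_atTop_add_const_right _ _ tendsto_id
    filter_upwards [this.eventually (hb (a (0 + i) w))] with n hn
    rwa [add_sub_assoc]
  obtain ⟨N, hN⟩ := eventually_atTop.1 (hb w)
  filter_upwards [eventually_ge_atTop N, h2] with n hn h2
  rw [nthProd_apply, borcherds, finsum_eq_zero_of_forall_eq_zero]
  intro i
  rw [hN (n + i) (by omega)]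
  have : b (n + l - i) (a (0 + i) w) = 0 := by
    by_cases hi : i < K
    · exact h2 i (Finset.mem_range.2 hi)
    · rw [hK i (not_lt.1 hi), map_zero]
  rw [this]
  simp

/-- Locality implies the Jacobi identity. -/
theorem IsLocal.jacobi (ha : IsField a) (hb : IsField b) (h : IsLocal a b) (l m n : ℤ) (w : V) :
    binomSum m (fun i => nthProd a b ha hb (l + i) (m + n - i) w) = borcherds a b l m n w := by
  obtain ⟨N, hN⟩ := h
  have ev : ∀ l k : ℤ, ∀ᶠ i : ℕ in atTop, nthProd a b ha hb (l + i) (k - i) w = 0 := by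
    intro l k
    filter_upwards [eventually_ge_atTop (N - l).toNat] with i hi
    exact hN _ (by omega) _ _ _
  -- The two sides obey the same recurrence, this one and `borcherds_succ`. They agree at `m = 0` by
  -- definition, which yields `m ≥ 0`. For `m < 0` the recurrence expresses the value at `(l, m)`
  -- through `m + 1` and through `l + 1`; a descending induction on `l` starts at `N`, where
  -- everything vanishes.
  have succ : ∀ l m n : ℤ,
      binomSum (m + 1) (fun i => nthProd a b ha hb (l + i) (m + 1 + n - i) w) =
        binomSum m (fun i => nthProd a b ha hb (l + i) (m + (n + 1) - i) w) +
        binomSum m (fun i => nthProd a b ha hb (l + 1 + i) (m + n - i) w) := by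
    intro l m n
    rw [binomSum_succ _ (ev _ _)]
    have i1 : m + 1 + n = m + (n + 1) := by ring
    have i2 : ∀ i : ℕ, m + (n + 1) - ((i + 1 : ℕ) : ℤ) = m + n - i := by
      intro i; push_cast; ring
    have i3 : ∀ i : ℕ, l + ((i + 1 : ℕ) : ℤ) = l + 1 + i := by intro i; push_cast; ring
    simp only [i1, i2, i3]
  have nonneg : ∀ (k : ℕ) (l n : ℤ),
      binomSum k (fun i => nthProd a b ha hb (l + i) (k + n - i) w) = borcherds a b l k n w := by
    intro k
    induction k with
    | zero =>
      intro l n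
      simp [binomSum_zero, nthProd_apply]
    | succ k ih =>
      intro l n
      push_cast
      rw [succ, ih, ih, borcherds_succ ha hb]
      abel
  have neg : ∀ (k : ℕ) (l n : ℤ),
      binomSum (-k) (fun i => nthProd a b ha hb (l + i) (-k + n - i) w) =
        borcherds a b l (-k) n w := by
    intro k
    induction k with
    | zero =>
      intro l n
      simpa using nonneg 0 l n
    | succ k ih =>
      suffices H : ∀ (j : ℕ) (l n : ℤ), (N : ℤ) - j ≤ l →
          binomSum (-(k + 1 : ℕ)) (fun i => nthProd a b ha hb (l + i) (-(k + 1 : ℕ) + n - i) w) =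
            borcherds a b l (-(k + 1 : ℕ)) n w from
        fun l n => H (N - l).toNat l n (by omega)
      intro j
      induction j with
      | zero =>
        intro l n hl
        rw [hN l (by simpa using hl), binomSum, finsum_eq_zero_of_forall_eq_zero]
        intro i
        rw [nthProd_apply, hN _ (by push_cast at hl; omega), smul_zero]
      | succ j ihj =>
        intro l n hl
        have e1 := succ l (-(k + 1 : ℕ)) (n - 1)
        have e2 := borcherds_succ ha hb l (-(k + 1 : ℕ)) (n - 1) w
        have e3 := ih l (n - 1)
        have e4 := ihj (l + 1) (n - 1) (by push_cast at hl ⊢; omega)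
        rw [show (-(k + 1 : ℕ) : ℤ) + 1 = -k by push_cast; ring, sub_add_cancel] at e1 e2
        rw [e3, e4, e2] at e1
        rw [eq_comm, ← sub_eq_zero] at e1
        rw [← sub_eq_zero, ← e1]
        abel
  obtain ⟨k, rfl | rfl⟩ := m.eq_nat_or_neg
  · exact nonneg k l n
  · exact neg k l n

end Fields

end VertexField

end

/-! ### Dong's lemma: products of mutually local fields are local. -/

noncomputable section

namespace VertexField

open Filter

section Dong

variable {V : Type*} [AddCommGroup V] [Module ℂ V]

/-- If `P` and `Q` commute and are nilpotent at `f`, then so is `P + Q`. -/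
theorem add_pow_apply_eq_zero {M : Type*} [AddCommGroup M] [Module ℂ M] {P Q : Module.End ℂ M}
    (h : Commute P Q) (p q : ℕ) (f : M) (hp : (P ^ p) f = 0) (hq : (Q ^ q) f = 0) :
    ((P + Q) ^ (p + q)) f = 0 := by
  induction hs : p + q generalizing p q f with
  | zero =>
    obtain ⟨rfl, rfl⟩ : p = 0 ∧ q = 0 := by omega
    simpa using hp
  | succ s ih =>
    have z : ∀ (R : Module.End ℂ M), (R ^ 0) f = 0 → f = 0 := fun R h => by simpa using h
    rcases p with - | p
    · rw [z _ hp, map_zero]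
    rcases q with - | q
    · rw [z _ hq, map_zero]
    have c1 : (Q ^ (q + 1)) (P f) = 0 := by
      rw [← Module.End.mul_apply, ← (h.pow_right _).eq, Module.End.mul_apply, hq, map_zero]
    have c2 : (P ^ (p + 1)) (Q f) = 0 := by
      rw [← Module.End.mul_apply, (h.pow_left _).eq, Module.End.mul_apply, hp, map_zero]
    rw [pow_succ, Module.End.mul_apply, LinearMap.add_apply, map_add,
      ih p (q + 1) (P f) (by rwa [pow_succ, Module.End.mul_apply] at hp) c1 (by omega),
      ih (p + 1) q (Q f) c2 (by rwa [pow_succ, Module.End.mul_apply] at hq) (by omega), add_zero]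

/-- Translation by `t` on functions of three integers. -/
def shift (t : ℤ × ℤ × ℤ) : Module.End ℂ (ℤ × ℤ × ℤ → V) where
  toFun f := fun p => f (p + t)
  map_add' _ _ := rfl
  map_smul' _ _ := rfl

theorem shift_apply (t p : ℤ × ℤ × ℤ) (f : ℤ × ℤ × ℤ → V) : shift t f p = f (p + t) := rfl

theorem commute_shift (s t : ℤ × ℤ × ℤ) : Commute (shift s : Module.End ℂ (ℤ × ℤ × ℤ → V))
    (shift t) := by
  refine LinearMap.ext fun f => funext fun p => ?_
  simp only [Module.End.mul_apply, shift_apply]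
  rw [add_right_comm]

/-- The difference of two translations. -/
def diff (s t : ℤ × ℤ × ℤ) : Module.End ℂ (ℤ × ℤ × ℤ → V) := shift s - shift t

theorem diff_apply (s t p : ℤ × ℤ × ℤ) (f : ℤ × ℤ × ℤ → V) :
    diff s t f p = f (p + s) - f (p + t) := rfl

theorem commute_shift_diff (r s t : ℤ × ℤ × ℤ) :
    Commute (shift r : Module.End ℂ (ℤ × ℤ × ℤ → V)) (diff s t) :=
  (commute_shift _ _).sub_right (commute_shift _ _)

theorem commute_diff (r u s t : ℤ × ℤ × ℤ) :
    Commute (diff r u : Module.End ℂ (ℤ × ℤ × ℤ → V)) (diff s t) :=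
  (commute_shift_diff _ _ _).sub_left (commute_shift_diff _ _ _)

/-- Powers of differences of translations commute with pointwise finite sums. -/
theorem diff_pow_finsum (s t : ℤ × ℤ × ℤ) (k : ℕ) (f : ℕ → ℤ × ℤ × ℤ → V)
    (hf : ∀ p, ∀ᶠ i in atTop, f i p = 0) :
    (∀ p, ∀ᶠ i in atTop, (diff s t ^ k) (f i) p = 0) ∧
      (diff s t ^ k) (fun p => ∑ᶠ i, f i p) = fun p => ∑ᶠ i, (diff s t ^ k) (f i) p := by
  induction k with
  | zero => exact ⟨by simpa using hf, by simp⟩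
  | succ k ih =>
    obtain ⟨h1, h2⟩ := ih
    simp only [pow_succ', Module.End.mul_apply]
    constructor
    · intro p
      filter_upwards [h1 (p + s), h1 (p + t)] with i e1 e2
      rw [diff_apply, e1, e2, sub_zero]
    · rw [h2]
      funext p
      simp only [diff_apply]
      rw [finsum_sub_distrib (hasFiniteSupport_of_eventually (h1 _))
        (hasFiniteSupport_of_eventually (h1 _))]

variable {a b c : ℤ → Module.End ℂ V}

/-- On a set of indices stable under two translations which raise the first, respectively the
second, index of a commutator function, the powers of the difference operator turn that function
into `borcherds`. -/
theorem diff_pow_eq_borcherds (ha : IsField a) (hb : IsField b) {s t : ℤ × ℤ × ℤ}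
    (S : Set (ℤ × ℤ × ℤ)) (hS : ∀ p ∈ S, p + s ∈ S ∧ p + t ∈ S)
    {α β : ℤ × ℤ × ℤ → ℤ} {w : ℤ × ℤ × ℤ → V}
    (hs : ∀ p, α (p + s) = α p + 1 ∧ β (p + s) = β p ∧ w (p + s) = w p)
    (ht : ∀ p, α (p + t) = α p ∧ β (p + t) = β p + 1 ∧ w (p + t) = w p) {f : ℤ × ℤ × ℤ → V}
    (hf : ∀ p ∈ S, f p = a (α p) (b (β p) (w p)) - b (β p) (a (α p) (w p))) (k : ℕ) :
    ∀ p ∈ S, (diff s t ^ k) f p = borcherds a b k (α p) (β p) (w p) := by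
  induction k with
  | zero =>
    intro p hp
    simp [hf p hp, borcherds_zero]
  | succ k ih =>
    intro p hp
    rw [pow_succ', Module.End.mul_apply, diff_apply, ih _ (hS p hp).1, ih _ (hS p hp).2,
      (hs p).1, (hs p).2.1, (hs p).2.2, (ht p).1, (ht p).2.1, (ht p).2.2]
    push_cast
    rw [borcherds_succ ha hb]

/-- Lets a mode whose index is fixed by both translations be pulled out of the difference operator.
-/
theorem diff_pow_map {s t : ℤ × ℤ × ℤ} (k : ℕ) (f : ℤ × ℤ × ℤ → V) (φ : ℤ → V →ₗ[ℂ] V)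
    (j : ℤ × ℤ × ℤ → ℤ) (hs : ∀ p, j (p + s) = j p) (ht : ∀ p, j (p + t) = j p) :
    (diff s t ^ k) (fun p => φ (j p) (f p)) = fun p => φ (j p) ((diff s t ^ k) f p) := by
  induction k with
  | zero => simp
  | succ k ih =>
    rw [pow_succ', Module.End.mul_apply, Module.End.mul_apply, ih]
    funext p
    simp only [diff_apply, hs, ht, map_sub]

/-- By `[ab, c] = a[b, c] + [a, c]b`: the first summand dies under the power of `diff t u` by
locality of `b` and `c`, the second under the power of `diff s u` by locality of `a` and `c`, and
the two operators commute. -/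
theorem commutator_mul_eq_zero (ha : IsField a) (hb : IsField b) (hc : IsField c) (Q : ℕ)
    (hac : ∀ m n w, borcherds a c Q m n w = 0) (hbc : ∀ m n w, borcherds b c Q m n w = 0)
    {s t u : ℤ × ℤ × ℤ} {α β γ : ℤ × ℤ × ℤ → ℤ}
    (hs : ∀ p, α (p + s) = α p + 1 ∧ β (p + s) = β p ∧ γ (p + s) = γ p)
    (ht : ∀ p, α (p + t) = α p ∧ β (p + t) = β p + 1 ∧ γ (p + t) = γ p)
    (hu : ∀ p, α (p + u) = α p ∧ β (p + u) = β p ∧ γ (p + u) = γ p + 1) (w : V) :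
    (diff s u ^ Q * diff t u ^ Q : Module.End ℂ (ℤ × ℤ × ℤ → V))
      (fun p => a (α p) (b (β p) (c (γ p) w)) - c (γ p) (a (α p) (b (β p) w))) = 0 := by
  have split : (fun p => a (α p) (b (β p) (c (γ p) w)) - c (γ p) (a (α p) (b (β p) w))) =
      (fun p => a (α p) (b (β p) (c (γ p) w) - c (γ p) (b (β p) w))) +
      fun p => a (α p) (c (γ p) (b (β p) w)) - c (γ p) (a (α p) (b (β p) w)) := by
    funext p
    simp
  have z1 : (diff t u ^ Q) (fun p => a (α p) (b (β p) (c (γ p) w) - c (γ p) (b (β p) w))) = 0 := by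
    rw [diff_pow_map Q (fun p => b (β p) (c (γ p) w) - c (γ p) (b (β p) w)) a α
      (fun p => (ht p).1) (fun p => (hu p).1)]
    funext p
    rw [diff_pow_eq_borcherds hb hc Set.univ (by simp) (w := fun _ => w)
      (fun p => ⟨(ht p).2.1, (ht p).2.2, rfl⟩) (fun p => ⟨(hu p).2.1, (hu p).2.2, rfl⟩)
      (fun p _ => rfl) Q p trivial, hbc, map_zero]
    rfl
  have z2 : (diff s u ^ Q)
      (fun p => a (α p) (c (γ p) (b (β p) w)) - c (γ p) (a (α p) (b (β p) w))) = 0 := by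
    funext p
    rw [diff_pow_eq_borcherds ha hc Set.univ (by simp) (w := fun p => b (β p) w)
      (fun p => ⟨(hs p).1, (hs p).2.2, by rw [(hs p).2.1]⟩)
      (fun p => ⟨(hu p).1, (hu p).2.2, by rw [(hu p).2.1]⟩)
      (fun p _ => rfl) Q p trivial, hac]
    rfl
  rw [split, map_add, Module.End.mul_apply, z1, map_zero, zero_add,
    ((commute_diff _ _ _ _).pow_pow _ _).eq, Module.End.mul_apply, z2, map_zero]

/-- Dong's lemma. -/
theorem IsLocal.nthProd (ha : IsField a) (hb : IsField b) (hc : IsField c) (hab : IsLocal a b)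
    (hac : IsLocal a c) (hbc : IsLocal b c) (l : ℤ) : IsLocal (nthProd a b ha hb l) c := by
  obtain ⟨N, hN⟩ := hab
  obtain ⟨Q₁, h₁⟩ := hac
  obtain ⟨Q₂, h₂⟩ := hbc
  obtain ⟨Q, hac, hbc⟩ : ∃ Q : ℕ, (∀ m n w, borcherds a c Q m n w = 0) ∧
      ∀ m n w, borcherds b c Q m n w = 0 :=
    ⟨max Q₁ Q₂, h₁ _ (by simp), h₂ _ (by simp)⟩
  obtain ⟨K, hK⟩ : ∃ K : ℕ, (N : ℤ) ≤ l + K := ⟨(N - l).toNat, by omega⟩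
  refine isLocal_of_eq_zero (isField_nthProd ha hb l) hc (K + Q + Q) fun m n w => ?_
  -- The commutator of the product with `c`, with the index of `a` left free; the slice `p.1 = 0` is
  -- the one wanted. Write `x, y, z` for the unit translations of the three indices. Then `(y -
  -- x)^K` kills `g`, since it raises `l` beyond `N`, and `(x - z)^Q (y - z)^Q` kills `g` by
  -- locality with `c`. Since `y - z = (y - x) + (x - z)`, also `(y - z)^(K + 2Q)` kills `g`.
  let g : ℤ × ℤ × ℤ → V := fun p =>
    borcherds a b l p.1 p.2.1 (c p.2.2 w) - c p.2.2 (borcherds a b l p.1 p.2.1 w)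
  have hg1 : ∀ k : ℕ, (diff (0, 1, 0) (1, 0, 0) ^ k) g = fun p => (-1 : ℂ) ^ k •
      (borcherds a b (l + k) p.1 p.2.1 (c p.2.2 w)
        - c p.2.2 (borcherds a b (l + k) p.1 p.2.1 w)) := by
    intro k
    induction k with
    | zero => simp [g]
    | succ k ih =>
      rw [pow_succ', Module.End.mul_apply, ih]
      funext p
      rw [diff_apply]
      push_cast
      rw [← add_assoc, borcherds_succ ha hb, borcherds_succ ha hb, pow_succ]
      simp only [Prod.fst_add, Prod.snd_add, add_zero, map_sub]
      module
  have hXY : (diff (0, 1, 0) (1, 0, 0) ^ K) g = 0 := by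
    rw [hg1]
    funext p
    simp [hN _ hK]
  have hmain : (diff (1, 0, 0) (0, 0, 1) ^ Q) ((diff (0, 1, 0) (0, 0, 1) ^ Q) g) = 0 := by
    let T₁ : ℤ × ℤ × ℤ → V := fun p => a p.1 (b p.2.1 (c p.2.2 w)) - c p.2.2 (a p.1 (b p.2.1 w))
    let T₂ : ℤ × ℤ × ℤ → V := fun p => b p.2.1 (a p.1 (c p.2.2 w)) - c p.2.2 (b p.2.1 (a p.1 w))
    set P : Module.End ℂ (ℤ × ℤ × ℤ → V) :=
      diff (1, 0, 0) (0, 0, 1) ^ Q * diff (0, 1, 0) (0, 0, 1) ^ Q with hP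
    have e1 : P T₁ = 0 :=
      commutator_mul_eq_zero ha hb hc Q hac hbc (s := (1, 0, 0)) (t := (0, 1, 0)) (u := (0, 0, 1))
        (α := fun p => p.1) (β := fun p => p.2.1) (γ := fun p => p.2.2)
        (by simp) (by simp) (by simp) w
    have e2 : P T₂ = 0 := by
      rw [hP, ((commute_diff _ _ _ _).pow_pow _ _).eq]
      exact commutator_mul_eq_zero hb ha hc Q hbc hac (s := (0, 1, 0)) (t := (1, 0, 0))
        (u := (0, 0, 1))
        (α := fun p => p.2.1) (β := fun p => p.1) (γ := fun p => p.2.2)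
        (by simp) (by simp) (by simp) w
    have hPs : ∀ t, Commute (shift t) P := fun t =>
      ((commute_shift_diff _ _ _).pow_right _).mul_right ((commute_shift_diff _ _ _).pow_right _)
    have e3 : ∀ t, P (shift t T₁) = 0 := fun t => by
      rw [← Module.End.mul_apply, ← (hPs t).eq, Module.End.mul_apply, e1, map_zero]
    have e4 : ∀ t, P (shift t T₂) = 0 := fun t => by
      rw [← Module.End.mul_apply, ← (hPs t).eq, Module.End.mul_apply, e2, map_zero]
    -- `g` is a pointwise finite sum of translates of `T₁` and `T₂`, and translations commute with
    -- `P`.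
    let f : ℕ → ℤ × ℤ × ℤ → V := fun i => ((-1 : ℂ) ^ i * ((Ring.choose l i : ℤ) : ℂ)) •
      (shift (l - i, (i : ℤ), 0) T₁ - (-1 : ℂ) ^ l • shift ((i : ℤ), l - i, 0) T₂)
    have hPf : ∀ i, P (f i) = 0 := fun i => by
      simp only [f, map_smul, map_sub, e3, e4, smul_zero, sub_zero]
    have hf : ∀ p, ∀ᶠ i in atTop, f i p = 0 := by
      intro p
      filter_upwards [ha.eventually_nat p.1 w, hb.eventually_nat p.2.1 w,
        ha.eventually_nat p.1 (c p.2.2 w), hb.eventually_nat p.2.1 (c p.2.2 w)] with i h1 h2 h3 h4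
      simp [f, T₁, T₂, shift_apply, h1, h2, h3, h4]
    have hgf : g = fun p => ∑ᶠ i, f i p := by
      funext p
      simp only [g]
      rw [borcherds, borcherds, ← LinearMap.toAddMonoidHom_coe, AddMonoidHom.map_finsum,
        ← finsum_sub_distrib]
      · congr 1
        funext i
        simp only [f, T₁, T₂, shift_apply, Pi.smul_apply, Pi.sub_apply, Prod.fst_add, Prod.snd_add,
          add_zero, LinearMap.toAddMonoidHom_coe, map_smul, map_sub, add_sub_assoc]
        module
      · exact hasFiniteSupport_smul_of_eventually _ (by
          filter_upwards [ha.eventually_nat p.1 (c p.2.2 w),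
            hb.eventually_nat p.2.1 (c p.2.2 w)] with i h1 h2
          simp [h1, h2])
      · exact hasFiniteSupport_of_eventually (by
          filter_upwards [ha.eventually_nat p.1 w, hb.eventually_nat p.2.1 w] with i h1 h2
          simp [h1, h2])
      · exact hasFiniteSupport_smul_of_eventually _ (by
          filter_upwards [ha.eventually_nat p.1 w, hb.eventually_nat p.2.1 w] with i h1 h2
          simp [h1, h2])
    obtain ⟨k1, k2⟩ := diff_pow_finsum (0, 1, 0) (0, 0, 1) Q f hf
    obtain ⟨-, k3⟩ := diff_pow_finsum (1, 0, 0) (0, 0, 1) Q _ k1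
    rw [hgf, k2, k3]
    funext p
    refine finsum_eq_zero_of_forall_eq_zero fun i => ?_
    exact congrFun (hPf i) p
  have hYZ : (diff (0, 1, 0) (0, 0, 1) ^ (K + Q)) ((diff (0, 1, 0) (0, 0, 1) ^ Q) g) = 0 := by
    have hd : (diff (0, 1, 0) (0, 0, 1) : Module.End ℂ (ℤ × ℤ × ℤ → V)) =
        diff (0, 1, 0) (1, 0, 0) + diff (1, 0, 0) (0, 0, 1) := by
      simp only [diff, sub_add_sub_cancel]
    rw [show (diff (0, 1, 0) (0, 0, 1) : Module.End ℂ (ℤ × ℤ × ℤ → V)) ^ (K + Q) =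
      (diff (0, 1, 0) (1, 0, 0) + diff (1, 0, 0) (0, 0, 1)) ^ (K + Q) by rw [hd]]
    refine add_pow_apply_eq_zero (commute_diff _ _ _ _) K Q _ ?_ hmain
    rw [← Module.End.mul_apply, ((commute_diff _ _ _ _).pow_pow _ _).eq, Module.End.mul_apply, hXY,
      map_zero]
  rw [← Module.End.mul_apply, ← pow_add] at hYZ
  have := diff_pow_eq_borcherds (isField_nthProd ha hb l) hc (s := (0, 1, 0)) (t := (0, 0, 1))
    {p | p.1 = 0} (by simp) (α := fun p => p.2.1) (β := fun p => p.2.2) (w := fun _ => w) (by simp)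
    (by simp) (f := g) (fun p hp => by simp [g, nthProd_apply, show p.1 = 0 from hp])
    (K + Q + Q) (0, m, n) rfl
  rw [← this, hYZ]
  rfl

end Dong

end VertexField

end

/-! ### Reconstruction of a vertex algebra from mutually local fields. -/

noncomputable section

namespace VertexField

open Filter

section Reconstruction

variable {V : Type*} [AddCommGroup V] [Module ℂ V] {a b c : ℤ → Module.End ℂ V}

/-- Translation covariance `[D, a n] = -n a (n - 1)`. -/
def IsCovariant (D : Module.End ℂ V) (a : ℤ → Module.End ℂ V) : Prop :=
  ∀ n v, D (a n v) = a n (D v) - (n : ℂ) • a (n - 1) v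

theorem nthProd_vac_of_nonneg (ha : IsField a) (hb : IsField b) {vac : V}
    (hav : ∀ n, 0 ≤ n → a n vac = 0) (hbv : ∀ n, 0 ≤ n → b n vac = 0) (l n : ℤ) (hn : 0 ≤ n) :
    nthProd a b ha hb l n vac = 0 := by
  rw [nthProd_apply, borcherds, finsum_eq_zero_of_forall_eq_zero]
  intro i
  rw [hav _ (by omega), hbv _ (by omega)]
  simp

/-- Only the term `i = 0` survives on the vacuum. In terms of states: the state of the `l`-th
product of `a` and `b` is `a l` applied to the state of `b`. -/
theorem nthProd_neg_one_vac (ha : IsField a) (hb : IsField b) {vac : V}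
    (hav : ∀ n, 0 ≤ n → a n vac = 0) (hbv : ∀ n, 0 ≤ n → b n vac = 0) (l : ℤ) :
    nthProd a b ha hb l (-1) vac = a l (b (-1) vac) := by
  rw [nthProd_apply, borcherds_eq_binomSum, binomSum_eq_apply_zero]
  · rw [hav _ (by simp)]
    simp
  · intro i hi
    rw [hav _ (by omega), hbv _ (by omega)]
    simp

theorem IsCovariant.nthProd {D : Module.End ℂ V} (ha : IsField a) (hb : IsField b)
    (hDa : IsCovariant D a) (hDb : IsCovariant D b) (l : ℤ) :
    IsCovariant D (nthProd a b ha hb l) := by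
  intro n w
  let G : ℕ → V := fun i => (-1 : ℂ) ^ i •
    ((-1 : ℂ) ^ l • b (n + l - i) (a (-1 + i) w) - a (0 + l - i) (b (n - 1 + i) w))
  have hG : ∀ᶠ i in atTop, G i = 0 := by
    filter_upwards [ha.eventually_nat (-1) w, hb.eventually_nat (n - 1) w] with i h1 h2
    simp [G, h1, h2]
  have hG1 : ∀ᶠ i : ℕ in atTop, (i : ℂ) • G i = 0 := hG.mono fun i hi => by simp [hi]
  have hG2 : ∀ᶠ i : ℕ in atTop, ((l : ℂ) - i) • G (i + 1) = 0 :=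
    (eventually_shift hG).mono fun i hi => by simp [hi]
  -- Applying `D` termwise leaves, besides the wanted terms, multiples by `i` and by `l - i` of
  -- shifted terms; these cancel by absorption, added here in the form of a vanishing sum.
  have key := sub_eq_zero.2 (binomSum_absorb l hG)
  have t1 := eventually_borcherds_term ha hb l 0 n (D w)
  have t2 : ∀ᶠ i : ℕ in atTop, (n : ℂ) • ((-1 : ℂ) ^ i •
      (a (0 + l - i) (b (n - 1 + i) w) - (-1 : ℂ) ^ l • b (n - 1 + l - i) (a (0 + i) w))) = 0 :=
    (eventually_borcherds_term ha hb l 0 (n - 1) w).mono fun i hi => by rw [hi, smul_zero]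
  rw [← binomSum_sub _ hG1 hG2] at key
  simp only [nthProd_apply, borcherds_eq_binomSum]
  rw [map_binomSum _ _ (eventually_borcherds_term ha hb l 0 n w), ← binomSum_smul,
    ← binomSum_sub _ t1 t2, ← add_zero (binomSum l fun i => _ - _), ← key, ← binomSum_add]
  · congr 1
    funext i
    have i1 : n + (i : ℤ) - 1 = n - 1 + i := by ring
    have i2 : (0 : ℤ) + i - 1 = -1 + i := by ring
    have i3 : n + l - (i : ℤ) - 1 = n - 1 + l - i := by ring
    have i4 : n + l - ((i + 1 : ℕ) : ℤ) = n - 1 + l - i := by push_cast; ring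
    have i5 : -1 + ((i + 1 : ℕ) : ℤ) = 0 + i := by push_cast; ring
    have i6 : n - 1 + ((i + 1 : ℕ) : ℤ) = n + i := by push_cast; ring
    have i7 : 0 + l - ((i + 1 : ℕ) : ℤ) = 0 + l - i - 1 := by push_cast; ring
    simp only [G, map_smul, map_sub, hDa _ _, hDb _ _, i1, i2, i3, i4, i5, i6, i7, pow_succ]
    push_cast
    module
  · filter_upwards [t1, t2] with i h1 h2
    rw [h1, h2, sub_zero]
  · filter_upwards [hG1, hG2] with i h1 h2
    rw [h1, h2, sub_zero]

/-- If `c` is local to `a` and all modes of `c` kill `w`, then they kill all `a n w`. -/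
theorem IsLocal.apply_eq_zero {K : Submodule ℂ V} (ha : IsField a) (h : IsLocal c a)
    (hK : ∀ n v, v ∈ K → a n v ∈ K) {w : V} (hw : ∀ n, c n w ∈ K) (m n : ℤ) :
    c m (a n w) ∈ K := by
  obtain ⟨N, hN⟩ := h
  obtain ⟨M, hM⟩ := eventually_atTop.1 (ha w)
  suffices H : ∀ (j : ℕ) (m n : ℤ), M - j ≤ n → c m (a n w) ∈ K from
    H (M - n).toNat m n (by omega)
  intro j
  induction j with
  | zero =>
    intro m n hn
    rw [hM n (by simpa using hn), map_zero]
    exact zero_mem _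
  | succ j ih =>
    intro m n hn
    -- The first index `m - N` makes `c m (a n w)` appear in the term `i = 0`; every other term has
    -- `c` on `a (n + i) w` with `i > 0`, covered by the descending induction on `n`, or `a` on some
    -- `c _ w ∈ K`.
    have h0 := hN N le_rfl (m - N) n w
    have hterm : ∀ i : ℕ, i ≠ 0 → ((-1 : ℂ) ^ i * ((Ring.choose (N : ℤ) i : ℤ) : ℂ)) •
        (c (m - N + N - i) (a (n + i) w) - (-1 : ℂ) ^ (N : ℤ) • a (n + N - i) (c (m - N + i) w))
        ∈ K := fun i hi =>
      K.smul_mem _ (K.sub_mem (ih _ _ (by push_cast at hn; omega))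
        (K.smul_mem _ (hK _ _ (hw _))))
    rw [borcherds, finsum_eq_sum_of_support_subset (s := Finset.range (N + 1)),
      ← Finset.add_sum_erase _ _ (Finset.mem_range.2 N.succ_pos)] at h0
    · have h1 := K.neg_mem (K.sum_mem (t := (Finset.range (N + 1)).erase 0)
        fun i hi => hterm i (Finset.ne_of_mem_erase hi))
      rw [← eq_neg_iff_add_eq_zero] at h0
      rw [← h0] at h1
      have h2 := K.add_mem h1 (K.smul_mem ((-1 : ℂ) ^ N) (hK (n + N) _ (hw (m - N))))
      simpa using h2
    · intro i hi
      by_contra h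
      refine hi ?_
      have : N < i := by simpa using h
      simp only [Ring.choose_natCast, Nat.choose_eq_zero_of_lt this]
      simp

variable {ι : Type*}

/-- The fields that are local to the family `g`, create from the vacuum and are translation
covariant. -/
def creativeFields (vac : V) (D : Module.End ℂ V) (g : ι → ℤ → Module.End ℂ V)
    (hg : ∀ i, IsField (g i)) : Submodule ℂ (ℤ → Module.End ℂ V) where
  carrier := {c | IsField c ∧ (∀ i, IsLocal c (g i)) ∧ (∀ n, 0 ≤ n → c n vac = 0) ∧
    IsCovariant D c}
  zero_mem' := ⟨isField_zero, fun i => isLocal_zero_left _, by simp, fun n v => by simp⟩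
  add_mem' := by
    rintro c c' ⟨h1, h2, h3, h4⟩ ⟨h1', h2', h3', h4'⟩
    refine ⟨h1.add h1', fun i => (h2 i).add_left h1 h1' (hg i) (h2' i), fun n hn => ?_,
      fun n v => ?_⟩
    · simp [h3 n hn, h3' n hn]
    · simp only [Pi.add_apply, LinearMap.add_apply, map_add, h4 _ _, h4' _ _]
      module
  smul_mem' := by
    rintro r c ⟨h1, h2, h3, h4⟩
    refine ⟨h1.smul r, fun i => (h2 i).smul_left r, fun n hn => ?_, fun n v => ?_⟩
    · simp [h3 n hn]
    · simp only [Pi.smul_apply, LinearMap.smul_apply, map_smul, h4 _ _]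
      module

/-- The reconstruction theorem. -/
theorem exists_vertexAlgebra (vac : V) (D : Module.End ℂ V) (g : ι → ℤ → Module.End ℂ V)
    (hfield : ∀ i, IsField (g i)) (hlocal : ∀ i j, IsLocal (g i) (g j))
    (hvac : ∀ i n, 0 ≤ n → g i n vac = 0) (hDvac : D vac = 0) (hD : ∀ i, IsCovariant D (g i))
    (hspan : ∀ K : Submodule ℂ V, vac ∈ K → (∀ i n v, v ∈ K → g i n v ∈ K) → K = ⊤) :
    ∃ S : VertexAlgebra V, S.vac = vac ∧ ∀ i n v, S.prod n (g i (-1) vac) v = g i n v := by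
  set 𝓕 := creativeFields vac D g hfield
  have gmem : ∀ i, g i ∈ 𝓕 := fun i => ⟨hfield i, hlocal i, hvac i, hD i⟩
  -- closure under products with a field local to everything in sight
  have pmem : ∀ a b (ha : a ∈ 𝓕) (hb : b ∈ 𝓕), IsLocal a b → ∀ l,
      nthProd a b ha.1 hb.1 l ∈ 𝓕 := fun a b ha hb hab l =>
    ⟨isField_nthProd _ _ _, fun i => hab.nthProd _ _ (hfield i) (ha.2.1 i) (hb.2.1 i) l,
      nthProd_vac_of_nonneg _ _ ha.2.2.1 hb.2.2.1 l, ha.2.2.2.nthProd _ _ hb.2.2.2 l⟩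
  -- the state map
  let ev : 𝓕 →ₗ[ℂ] V :=
    { toFun := fun c => c.1 (-1) vac
      map_add' := fun _ _ => rfl
      map_smul' := fun _ _ => rfl }
  -- Goddard's uniqueness argument: if `c (-1)` kills the vacuum, covariance makes all `c n` kill
  -- it, and locality with the generators spreads this to all of `V`.
  have inj : Function.Injective ev := by
    rw [← LinearMap.ker_eq_bot, LinearMap.ker_eq_bot']
    rintro ⟨c, hc⟩ (h : c (-1) vac = 0)
    have cv : ∀ n, c n vac = 0 := by
      have neg : ∀ k : ℕ, c (-1 - k) vac = 0 := by
        intro k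
        induction k with
        | zero => simpa using h
        | succ k ih =>
          have := hc.2.2.2 (-1 - k) vac
          rw [ih, hDvac, map_zero, map_zero, zero_sub, eq_comm, neg_eq_zero, smul_eq_zero] at this
          rcases this with h0 | h0
          · exfalso
            norm_cast at h0
            omega
          · rw [← h0]
            congr 2
            push_cast
            ring
      intro n
      rcases le_or_gt 0 n with hn | hn
      · exact hc.2.2.1 n hn
      · have := neg (-1 - n).toNat
        rwa [show (-1 - ((-1 - n).toNat : ℤ)) = n by omega] at this
    have top := hspan (⨅ n, LinearMap.ker (c n)) (by simpa using cv) (by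
      intro i n v hv
      simp only [Submodule.mem_iInf, LinearMap.mem_ker] at hv ⊢
      intro m
      simpa using (hc.2.1 i).apply_eq_zero (K := ⊥) (hfield i) (by simp +contextual)
        (by simpa using hv) m n)
    ext n v
    have : v ∈ ⨅ n, LinearMap.ker (c n) := top ▸ Submodule.mem_top
    simp only [Submodule.mem_iInf, LinearMap.mem_ker] at this
    simp [this n]
  let idF : ℤ → Module.End ℂ V := fun n => if n = -1 then LinearMap.id else 0
  have idField : IsField idF := fun v => by
    filter_upwards [eventually_ge_atTop 0] with n hn
    simp [idF, show n ≠ -1 by omega]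
  have idLocal : ∀ b, IsField b → IsLocal idF b := fun b hb =>
    isLocal_of_commute idField hb fun m n w => by
      by_cases hm : m = -1 <;> simp [idF, hm]
  have idmem : idF ∈ 𝓕 := by
    refine ⟨idField, fun i => idLocal _ (hfield i), fun n hn => ?_, fun n v => ?_⟩
    · simp [idF, show n ≠ -1 by omega]
    · by_cases hn : n = -1
      · simp [idF, hn]
      · by_cases hn' : n = 0
        · simp [idF, hn']
        · simp [idF, hn, show n - 1 ≠ -1 by omega]
  -- a subspace of fields containing the identity and stable under products with the generators
  have full : ∀ 𝓖 : Submodule ℂ 𝓕, ⟨idF, idmem⟩ ∈ 𝓖 →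
      (∀ i n (c : 𝓕), c ∈ 𝓖 → ⟨_, pmem _ _ (gmem i) c.2 (c.2.2.1 i).symm n⟩ ∈ 𝓖) →
      𝓖.map ev = ⊤ := by
    intro 𝓖 h1 h2
    refine hspan _ ⟨_, h1, by simp [ev, idF]⟩ ?_
    rintro i n _ ⟨c, hc, rfl⟩
    exact ⟨_, h2 i n c hc, nthProd_neg_one_vac (hfield i) c.2.1 (hvac i) c.2.2.2.1 n⟩
  have surj : Function.Surjective ev := by
    rw [← LinearMap.range_eq_top, LinearMap.range_eq_map]
    exact full ⊤ trivial fun _ _ _ _ => trivial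
  -- Membership in `𝓕` gives locality with the generators only. For fixed `c`, the fields local to
  -- `c` are stable under products with generators by Dong's lemma, so their states exhaust `V`, and
  -- injectivity of `ev` shows that they are all of `𝓕`.
  have allLocal : ∀ c c' : 𝓕, IsLocal c.1 c'.1 := by
    intro c c'
    let 𝓖 : Submodule ℂ 𝓕 :=
      { carrier := {e | IsLocal e.1 c.1}
        zero_mem' := isLocal_zero_left _
        add_mem' := fun {e e'} h h' => IsLocal.add_left e.2.1 e'.2.1 c.2.1 h h'
        smul_mem' := fun r e h => IsLocal.smul_left r h }
    have h𝓖 := full 𝓖 (idLocal _ c.2.1) fun i n e he =>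
      IsLocal.nthProd (hfield i) e.2.1 c.2.1 (e.2.2.1 i).symm (c.2.2.1 i).symm he n
    have : ev c' ∈ 𝓖.map ev := h𝓖 ▸ Submodule.mem_top
    obtain ⟨e, he, hee⟩ := this
    rw [inj hee] at he
    exact he.symm
  let Y : V ≃ₗ[ℂ] 𝓕 := (LinearEquiv.ofBijective ev ⟨inj, surj⟩).symm
  have Yev : ∀ v, (Y v).1 (-1) vac = v := fun v =>
    (LinearEquiv.ofBijective ev ⟨inj, surj⟩).apply_symm_apply v
  have Yuniq : ∀ c : 𝓕, Y (c.1 (-1) vac) = c := fun c =>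
    (LinearEquiv.ofBijective ev ⟨inj, surj⟩).symm_apply_apply c
  have Yvac : Y vac = ⟨idF, idmem⟩ := by
    have := Yuniq ⟨idF, idmem⟩
    simpa [idF] using this
  -- Both fields lie in `𝓕` and have the same state.
  have Yprod : ∀ u v l, (Y ((Y u).1 l v)).1 = nthProd _ _ (Y u).2.1 (Y v).2.1 l := by
    intro u v l
    have := Yuniq ⟨_, pmem _ _ (Y u).2 (Y v).2 (allLocal _ _) l⟩
    dsimp only at this
    rw [nthProd_neg_one_vac (Y u).2.1 (Y v).2.1 (Y u).2.2.2.1 (Y v).2.2.2.1, Yev] at this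
    rw [this]
  refine ⟨{
    vac := vac
    prod := fun n =>
      { toFun := fun u => (Y u).1 n
        map_add' := fun u v => by simp
        map_smul' := fun r u => by simp }
    truncation := fun u v => eventually_atTop.1 ((Y u).2.1 v)
    vac_prod := fun n v => ?_
    prod_vac_of_nonneg := fun n v hn => (Y v).2.2.2.1 n hn
    prod_vac := Yev
    jacobi := fun u v w l m n => ?_ }, rfl, fun i n v => ?_⟩
  · change (Y vac).1 n v = _
    rw [Yvac]
    by_cases hn : n = -1 <;> simp [idF, hn]
  · have := (allLocal (Y u) (Y v)).jacobi (Y u).2.1 (Y v).2.1 l m n w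
    change ∑ᶠ i : ℕ, ((Ring.choose m i : ℤ) : ℂ) • (Y ((Y u).1 (l + i) v)).1 (m + n - i) w =
      borcherds (Y u).1 (Y v).1 l m n w
    rw [← this]
    simp only [Yprod]
    rfl
  · change (Y (g i (-1) vac)).1 n v = _
    rw [Yuniq ⟨g i, gmem i⟩]

end Reconstruction

end VertexField

end

noncomputable section

/-! ## Generalities on vertex algebras -/

namespace VertexAlgebra

open Filter VertexField

variable {V W : Type*} [AddCommGroup V] [Module ℂ V] [AddCommGroup W] [Module ℂ W]

section

variable (S : VertexAlgebra V)

theorem isField_prod (u : V) : IsField fun n => S.prod n u := fun v =>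
  eventually_atTop.2 (S.truncation u v)

theorem jacobi_binomSum (u v w : V) (l m n : ℤ) :
    binomSum m (fun i => S.prod (m + n - i) (S.prod (l + i) u v) w) =
      borcherds (fun n => S.prod n u) (fun n => S.prod n v) l m n w :=
  S.jacobi u v w l m n

/-- The associativity formula. -/
theorem prod_prod (u v w : V) (l n : ℤ) :
    S.prod n (S.prod l u v) w =
      borcherds (fun n => S.prod n u) (fun n => S.prod n v) l 0 n w := by
  have := S.jacobi_binomSum u v w l 0 n
  rw [binomSum_zero] at this
  simpa using this

/-- For `l` beyond the truncation bound all `u_{l+i} v` on the left of the Jacobi identity vanish.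
-/
theorem isLocal_prod (u v : V) : IsLocal (fun n => S.prod n u) fun n => S.prod n v := by
  obtain ⟨N, hN⟩ := S.truncation u v
  refine ⟨N.toNat, fun l hl m n w => ?_⟩
  rw [← jacobi_binomSum, binomSum, finsum_eq_zero_of_forall_eq_zero]
  intro i
  rw [hN _ (by omega)]
  simp

/-- The translation operator `v ↦ v_{-2} 𝟏`. -/
def transl : V →ₗ[ℂ] V := (S.prod (-2)).flip S.vac

theorem transl_apply (v : V) : S.transl v = S.prod (-2) v S.vac := rfl

/-- Associativity for `(u_n v)_{-2} 𝟏`; the vacuum leaves only the terms `i = 0` and `i = 1`. -/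
theorem transl_prod (u v : V) (n : ℤ) :
    S.transl (S.prod n u v) = S.prod n u (S.transl v) - (n : ℂ) • S.prod (n - 1) u v := by
  rw [transl_apply, prod_prod, borcherds_eq_binomSum]
  have h : ∀ i : ℕ, 2 ≤ i → (-1 : ℂ) ^ i • (S.prod (0 + n - i) u (S.prod (-2 + i) v S.vac) -
      (-1 : ℂ) ^ n • S.prod (-2 + n - i) v (S.prod (0 + i) u S.vac)) = 0 := by
    intro i hi
    rw [S.prod_vac_of_nonneg _ _ (by omega), S.prod_vac_of_nonneg _ _ (by omega)]
    simp
  rw [binomSum, finsum_eq_sum_of_support_subset (s := Finset.range 2)]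
  · rw [Finset.sum_range_succ, Finset.sum_range_succ, Finset.sum_range_zero, zero_add,
      S.prod_vac_of_nonneg _ u (by simp), S.prod_vac_of_nonneg _ u (by simp)]
    simp [transl_apply, S.prod_vac, sub_eq_add_neg]
  · intro i hi
    by_contra h'
    exact hi (smul_eq_zero_of_right _ (h i (Nat.succ_le_of_lt (by simpa using h'))))

theorem transl_vac : S.transl S.vac = 0 := by
  rw [transl_apply, S.vac_prod]
  simp

/-- The recursion behind `v_{-k-1} 𝟏 = D^k v / k!`. -/
theorem prod_neg_sub_one_vac (v : V) (k : ℕ) :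
    (k : ℂ) • S.prod (-k - 1) v S.vac = S.transl (S.prod (-k) v S.vac) := by
  rw [transl_prod, transl_vac, map_zero]
  simp

/-- A translation stable subspace is stable under `v ↦ v_n 𝟏`. -/
theorem prod_vac_mem {K : Submodule ℂ V} (hK : ∀ v ∈ K, S.transl v ∈ K) {v : V} (hv : v ∈ K)
    (n : ℤ) : S.prod n v S.vac ∈ K := by
  rcases le_or_gt 0 n with hn | hn
  · rw [S.prod_vac_of_nonneg n v hn]
    exact zero_mem _
  · have H : ∀ k : ℕ, S.prod (-k - 1) v S.vac ∈ K := by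
      intro k
      induction k with
      | zero => simpa [S.prod_vac] using hv
      | succ k ih =>
        have h := S.prod_neg_sub_one_vac v (k + 1)
        have h0 : ((k + 1 : ℕ) : ℂ) ≠ 0 := by exact_mod_cast k.succ_ne_zero
        rw [← (inv_smul_eq_iff₀ h0).2 h.symm]
        refine K.smul_mem _ (hK _ ?_)
        rw [show (-((k + 1 : ℕ) : ℤ)) = -k - 1 by push_cast; ring]
        exact ih
    have := H (-n - 1).toNat
    rwa [show (-((-n - 1).toNat : ℤ) - 1) = n by omega] at this

/-- A translation stable left ideal is an ideal. -/
theorem isIdeal_of_left {K : Submodule ℂ V} (hD : ∀ v ∈ K, S.transl v ∈ K)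
    (hK : ∀ (n : ℤ) (u v : V), v ∈ K → S.prod n u v ∈ K) : S.IsIdeal K := by
  refine fun n u v hv => ⟨hK n u v hv, ?_⟩
  obtain ⟨N, hN⟩ := S.truncation v u
  suffices H : ∀ (j : ℕ) (n : ℤ), N - j ≤ n → S.prod n v u ∈ K from
    H (N - n).toNat n (by omega)
  intro j
  induction j with
  | zero =>
    intro n hn
    rw [hN n (by simpa using hn)]
    exact zero_mem _
  | succ j ih =>
    intro n hn
    -- A substitute for skew symmetry. On the vacuum the right-hand side reduces to `v_n u -
    -- (-1)^(n+1) u_n v`, while the left-hand side contains only `(v_{n+1+i} u)_{-2-i} 𝟏`, in `K` by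
    -- induction and translation stability.
    have h := S.jacobi v u S.vac (n + 1) (-1) (-1)
    have left : ∑ᶠ i : ℕ, ((Ring.choose (-1) i : ℤ) : ℂ) •
        S.prod (-1 + -1 - i) (S.prod (n + 1 + i) v u) S.vac ∈ K :=
      finsum_induction (· ∈ K) (zero_mem _) (fun x y => K.add_mem) fun i =>
        K.smul_mem _ (S.prod_vac_mem hD (ih _ (by push_cast at hn; omega)) _)
    rw [h, finsum_eq_single _ 0] at left
    · have := K.add_mem left (K.smul_mem ((-1 : ℂ) ^ (n + 1)) (hK n u v hv))
      simpa [S.prod_vac, show -1 + (n + 1) = n by ring] using this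
    · intro i hi
      rw [S.prod_vac_of_nonneg _ u (by omega), S.prod_vac_of_nonneg _ v (by omega)]
      simp

theorem IsIdeal.transl_mem {S : VertexAlgebra V} {I : Submodule ℂ V} (hI : S.IsIdeal I) {v : V}
    (hv : v ∈ I) : S.transl v ∈ I := (hI (-2) S.vac v hv).2

theorem IsIdeal.eq_top {S : VertexAlgebra V} {I : Submodule ℂ V} (hI : S.IsIdeal I)
    (h : S.vac ∈ I) : I = ⊤ :=
  (Submodule.eq_top_iff').2 fun v => by
    have := (hI (-1) v S.vac h).1
    rwa [S.prod_vac] at this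

/-- Maximal ideals are prime. -/
theorem IsMaximalIdeal.mem_or_mem {S : VertexAlgebra V} {J : Submodule ℂ V}
    (hJ : S.IsMaximalIdeal J) {u v : V} (h : ∀ n, S.prod n u v ∈ J) : u ∈ J ∨ v ∈ J := by
  obtain ⟨hI, htop, hmax⟩ := hJ
  -- The annihilator of `u` modulo `J`. Locality makes it an ideal containing `J`, so it is `J`,
  -- which then contains `v`, or everything, in which case `u = u_{-1} 𝟏 ∈ J`.
  let K : Submodule ℂ V := ⨅ n, J.comap (S.prod n u)
  have memK : ∀ x, x ∈ K ↔ ∀ n, S.prod n u x ∈ J := fun x => by simp [K]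
  have hK : S.IsIdeal K := by
    refine S.isIdeal_of_left (fun x hx => ?_) fun n w x hx => ?_
    · rw [memK] at hx ⊢
      intro n
      have := J.add_mem (hI.transl_mem (hx n)) (J.smul_mem (n : ℂ) (hx (n - 1)))
      rwa [transl_prod, sub_add_cancel] at this
    · rw [memK] at hx ⊢
      intro m
      exact (S.isLocal_prod u w).apply_eq_zero (S.isField_prod w)
        (fun n v hv => (hI n w v hv).1) hx m n
  have hJK : J ≤ K := fun x hx => (memK x).2 fun n => (hI n u x hx).1
  by_cases hKt : K = ⊤
  · left
    have : S.vac ∈ K := hKt ▸ Submodule.mem_top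
    have := (memK _).1 this (-1)
    rwa [S.prod_vac] at this
  · right
    rw [← hmax K hK hJK hKt]
    exact (memK v).2 h

/-- A set of vectors generates the vertex algebra if its modes span `V` from the vacuum. -/
def Generates (X : Set V) : Prop :=
  ∀ K : Submodule ℂ V, S.vac ∈ K → (∀ x ∈ X, ∀ n, ∀ v ∈ K, S.prod n x v ∈ K) → K = ⊤

variable {S}

/-- By associativity the modes of `x_l y` are built from those of `x` and `y`, so the vectors whose
modes preserve `K` are closed under the generating operations. -/
theorem Generates.prod_mem {X : Set V} (hX : S.Generates X) {K : Submodule ℂ V}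
    (hK : ∀ x ∈ X, ∀ n, ∀ v ∈ K, S.prod n x v ∈ K) (n : ℤ) (u v : V) (hv : v ∈ K) :
    S.prod n u v ∈ K := by
  let L : Submodule ℂ V :=
    { carrier := {u | ∀ n, ∀ v ∈ K, S.prod n u v ∈ K}
      zero_mem' := fun n v _ => by simp
      add_mem' := fun {x y} hx hy n v hv => by
        rw [map_add, LinearMap.add_apply]
        exact K.add_mem (hx n v hv) (hy n v hv)
      smul_mem' := fun r x hx n v hv => by
        rw [map_smul, LinearMap.smul_apply]
        exact K.smul_mem _ (hx n v hv) }
  have hL : L = ⊤ := by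
    refine hX L (fun n v hv => ?_) fun x hx l y hy n v hv => ?_
    · rw [S.vac_prod]
      split_ifs
      exacts [hv, zero_mem _]
    · rw [prod_prod]
      exact finsum_induction (· ∈ K) (zero_mem _) (fun x y => K.add_mem) fun i =>
        K.smul_mem _ (K.sub_mem (hK x hx _ _ (hy _ _ hv))
          (K.smul_mem _ (hy _ _ (hK x hx _ _ hv))))
  have : u ∈ L := hL ▸ Submodule.mem_top
  exact this n v hv

theorem map_borcherds {a b : ℤ → Module.End ℂ V} {a' b' : ℤ → Module.End ℂ W} (ha : IsField a)
    (hb : IsField b) (φ : V →ₗ[ℂ] W) (h : ∀ n v, φ (a n v) = a' n (φ v))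
    (h' : ∀ n v, φ (b n v) = b' n (φ v)) (l m n : ℤ) (w : V) :
    φ (borcherds a b l m n w) = borcherds a' b' l m n (φ w) := by
  rw [borcherds_eq_binomSum, map_binomSum _ _ (eventually_borcherds_term ha hb l m n w),
    borcherds_eq_binomSum]
  simp [h, h']

/-- A linear map preserving the vacuum and the products with generators is a homomorphism. -/
theorem Generates.map_prod {X : Set V} (hX : S.Generates X) {T : VertexAlgebra W}
    (φ : V →ₗ[ℂ] W) (hvac : φ S.vac = T.vac)
    (h : ∀ x ∈ X, ∀ n v, φ (S.prod n x v) = T.prod n (φ x) (φ v)) (n : ℤ) (u v : V) :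
    φ (S.prod n u v) = T.prod n (φ u) (φ v) := by
  let L : Submodule ℂ V :=
    { carrier := {u | ∀ n v, φ (S.prod n u v) = T.prod n (φ u) (φ v)}
      zero_mem' := fun n v => by simp
      add_mem' := fun {x y} hx hy n v => by
        simp only [map_add, LinearMap.add_apply, hx n v, hy n v]
      smul_mem' := fun r x hx n v => by
        simp only [map_smul, LinearMap.smul_apply, hx n v] }
  have hL : L = ⊤ := by
    refine hX L (fun n v => ?_) fun x hx l y hy n v => ?_
    · rw [hvac, S.vac_prod, T.vac_prod]
      split_ifs <;> simp
    · rw [prod_prod, h x hx, prod_prod, map_borcherds (S.isField_prod x) (S.isField_prod y) φ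
        (h x hx) hy]
  have : u ∈ L := hL ▸ Submodule.mem_top
  exact this n v

end

end VertexAlgebra

end

noncomputable section

/-! ## Enveloping algebras -/

namespace UniversalEnvelopingAlgebra

variable {L : Type*} [LieRing L] [LieAlgebra ℂ L]

theorem ι_lie (x y : L) : ι ℂ x * ι ℂ y - ι ℂ y * ι ℂ x = ι ℂ ⁅x, y⁆ := by
  rw [LieHom.map_lie, LieRing.of_associative_ring_bracket]

/-- The lift of `ι`, corestricted to `T`, followed by the inclusion is the identity, by uniqueness
of lifts. -/
theorem eq_top_of_ι_mem (T : Subalgebra ℂ (UniversalEnvelopingAlgebra ℂ L))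
    (h : ∀ x, ι ℂ x ∈ T) : T = ⊤ := by
  let f : L →ₗ⁅ℂ⁆ T :=
    { toFun := fun x => ⟨ι ℂ x, h x⟩
      map_add' := fun x y => Subtype.ext (map_add _ x y)
      map_smul' := fun c x => Subtype.ext (map_smul _ c x)
      map_lie' := fun {x y} => Subtype.ext (by
        simp [LieRing.of_associative_ring_bracket]) }
  have hf : T.val.comp (lift ℂ f) = AlgHom.id ℂ _ := by
    apply hom_ext
    ext x
    change ((lift ℂ f (ι ℂ x) : T) : UniversalEnvelopingAlgebra ℂ L) = ι ℂ x
    rw [lift_ι_apply]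
    rfl
  rw [Algebra.eq_top_iff]
  intro x
  rw [← AlgHom.id_apply (R := ℂ) x, ← hf]
  exact (lift ℂ f x).2

/-- A subspace stable under the Lie algebra is stable under its enveloping algebra. -/
theorem smul_mem_of_ι_smul_mem {M : Type*} [AddCommGroup M] [Module ℂ M]
    [Module (UniversalEnvelopingAlgebra ℂ L) M] [IsScalarTower ℂ (UniversalEnvelopingAlgebra ℂ L) M]
    (K : Submodule ℂ M) (h : ∀ x : L, ∀ v ∈ K, ι ℂ x • v ∈ K)
    (u : UniversalEnvelopingAlgebra ℂ L) (v : M) (hv : v ∈ K) : u • v ∈ K := by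
  let T : Subalgebra ℂ (UniversalEnvelopingAlgebra ℂ L) :=
    { carrier := {u | ∀ v ∈ K, u • v ∈ K}
      mul_mem' := fun {x y} hx hy v hv => by
        rw [mul_smul]
        exact hx _ (hy _ hv)
      add_mem' := fun {x y} hx hy v hv => by
        rw [add_smul]
        exact K.add_mem (hx _ hv) (hy _ hv)
      algebraMap_mem' := fun r v hv => by
        rw [algebraMap_smul]
        exact K.smul_mem _ hv }
  have : u ∈ T := eq_top_of_ι_mem T h ▸ Algebra.mem_top
  exact this v hv

/-- A derivation of a Lie algebra extends to its enveloping algebra. -/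
theorem exists_derivation (δ : L →ₗ[ℂ] L) (hδ : ∀ x y, δ ⁅x, y⁆ = ⁅δ x, y⁆ + ⁅x, δ y⁆) :
    ∃ E : UniversalEnvelopingAlgebra ℂ L →ₗ[ℂ] UniversalEnvelopingAlgebra ℂ L,
      (∀ x y, E (x * y) = E x * y + x * E y) ∧ ∀ x, E (ι ℂ x) = ι ℂ (δ x) := by
  let U := UniversalEnvelopingAlgebra ℂ L
  let F : U →ₐ[ℂ] TrivSqZeroExt U U := lift ℂ
    { toFun := fun x => TrivSqZeroExt.inl (ι ℂ x) + TrivSqZeroExt.inr (ι ℂ (δ x))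
      map_add' := fun x y => by
        ext <;> simp
      map_smul' := fun c x => by
        ext <;> simp
      map_lie' := fun {x y} => by
        ext
        · simp [LieRing.of_associative_ring_bracket]
        · simp only [hδ, map_add, LieHom.map_lie, LieRing.of_associative_ring_bracket,
            TrivSqZeroExt.snd_add, TrivSqZeroExt.snd_sub, TrivSqZeroExt.snd_mul,
            TrivSqZeroExt.fst_add, TrivSqZeroExt.fst_inl, TrivSqZeroExt.fst_inr,
            TrivSqZeroExt.snd_inl, TrivSqZeroExt.snd_inr, zero_add, add_zero, smul_eq_mul,
            MulOpposite.smul_eq_mul_unop, MulOpposite.unop_op]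
          abel }
  have hF : ∀ x, F (ι ℂ x) = TrivSqZeroExt.inl (ι ℂ x) + TrivSqZeroExt.inr (ι ℂ (δ x)) := fun x =>
    lift_ι_apply ℂ _ x
  have fst : ∀ x, (F x).fst = x := by
    have h : (TrivSqZeroExt.fstHom ℂ U U).comp F = AlgHom.id ℂ U := by
      apply hom_ext
      ext y
      change (F (ι ℂ y)).fst = ι ℂ y
      rw [hF]
      simp
    exact fun x => DFunLike.congr_fun h x
  refine ⟨{ toFun := fun x => (F x).snd, map_add' := fun x y => by simp,
            map_smul' := fun c x => by simp }, fun x y => ?_, fun x => ?_⟩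
  · change (F (x * y)).snd = (F x).snd * y + x * (F y).snd
    rw [map_mul, TrivSqZeroExt.snd_mul, fst, fst]
    simp only [smul_eq_mul, MulOpposite.smul_eq_mul_unop, MulOpposite.unop_op]
    exact add_comm _ _
  · change (F (ι ℂ x)).snd = _
    rw [hF]
    simp

/-- Maps out of a cyclic module `U(L) / I` into a representation of `L`. -/
theorem exists_linearMap_quotient {M : Type*} [AddCommGroup M] [Module ℂ M]
    (ρ : L →ₗ⁅ℂ⁆ Module.End ℂ M) (w : M) (X : Set (UniversalEnvelopingAlgebra ℂ L))
    (hX : ∀ x ∈ X, lift ℂ ρ x w = 0) :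
    ∃ ψ : (UniversalEnvelopingAlgebra ℂ L ⧸ Submodule.span (UniversalEnvelopingAlgebra ℂ L) X)
        →ₗ[ℂ] M,
      (∀ u, ψ (Submodule.Quotient.mk u) = lift ℂ ρ u w) ∧
        ∀ u v, ψ (u • v) = lift ℂ ρ u (ψ v) := by
  set I := Submodule.span (UniversalEnvelopingAlgebra ℂ L) X
  have hI : ∀ x ∈ I, lift ℂ ρ x w = 0 := by
    intro x hx
    induction hx using Submodule.span_induction with
    | zero => simp
    | add x y _ _ hx hy => simp [hx, hy]
    | smul p x _ hx => rw [smul_eq_mul, map_mul, Module.End.mul_apply, hx, map_zero]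
    | mem x h => exact hX x h
  let f : UniversalEnvelopingAlgebra ℂ L →ₗ[ℂ] M :=
    { toFun := fun u => lift ℂ ρ u w
      map_add' := fun x y => by simp
      map_smul' := fun c x => by simp }
  let ψ : (UniversalEnvelopingAlgebra ℂ L ⧸ I) →ₗ[ℂ] M :=
    (I.restrictScalars ℂ).liftQ f (fun x hx => hI x hx) ∘ₗ
      (Submodule.Quotient.restrictScalarsEquiv ℂ I).symm.toLinearMap
  have hψ : ∀ u, ψ (Submodule.Quotient.mk u) = lift ℂ ρ u w := fun u => rfl
  refine ⟨ψ, hψ, fun u v => ?_⟩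
  obtain ⟨v, rfl⟩ := Submodule.Quotient.mk_surjective _ v
  rw [← Submodule.Quotient.mk_smul, hψ, hψ, smul_eq_mul, map_mul, Module.End.mul_apply]

end UniversalEnvelopingAlgebra

/-! ## The Heisenberg vertex algebra -/

namespace HeisenbergAlg

open Filter VertexField UniversalEnvelopingAlgebra

/-- The element `∑ f n h(n)`. -/
def ofFinsupp : (ℤ →₀ ℂ) →ₗ[ℂ] HeisenbergAlg := LinearMap.inl ℂ (ℤ →₀ ℂ) ℂ

/-- The central element `𝐤`. -/
def central : HeisenbergAlg := LinearMap.inr ℂ (ℤ →₀ ℂ) ℂ 1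

/-- The coefficients of the `h(n)`. -/
def coeffs : HeisenbergAlg →ₗ[ℂ] (ℤ →₀ ℂ) := LinearMap.fst ℂ (ℤ →₀ ℂ) ℂ

/-- The coefficient of `𝐤`. -/
def level : HeisenbergAlg →ₗ[ℂ] ℂ := LinearMap.snd ℂ (ℤ →₀ ℂ) ℂ

theorem coeffs_ofFinsupp (f : ℤ →₀ ℂ) : coeffs (ofFinsupp f) = f := rfl

theorem level_ofFinsupp (f : ℤ →₀ ℂ) : level (ofFinsupp f) = 0 := rfl

theorem coeffs_central : coeffs central = 0 := rfl

theorem level_central : level central = 1 := rfl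

theorem eq_add_central (x : HeisenbergAlg) : x = ofFinsupp (coeffs x) + level x • central :=
  Prod.ext (by change x.1 = x.1 + x.2 • 0; simp) (by change x.2 = 0 + x.2 • 1; simp)

theorem lie_eq (x y : HeisenbergAlg) : ⁅x, y⁆ = cocycle (coeffs x) (coeffs y) • central :=
  Prod.ext (by change (0 : ℤ →₀ ℂ) = _ • 0; simp)
    (by change cocycle (coeffs x) (coeffs y) = cocycle (coeffs x) (coeffs y) • 1; simp)

theorem envMode_eq (n : ℤ) : envMode n = ι ℂ (ofFinsupp (Finsupp.single n 1)) := rfl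

theorem envK_eq : envK = ι ℂ central := rfl

/-- The operator `∑ f n op(n)`. -/
def opSum {M : Type*} [AddCommGroup M] [Module ℂ M] (op : ℤ → Module.End ℂ M) :
    (ℤ →₀ ℂ) →ₗ[ℂ] Module.End ℂ M :=
  Finsupp.lsum ℂ fun n : ℤ => LinearMap.toSpanSingleton ℂ _ (op n)

theorem opSum_single {M : Type*} [AddCommGroup M] [Module ℂ M] (op : ℤ → Module.End ℂ M) (n : ℤ)
    (x : ℂ) : opSum op (Finsupp.single n x) = x • op n := by
  rw [opSum, Finsupp.lsum_single, LinearMap.toSpanSingleton_apply]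

theorem opSum_commutator {M : Type*} [AddCommGroup M] [Module ℂ M] (op : ℤ → Module.End ℂ M)
    (hop : ∀ m n, op m * op n - op n * op m = if m + n = 0 then (m : ℂ) • 1 else 0)
    (f g : ℤ →₀ ℂ) : opSum op f * opSum op g - opSum op g * opSum op f = cocycle f g • 1 := by
  induction f using Finsupp.induction_linear with
  | zero => simp
  | add f f' hf hf' =>
    rw [map_add, map_add, LinearMap.add_apply, add_smul, ← hf, ← hf', add_mul, mul_add]
    abel
  | single m x =>
  induction g using Finsupp.induction_linear with
  | zero => simp
  | add g g' hg hg' =>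
    rw [map_add, map_add, add_smul, ← hg, ← hg', add_mul, mul_add]
    abel
  | single n y =>
  rw [cocycle_single, opSum_single, opSum_single, smul_mul_smul_comm, smul_mul_smul_comm,
    mul_comm y x, ← smul_sub, hop]
  split_ifs
  · rw [smul_smul]
    congr 1
    ring
  · simp

/-- The Lie algebra homomorphism defined by operators with Heisenberg commutators. -/
def rep {M : Type*} [AddCommGroup M] [Module ℂ M] (op : ℤ → Module.End ℂ M)
    (hop : ∀ m n, op m * op n - op n * op m = if m + n = 0 then (m : ℂ) • 1 else 0) :
    HeisenbergAlg →ₗ⁅ℂ⁆ Module.End ℂ M where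
  toFun x := opSum op (coeffs x) + level x • 1
  map_add' x y := by
    simp only [map_add, add_smul]
    abel
  map_smul' c x := by
    simp only [map_smul, RingHom.id_apply, smul_add, smul_assoc]
  map_lie' := by
    intro x y
    rw [lie_eq, map_smul coeffs, map_smul level, coeffs_central, level_central, smul_zero,
      map_zero, zero_add,
      smul_eq_mul, mul_one, ← opSum_commutator op hop, LieRing.of_associative_ring_bracket]
    simp only [add_mul, mul_add, smul_mul_assoc, mul_smul_comm, one_mul, mul_one]
    module

theorem rep_apply {M : Type*} [AddCommGroup M] [Module ℂ M] (op : ℤ → Module.End ℂ M)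
    (hop : ∀ m n, op m * op n - op n * op m = if m + n = 0 then (m : ℂ) • 1 else 0)
    (x : HeisenbergAlg) : rep op hop x = opSum op (coeffs x) + level x • 1 := rfl

theorem rep_mode {M : Type*} [AddCommGroup M] [Module ℂ M] (op : ℤ → Module.End ℂ M)
    (hop : ∀ m n, op m * op n - op n * op m = if m + n = 0 then (m : ℂ) • 1 else 0) (n : ℤ) :
    lift ℂ (rep op hop) (envMode n) = op n := by
  rw [envMode_eq, lift_ι_apply, rep_apply, coeffs_ofFinsupp, level_ofFinsupp, opSum_single]
  simp

theorem rep_k {M : Type*} [AddCommGroup M] [Module ℂ M] (op : ℤ → Module.End ℂ M)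
    (hop : ∀ m n, op m * op n - op n * op m = if m + n = 0 then (m : ℂ) • 1 else 0) :
    lift ℂ (rep op hop) envK = 1 := by
  rw [envK_eq, lift_ι_apply, rep_apply, coeffs_central, level_central]
  simp

/-- The universal property of `M(1)`. -/
theorem exists_fock_map {M : Type*} [AddCommGroup M] [Module ℂ M] (op : ℤ → Module.End ℂ M)
    (hop : ∀ m n, op m * op n - op n * op m = if m + n = 0 then (m : ℂ) • 1 else 0) (w : M)
    (hw : ∀ n, 0 ≤ n → op n w = 0) :
    ∃ ψ : Fock →ₗ[ℂ] M, ψ fockVac = w ∧ ∀ n v, ψ (envMode n • v) = op n (ψ v) := by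
  obtain ⟨ψ, h1, h2⟩ := exists_linearMap_quotient (rep op hop) w
    ({x | ∃ n : ℤ, 0 ≤ n ∧ x = envMode n} ∪ {envK - 1}) (by
      rintro x (⟨n, hn, rfl⟩ | rfl)
      · rw [rep_mode, hw n hn]
      · simp [rep_k])
  refine ⟨ψ, ?_, fun n v => ?_⟩
  · refine (h1 1).trans ?_
    simp
  · have := h2 (envMode n) v
    rwa [rep_mode] at this

theorem envMode_commutator (m n : ℤ) :
    envMode m * envMode n - envMode n * envMode m =
      (if m + n = 0 then (m : ℂ) else 0) • envK := by
  rw [envMode_eq, envMode_eq, ι_lie, lie_eq, coeffs_ofFinsupp, coeffs_ofFinsupp, cocycle_single,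
    map_smul, envK_eq]
  simp

theorem envK_commute (x : UniversalEnvelopingAlgebra ℂ HeisenbergAlg) : Commute envK x := by
  have h : Subalgebra.centralizer ℂ {envK} = ⊤ := eq_top_of_ι_mem _ fun y => by
    rw [Subalgebra.mem_centralizer_iff]
    rintro _ rfl
    rw [← sub_eq_zero, envK_eq, ι_lie, lie_eq, coeffs_central]
    simp
  have hx : x ∈ Subalgebra.centralizer ℂ {envK} := h ▸ Algebra.mem_top
  exact (Subalgebra.mem_centralizer_iff ℂ).1 hx _ rfl

/-- The central `𝐤` can be moved next to the generating vector, where it acts as `1`. -/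
theorem envK_smul (v : Fock) : envK • v = v := by
  obtain ⟨x, rfl⟩ := Submodule.Quotient.mk_surjective _ v
  rw [← Submodule.Quotient.mk_smul, Submodule.Quotient.eq, smul_eq_mul, (envK_commute x).eq,
    ← mul_sub_one, ← smul_eq_mul]
  exact Submodule.smul_mem _ _ (Submodule.subset_span (Or.inr rfl))

theorem mode_commutator (m n : ℤ) (v : Fock) :
    envMode m • envMode n • v - envMode n • envMode m • v =
      if m + n = 0 then (m : ℂ) • v else 0 := by
  rw [← mul_smul, ← mul_smul, ← sub_smul, envMode_commutator, smul_assoc, envK_smul]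
  split_ifs <;> simp

theorem mode_vac (n : ℤ) (hn : 0 ≤ n) : envMode n • fockVac = 0 := by
  change Submodule.Quotient.mk (envMode n • 1) = _
  rw [Submodule.Quotient.mk_eq_zero, smul_eq_mul, mul_one]
  exact Submodule.subset_span (Or.inl ⟨n, hn, rfl⟩)

theorem fock_eq_top (K : Submodule ℂ Fock) (hvac : fockVac ∈ K)
    (h : ∀ n, ∀ v ∈ K, envMode n • v ∈ K) : K = ⊤ := by
  rw [Submodule.eq_top_iff']
  intro v
  obtain ⟨x, rfl⟩ := Submodule.Quotient.mk_surjective _ v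
  have hx : (Submodule.Quotient.mk x : Fock) = x • fockVac := by
    change _ = Submodule.Quotient.mk (x • 1)
    rw [smul_eq_mul, mul_one]
  rw [hx]
  refine smul_mem_of_ι_smul_mem K ?_ x _ hvac
  intro y v hv
  rw [eq_add_central y, map_add, map_smul, add_smul, smul_assoc, ← envK_eq, envK_smul]
  refine K.add_mem ?_ (K.smul_mem _ hv)
  induction coeffs y using Finsupp.induction_linear with
  | zero => simp
  | add f g hf hg =>
    rw [map_add, map_add, add_smul]
    exact K.add_mem hf hg
  | single n x =>
    rw [← mul_one x, ← smul_eq_mul, ← Finsupp.smul_single, map_smul, map_smul, smul_assoc]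
    exact K.smul_mem _ (h n v hv)

end HeisenbergAlg

end

/-! ### The vertex algebra structure of `M(1)` and its irreducibility. -/

noncomputable section

namespace HeisenbergAlg

open Filter VertexField UniversalEnvelopingAlgebra

/-- The action of `h(n)` on `M(1)`. -/
def modeOp (n : ℤ) : Module.End ℂ Fock := Algebra.lsmul ℂ ℂ Fock (envMode n)

theorem modeOp_apply (n : ℤ) (v : Fock) : modeOp n v = envMode n • v := rfl

theorem isField_modeOp : IsField modeOp := by
  let K : Submodule ℂ Fock :=
    { carrier := {v | ∀ᶠ n in atTop, modeOp n v = 0}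
      zero_mem' := by simp
      add_mem' := fun {x y} hx hy => by
        filter_upwards [hx, hy] with n h1 h2
        rw [map_add, h1, h2, add_zero]
      smul_mem' := fun r x hx => by
        filter_upwards [hx] with n h1
        rw [map_smul, h1, smul_zero] }
  have hK : K = ⊤ := by
    refine fock_eq_top K ?_ fun m v hv => ?_
    · filter_upwards [eventually_ge_atTop 0] with n hn
      exact mode_vac n hn
    · filter_upwards [hv, eventually_gt_atTop (-m)] with n h1 h2
      have := mode_commutator n m v
      rw [if_neg (by omega), ← modeOp_apply n v, h1, smul_zero, sub_zero] at this
      exact this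
  intro v
  have : v ∈ K := hK ▸ Submodule.mem_top
  exact this

/-- The derivation `h(n) ↦ -n h(n-1)`, `𝐤 ↦ 0`. -/
def lieD : HeisenbergAlg →ₗ[ℂ] HeisenbergAlg :=
  ofFinsupp ∘ₗ (Finsupp.lsum ℂ fun n : ℤ => (-(n : ℂ)) • Finsupp.lsingle (n - 1)) ∘ₗ coeffs

theorem lieD_mode (n : ℤ) : lieD (ofFinsupp (Finsupp.single n 1)) =
    (-(n : ℂ)) • ofFinsupp (Finsupp.single (n - 1) 1) := by
  rw [lieD, LinearMap.comp_apply, LinearMap.comp_apply, coeffs_ofFinsupp, Finsupp.lsum_single,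
    LinearMap.smul_apply, map_smul]
  rfl

theorem lieD_central : lieD central = 0 := by
  rw [lieD, LinearMap.comp_apply, LinearMap.comp_apply, coeffs_central]
  simp

theorem lieD_lie (x y : HeisenbergAlg) : lieD ⁅x, y⁆ = ⁅lieD x, y⁆ + ⁅x, lieD y⁆ := by
  rw [lie_eq, map_smul, lieD_central, smul_zero, lie_eq, lie_eq, ← add_smul, eq_comm]
  convert zero_smul ℂ central
  simp only [lieD, LinearMap.comp_apply, coeffs_ofFinsupp]
  generalize coeffs x = f
  generalize coeffs y = g
  induction f using Finsupp.induction_linear with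
  | zero => simp
  | add f f' hf hf' =>
    simp only [map_add, LinearMap.add_apply]
    linear_combination hf + hf'
  | single m x =>
  induction g using Finsupp.induction_linear with
  | zero => simp
  | add g g' hg hg' =>
    simp only [map_add]
    linear_combination hg + hg'
  | single n y =>
  simp only [Finsupp.lsum_single, LinearMap.smul_apply, Finsupp.lsingle_apply, map_smul,
    cocycle_single, smul_eq_mul]
  rw [show m - 1 + n = m + (n - 1) by ring]
  split_ifs with h
  · have h' : (m : ℂ) + (n - 1) = 0 := by exact_mod_cast h
    push_cast
    linear_combination (-(m : ℂ) * x * y) * h'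
  · simp

theorem exists_transl : ∃ D : Module.End ℂ Fock, D fockVac = 0 ∧ IsCovariant D modeOp := by
  obtain ⟨E, hE1, hE2⟩ := exists_derivation lieD lieD_lie
  have hmode : ∀ n, E (envMode n) = (-(n : ℂ)) • envMode (n - 1) := fun n => by
    rw [envMode_eq, hE2, lieD_mode, map_smul, envMode_eq]
  have hk : E envK = 0 := by rw [envK_eq, hE2, lieD_central, map_zero]
  have h1 : E 1 = 0 := by simpa using hE1 1 1
  have hI : ∀ x ∈ vacIdeal, E x ∈ vacIdeal := by
    intro x hx
    induction hx using Submodule.span_induction with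
    | zero => simp
    | add x y _ _ hx hy =>
      rw [map_add]
      exact add_mem hx hy
    | smul p x h hx =>
      rw [smul_eq_mul, hE1]
      exact add_mem (Submodule.smul_mem _ _ h) (Submodule.smul_mem _ _ hx)
    | mem x h =>
      rcases h with ⟨n, hn, rfl⟩ | rfl
      · rw [hmode]
        rcases hn.eq_or_lt with rfl | hn
        · simp
        · exact Submodule.smul_of_tower_mem _ _
            (Submodule.subset_span (Or.inl ⟨n - 1, by omega, rfl⟩))
      · rw [map_sub, hk, h1, sub_zero]
        exact zero_mem _
  let D : Module.End ℂ Fock :=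
    (Submodule.Quotient.restrictScalarsEquiv ℂ vacIdeal).toLinearMap ∘ₗ
      (vacIdeal.restrictScalars ℂ).mapQ (vacIdeal.restrictScalars ℂ) E (fun x hx => hI x hx) ∘ₗ
      (Submodule.Quotient.restrictScalarsEquiv ℂ vacIdeal).symm.toLinearMap
  have hD : ∀ x, D (Submodule.Quotient.mk x) = Submodule.Quotient.mk (E x) := fun x => rfl
  refine ⟨D, ?_, fun n v => ?_⟩
  · refine (hD 1).trans ?_
    rw [h1, Submodule.Quotient.mk_zero]
  · obtain ⟨x, rfl⟩ := Submodule.Quotient.mk_surjective _ v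
    rw [modeOp_apply, modeOp_apply, modeOp_apply, ← Submodule.Quotient.mk_smul, hD, hD, smul_eq_mul,
      hE1, hmode, ← Submodule.Quotient.mk_smul, ← Submodule.Quotient.mk_smul,
      ← Submodule.Quotient.mk_smul, ← Submodule.Quotient.mk_sub]
    congr 1
    rw [smul_eq_mul, smul_eq_mul, neg_smul, neg_mul, smul_mul_assoc]
    abel

/-- The vertex algebra structure of `M(1)` exists. -/
theorem exists_isFockStructure : ∃ T : VertexAlgebra Fock, IsFockStructure T := by
  obtain ⟨D, hD1, hD2⟩ := exists_transl
  obtain ⟨T, h1, h2⟩ := exists_vertexAlgebra fockVac D (fun _ : Unit => modeOp)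
    (fun _ => isField_modeOp)
    (fun _ _ => isLocal_of_commutator isField_modeOp isField_modeOp 0
      (fun k => if k = -1 then 1 else 0) (fun m n w => by
        rw [modeOp_apply, modeOp_apply, modeOp_apply, modeOp_apply, mode_commutator]
        by_cases h : m + n = 0
        · simp [h]
        · simp [h, show m + n - 1 ≠ -1 by omega]))
    (fun _ n hn => mode_vac n hn) hD1 (fun _ => hD2)
    (fun K h1 h2 => fock_eq_top K h1 (h2 ()))
  exact ⟨T, h1, fun n v => h2 () n v⟩

/-! ### Irreducibility -/

/-- The operators of the polynomial model of `M(1)`. -/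
def polyOp : ℤ → Module.End ℂ (MvPolynomial ℕ ℂ)
  -- At `k = 0` the truncated index `k - 1` does no harm, as the coefficient is zero.
  | Int.ofNat k => (k : ℂ) • (MvPolynomial.pderiv (k - 1)).toLinearMap
  | Int.negSucc k => LinearMap.mulLeft ℂ (MvPolynomial.X k)

theorem pderiv_comm (i j : ℕ) (p : MvPolynomial ℕ ℂ) :
    MvPolynomial.pderiv i (MvPolynomial.pderiv j p) =
      MvPolynomial.pderiv j (MvPolynomial.pderiv i p) := by
  have : ⁅MvPolynomial.pderiv (R := ℂ) i, MvPolynomial.pderiv (R := ℂ) j⁆ = 0 := by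
    refine MvPolynomial.derivation_ext fun k => ?_
    rw [Derivation.commutator_apply, MvPolynomial.pderiv_X, MvPolynomial.pderiv_X]
    simp [Pi.single_apply, apply_ite]
  have := DFunLike.congr_fun this p
  rwa [Derivation.commutator_apply, Derivation.zero_apply, sub_eq_zero] at this

theorem polyOp_commutator (m n : ℤ) : polyOp m * polyOp n - polyOp n * polyOp m =
    if m + n = 0 then (m : ℂ) • 1 else 0 := by
  have mixed : ∀ k j : ℕ, polyOp (Int.ofNat k) * polyOp (Int.negSucc j) -
      polyOp (Int.negSucc j) * polyOp (Int.ofNat k) =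
        if (Int.ofNat k) + Int.negSucc j = 0 then (((Int.ofNat k) : ℤ) : ℂ) • 1 else 0 := by
    intro k j
    refine LinearMap.ext fun p => ?_
    rcases k with - | k
    · simp [polyOp]
    · have h : (Int.ofNat (k + 1) + Int.negSucc j = 0) ↔ k = j := by
        rw [Int.negSucc_eq]
        simp only [Int.ofNat_eq_natCast]
        omega
      by_cases hkj : k = j
      · subst hkj
        rw [if_pos (h.2 rfl)]
        simp [polyOp, Derivation.leibniz]
      · rw [if_neg (mt h.1 hkj)]
        simp [polyOp, Derivation.leibniz, Ne.symm hkj, MvPolynomial.pderiv_X]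
  rcases m with k | k <;> rcases n with j | j
  · refine LinearMap.ext fun p => ?_
    have e : polyOp (Int.ofNat k) (polyOp (Int.ofNat j) p) =
        polyOp (Int.ofNat j) (polyOp (Int.ofNat k) p) := by
      simp [polyOp, pderiv_comm (k - 1) (j - 1), smul_comm (k : ℂ) (j : ℂ)]
    rw [LinearMap.sub_apply, Module.End.mul_apply, Module.End.mul_apply, e, sub_self]
    split_ifs with h
    · have : k = 0 := by simp at h; omega
      simp [this]
    · rfl
  · exact mixed k j
  · rw [← neg_sub, mixed j k, add_comm]
    split_ifs with h
    · have : ((Int.negSucc k : ℤ) : ℂ) = -((Int.ofNat j : ℤ) : ℂ) := by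
        rw [eq_neg_of_add_eq_zero_left h]
        push_cast
        rfl
      rw [this]
      refine LinearMap.ext fun p => ?_
      simp
    · simp
  · refine LinearMap.ext fun p => ?_
    rw [if_neg (by simp [Int.negSucc_eq]; omega)]
    simp [polyOp]
    ring

/-- The universal property maps the vacuum to the polynomial `1`. This is the only use of the
polynomial model. -/
theorem fockVac_ne_zero : fockVac ≠ 0 := by
  obtain ⟨ψ, h, -⟩ := exists_fock_map polyOp polyOp_commutator 1 (by
    intro n hn
    obtain ⟨k, rfl⟩ := Int.eq_ofNat_of_zero_le hn
    change polyOp (Int.ofNat k) 1 = 0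
    simp [polyOp])
  intro h0
  rw [h0, map_zero] at h
  exact zero_ne_one h

/-- The span of the vectors `h(-m₁) ⋯ h(-mⱼ) 𝟏` with `j < k`. -/
def filt : ℕ → Submodule ℂ Fock
  | 0 => ⊥
  | k + 1 => Submodule.span ℂ ({fockVac} ∪ {v | ∃ m : ℕ, ∃ f ∈ filt k, v = modeOp (-(m + 1)) f})

theorem modeOp_neg_mem_filt {k : ℕ} {f : Fock} (hf : f ∈ filt k) (m : ℕ) :
    modeOp (-(m + 1)) f ∈ filt (k + 1) :=
  Submodule.subset_span (Or.inr ⟨m, f, hf, rfl⟩)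

theorem filt_le_succ (k : ℕ) : filt k ≤ filt (k + 1) := by
  induction k with
  | zero => exact bot_le
  | succ k ih =>
    refine Submodule.span_le.2 ?_
    rintro v (rfl | ⟨m, f, hf, rfl⟩)
    · exact Submodule.subset_span (Or.inl rfl)
    · exact modeOp_neg_mem_filt (ih hf) m

/-- Moving `h(n)` to the right through a creation operator leaves a scalar in place of that factor,
and at the end `h(n)` kills the vacuum: one factor is lost. -/
theorem modeOp_nonneg_mem_filt (n : ℤ) (hn : 0 ≤ n) (k : ℕ) :
    ∀ f ∈ filt (k + 1), modeOp n f ∈ filt k := by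
  induction k with
  | zero =>
    intro f hf
    have : filt 1 ≤ LinearMap.ker (modeOp n) := by
      refine Submodule.span_le.2 ?_
      rintro v (rfl | ⟨m, f, hf, rfl⟩)
      · exact mode_vac n hn
      · rw [(Submodule.mem_bot ℂ).1 hf]
        simp
    rw [this hf]
    exact zero_mem _
  | succ k ih =>
    intro f hf
    have : filt (k + 2) ≤ (filt (k + 1)).comap (modeOp n) := by
      refine Submodule.span_le.2 ?_
      rintro v (rfl | ⟨m, f, hf, rfl⟩)
      · have : modeOp n fockVac = 0 := mode_vac n hn
        simp [this]
      · have h := mode_commutator n (-(m + 1)) f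
        have h1 := modeOp_neg_mem_filt (ih f hf) m
        rw [sub_eq_iff_eq_add] at h
        change envMode n • envMode (-(m + 1)) • f ∈ filt (k + 1)
        rw [h]
        refine add_mem ?_ h1
        split_ifs
        · exact Submodule.smul_mem _ _ hf
        · exact zero_mem _
    exact this hf

theorem exists_mem_filt (f : Fock) : ∃ k, f ∈ filt k := by
  have mono : Monotone filt := monotone_nat_of_le_succ filt_le_succ
  let K : Submodule ℂ Fock :=
    { carrier := {f | ∃ k, f ∈ filt k}
      zero_mem' := ⟨0, zero_mem _⟩
      add_mem' := by
        rintro f g ⟨k, hk⟩ ⟨j, hj⟩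
        exact ⟨max k j, add_mem (mono (le_max_left _ _) hk) (mono (le_max_right _ _) hj)⟩
      smul_mem' := by
        rintro r f ⟨k, hk⟩
        exact ⟨k, Submodule.smul_mem _ _ hk⟩ }
  have hK : K = ⊤ := by
    refine fock_eq_top K ⟨1, Submodule.subset_span (Or.inl rfl)⟩ ?_
    rintro n f ⟨k, hk⟩
    rcases le_or_gt 0 n with hn | hn
    · exact ⟨k, modeOp_nonneg_mem_filt n hn k f (filt_le_succ k hk)⟩
    · have := modeOp_neg_mem_filt hk (-n - 1).toNat
      rw [show (-(((-n - 1).toNat : ℤ) + 1)) = n by omega] at this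
      exact ⟨k + 1, this⟩
  have : f ∈ K := hK ▸ Submodule.mem_top
  exact this

/-- The partial sums of the operator counting the factors `h(-m)`. -/
def euler (N : ℕ) : Module.End ℂ Fock :=
  ∑ n ∈ Finset.range N, ((n : ℂ) + 1)⁻¹ • (modeOp (-(n + 1)) * modeOp (n + 1))

/-- Only the summand `n = m` fails to commute with `h(-(m+1))`, and its weight cancels the factor `m
+ 1` of the commutator. So each creation operator raises the count by one. -/
theorem euler_modeOp_neg (N m : ℕ) (hm : m < N) (f : Fock) :
    euler N (modeOp (-(m + 1)) f) = modeOp (-(m + 1)) (euler N f) + modeOp (-(m + 1)) f := by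
  have key : ∀ n : ℕ, ((n : ℂ) + 1)⁻¹ • modeOp (-(n + 1)) (modeOp (n + 1) (modeOp (-(m + 1)) f)) =
      modeOp (-(m + 1)) (((n : ℂ) + 1)⁻¹ • modeOp (-(n + 1)) (modeOp (n + 1) f)) +
        if n = m then modeOp (-(m + 1)) f else 0 := by
    intro n
    have h1 := mode_commutator (n + 1) (-(m + 1)) f
    have h2 := mode_commutator (-(n + 1)) (-(m + 1)) (modeOp (n + 1) f)
    simp only [← modeOp_apply] at h1 h2
    rw [if_neg (by omega), sub_eq_zero] at h2
    rw [sub_eq_iff_eq_add] at h1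
    rw [h1, map_add, map_smul, h2, smul_add, add_comm]
    congr 1
    by_cases hnm : n = m
    · subst hnm
      have : (n : ℂ) + 1 ≠ 0 := by exact_mod_cast n.succ_ne_zero
      rw [if_pos (by ring), if_pos rfl, map_smul, smul_smul]
      push_cast
      rw [inv_mul_cancel₀ this, one_smul]
    · rw [if_neg (by omega), if_neg hnm, map_zero, smul_zero]
  simp only [euler, LinearMap.sum_apply, LinearMap.smul_apply, Module.End.mul_apply, key, map_sum,
    Finset.sum_add_distrib]
  congr 1
  rw [Finset.sum_ite_eq' (Finset.range N) m, if_pos (Finset.mem_range.2 hm)]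

/-- Up to shorter products, `euler N` multiplies a product of `k` creation operators by `k`, once
`N` exceeds the indices that occur. -/
theorem euler_sub_mem_filt (k : ℕ) : ∀ f ∈ filt (k + 1),
    ∀ᶠ N in atTop, euler N f - (k : ℂ) • f ∈ filt k := by
  induction k with
  | zero =>
    intro f hf
    refine Eventually.of_forall fun N => ?_
    have : euler N f = 0 := by
      simp only [euler, LinearMap.sum_apply, LinearMap.smul_apply, Module.End.mul_apply]
      refine Finset.sum_eq_zero fun n _ => ?_
      have := modeOp_nonneg_mem_filt (n + 1) (by positivity) 0 f hf
      rw [(Submodule.mem_bot ℂ).1 this]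
      simp
    simp [this]
  | succ k ih =>
    intro f hf
    induction hf using Submodule.span_induction with
    | zero => simp
    | add f g _ _ hf hg =>
      filter_upwards [hf, hg] with N h1 h2
      have := add_mem h1 h2
      rw [map_add, smul_add]
      convert this using 1
      abel
    | smul r f _ hf =>
      filter_upwards [hf] with N h1
      rw [map_smul, smul_comm, ← smul_sub]
      exact Submodule.smul_mem _ _ h1
    | mem f hf =>
      rcases hf with rfl | ⟨m, f, hf, rfl⟩
      · refine Eventually.of_forall fun N => sub_mem ?_
          (Submodule.smul_mem _ _ (Submodule.subset_span (Or.inl rfl)))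
        have : euler N fockVac = 0 := by
          simp only [euler, LinearMap.sum_apply, LinearMap.smul_apply, Module.End.mul_apply]
          refine Finset.sum_eq_zero fun n _ => ?_
          rw [modeOp_apply (n + 1), mode_vac _ (by positivity)]
          simp
        rw [this]
        exact zero_mem _
      · filter_upwards [ih f hf, eventually_gt_atTop m] with N h1 h2
        rw [euler_modeOp_neg N m h2]
        have := modeOp_neg_mem_filt h1 m
        rw [map_sub, map_smul] at this
        convert this using 1
        push_cast
        module

/-- A nonzero subspace of `M(1)` stable under the `h(n)`, `n > 0`, contains the vacuum. -/
theorem fockVac_mem (K : Submodule ℂ Fock) (hK : ∀ n : ℤ, 0 < n → ∀ v ∈ K, envMode n • v ∈ K)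
    (hne : K ≠ ⊥) : fockVac ∈ K := by
  classical
  obtain ⟨f₀, hf₀, hf₀'⟩ := (Submodule.ne_bot_iff K).1 hne
  -- Take a nonzero `f ∈ K` of least length. Annihilation operators shorten it, so they kill it and
  -- `euler N f = 0`. Comparing with the expected eigenvalue, a positive length would put `f` into a
  -- smaller step of the filtration; hence `f` is a multiple of the vacuum.
  have hex : ∃ k, ∃ f ∈ K, f ≠ 0 ∧ f ∈ filt k := by
    obtain ⟨k, hk⟩ := exists_mem_filt f₀
    exact ⟨k, f₀, hf₀, hf₀', hk⟩
  obtain ⟨f, hfK, hf0, hf⟩ := Nat.find_spec hex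
  have hmin := fun j (hj : j < Nat.find hex) => Nat.find_min hex hj
  generalize Nat.find hex = k at hf hmin
  rcases k with - | k
  · exact absurd ((Submodule.mem_bot ℂ).1 hf) hf0
  have kill : ∀ n : ℕ, modeOp (n + 1) f = 0 := by
    intro n
    by_contra h
    exact hmin k k.lt_succ_self
      ⟨_, hK (n + 1) (by positivity) f hfK, h, modeOp_nonneg_mem_filt _ (by positivity) k f hf⟩
  have heuler : ∀ N, euler N f = 0 := fun N => by
    simp [euler, LinearMap.sum_apply, kill]
  obtain ⟨N, hN⟩ := (euler_sub_mem_filt k f hf).exists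
  rw [heuler, zero_sub, neg_mem_iff] at hN
  rcases k with - | k
  · have hspan : filt 1 ≤ Submodule.span ℂ {fockVac} := by
      refine Submodule.span_le.2 ?_
      rintro v (rfl | ⟨m, f, hf, rfl⟩)
      · exact Submodule.subset_span rfl
      · rw [(Submodule.mem_bot ℂ).1 hf, map_zero]
        exact zero_mem _
    obtain ⟨c, rfl⟩ := Submodule.mem_span_singleton.1 (hspan hf)
    have hc : c ≠ 0 := by
      rintro rfl
      exact hf0 (zero_smul _ _)
    exact (Submodule.smul_mem_iff _ hc).1 hfK
  · have hk : ((k + 1 : ℕ) : ℂ) ≠ 0 := by exact_mod_cast k.succ_ne_zero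
    exact absurd ⟨f, hfK, hf0, (Submodule.smul_mem_iff _ hk).1 hN⟩ (hmin (k + 1) (by omega))

end HeisenbergAlg

end

noncomputable section

/-! ## The vertex algebra of a vertex algebroid -/

namespace VertexAlgebroid

open Filter VertexField UniversalEnvelopingAlgebra

variable {A B : Type*} [CommRing A] [Algebra ℂ A] [AddCommGroup B] [Module ℂ B]

section

variable (Γ : VertexAlgebroid A B)

theorem lie_proj (x y : ℤ →₀ A × B) : ⁅Γ.proj x, Γ.proj y⁆ = Γ.proj (Γ.loopBracket x y) := rfl

/-- The modes `u(n)` as a linear map in `u`. -/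
def envModeL (n : ℤ) : A × B →ₗ[ℂ] Γ.Env :=
  (ι ℂ : Γ.LieAlg →ₗ⁅ℂ⁆ Γ.Env).toLinearMap ∘ₗ Γ.proj ∘ₗ Finsupp.lsingle n

theorem envMode_commutator (u v : A × B) (m n : ℤ) :
    Γ.envMode u m * Γ.envMode v n - Γ.envMode v n * Γ.envMode u m =
      Γ.envMode (Γ.anchor u.2 v.1 - Γ.anchor v.2 u.1, Γ.bracket u.2 v.2) (m + n) +
        (m : ℂ) • Γ.envMode (Γ.pairing u.2 v.2, 0) (m + n - 1) := by
  rw [envMode, envMode, ι_lie, mode, mode, lie_proj, loopBracket_single, map_add, map_add,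
    map_smul, map_smul]
  rfl

theorem envMode_del (a : A) (n : ℤ) :
    Γ.envMode (0, Γ.del a) n = (-(n : ℂ)) • Γ.envMode (a, 0) (n - 1) := by
  have h : Γ.proj (Γ.hatDel (Finsupp.single n a)) = 0 := (Γ.proj_eq_zero _).2 ⟨_, rfl⟩
  rw [hatDel_single, map_add, map_smul] at h
  rw [envMode, mode, eq_neg_of_add_eq_zero_left h, map_neg, map_smul, neg_smul]
  rfl

/-- A subspace stable under all modes is stable under `U(𝓛)`. -/
theorem smul_mem_of_envMode {M : Type*} [AddCommGroup M] [Module ℂ M] [Module Γ.Env M]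
    [IsScalarTower ℂ Γ.Env M] (K : Submodule ℂ M)
    (h : ∀ u n, ∀ v ∈ K, Γ.envMode u n • v ∈ K) (x : Γ.Env) (v : M) (hv : v ∈ K) :
    x • v ∈ K := by
  refine smul_mem_of_ι_smul_mem K (fun y v hv => ?_) x v hv
  obtain ⟨f, rfl⟩ := Γ.proj_surjective y
  induction f using Finsupp.induction_linear with
  | zero => simp
  | add f g hf hg =>
    rw [map_add, map_add, add_smul]
    exact K.add_mem hf hg
  | single n u => exact h u n v hv

theorem vl_eq_top (K : Submodule ℂ Γ.VL) (hvac : Γ.vlVac ∈ K)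
    (h : ∀ u n, ∀ v ∈ K, Γ.envMode u n • v ∈ K) : K = ⊤ := by
  rw [Submodule.eq_top_iff']
  intro v
  obtain ⟨x, rfl⟩ := Submodule.Quotient.mk_surjective _ v
  have hx : (Submodule.Quotient.mk x : Γ.VL) = x • Γ.vlVac := by
    change _ = Submodule.Quotient.mk (x • 1)
    rw [smul_eq_mul, mul_one]
  rw [hx]
  exact Γ.smul_mem_of_envMode K h x _ hvac

theorem vb_eq_top (K : Submodule ℂ Γ.VB) (hvac : Γ.vbVac ∈ K)
    (h : ∀ u n, ∀ v ∈ K, Γ.envMode u n • v ∈ K) : K = ⊤ := by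
  let q : Γ.VL →ₗ[ℂ] Γ.VB := Γ.relIdeal.mkQ.restrictScalars ℂ
  have := Γ.vl_eq_top (K.comap q) hvac fun u n v hv => by
    have := h u n _ hv
    exact this
  rw [Submodule.eq_top_iff']
  intro v
  obtain ⟨x, rfl⟩ := Submodule.Quotient.mk_surjective _ v
  have hx : x ∈ K.comap q := this ▸ Submodule.mem_top
  exact hx

theorem envMode_vlVac (u : A × B) (n : ℤ) (hn : 0 ≤ n) : Γ.envMode u n • Γ.vlVac = 0 := by
  change Submodule.Quotient.mk (Γ.envMode u n • 1) = _
  rw [Submodule.Quotient.mk_eq_zero, smul_eq_mul, mul_one]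
  exact Submodule.subset_span ⟨u, n, hn, rfl⟩

theorem envMode_vbVac (u : A × B) (n : ℤ) (hn : 0 ≤ n) : Γ.envMode u n • Γ.vbVac = 0 := by
  have := congrArg Γ.relIdeal.mkQ (Γ.envMode_vlVac u n hn)
  rwa [map_smul, map_zero] at this

theorem vlD_mk (x : Γ.Env) :
    Γ.vlD (Submodule.Quotient.mk x) = Submodule.Quotient.mk (Γ.envD x) := rfl

theorem vlD_smul (x : Γ.Env) (v : Γ.VL) : Γ.vlD (x • v) = Γ.envD x • v + x • Γ.vlD v := by
  obtain ⟨y, rfl⟩ := Submodule.Quotient.mk_surjective _ v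
  rw [← Submodule.Quotient.mk_smul, vlD_mk, vlD_mk, ← Submodule.Quotient.mk_smul,
    ← Submodule.Quotient.mk_smul, ← Submodule.Quotient.mk_add, smul_eq_mul, envD_mul]
  rfl

theorem vlD_vlVac : Γ.vlD Γ.vlVac = 0 := by
  have h : Γ.envD 1 = 0 := by simpa using Γ.envD_mul 1 1
  refine (Γ.vlD_mk 1).trans ?_
  rw [h, Submodule.Quotient.mk_zero]

theorem vlD_relIdeal (x : Γ.VL) (hx : x ∈ Γ.relIdeal) : Γ.vlD x ∈ Γ.relIdeal := by
  induction hx using Submodule.span_induction with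
  | zero => simp
  | add x y _ _ hx hy =>
    rw [map_add]
    exact add_mem hx hy
  | smul p x h hx =>
    rw [vlD_smul]
    exact add_mem (Submodule.smul_mem _ _ h) (Submodule.smul_mem _ _ hx)
  | mem x h =>
    obtain ⟨k, e, he, rfl⟩ := h
    rw [← Module.End.mul_apply, ← pow_succ']
    exact Submodule.subset_span ⟨k + 1, e, he, rfl⟩

/-- The action of `u(n)` on `V_B`. -/
def vbOp (u : A × B) (n : ℤ) : Module.End ℂ Γ.VB := Algebra.lsmul ℂ ℂ Γ.VB (Γ.envMode u n)

theorem vbOp_apply (u : A × B) (n : ℤ) (v : Γ.VB) : Γ.vbOp u n v = Γ.envMode u n • v := rfl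

theorem exists_vbD : ∃ D : Module.End ℂ Γ.VB, D Γ.vbVac = 0 ∧
    ∀ u, IsCovariant D (Γ.vbOp u) := by
  let D : Module.End ℂ Γ.VB :=
    (Submodule.Quotient.restrictScalarsEquiv ℂ Γ.relIdeal).toLinearMap ∘ₗ
      (Γ.relIdeal.restrictScalars ℂ).mapQ (Γ.relIdeal.restrictScalars ℂ) Γ.vlD
        (fun x hx => Γ.vlD_relIdeal x hx) ∘ₗ
      (Submodule.Quotient.restrictScalarsEquiv ℂ Γ.relIdeal).symm.toLinearMap
  have hD : ∀ x, D (Submodule.Quotient.mk x) = Submodule.Quotient.mk (Γ.vlD x) := fun x => rfl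
  refine ⟨D, ?_, fun u n v => ?_⟩
  · refine (hD Γ.vlVac).trans ?_
    rw [vlD_vlVac, Submodule.Quotient.mk_zero]
  · obtain ⟨x, rfl⟩ := Submodule.Quotient.mk_surjective _ v
    rw [vbOp_apply, vbOp_apply, vbOp_apply, ← Submodule.Quotient.mk_smul, hD, hD, vlD_smul,
      envD_envMode, ← Submodule.Quotient.mk_smul, ← Submodule.Quotient.mk_smul,
      ← Submodule.Quotient.mk_smul, ← Submodule.Quotient.mk_sub]
    congr 1
    rw [smul_assoc, neg_smul]
    abel

theorem vbOp_commutator (u v : A × B) (m n : ℤ) (w : Γ.VB) :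
    Γ.envMode u m • Γ.envMode v n • w - Γ.envMode v n • Γ.envMode u m • w =
      Γ.envMode (Γ.anchor u.2 v.1 - Γ.anchor v.2 u.1, Γ.bracket u.2 v.2) (m + n) • w +
        (m : ℂ) • Γ.envMode (Γ.pairing u.2 v.2, 0) (m + n - 1) • w := by
  rw [← mul_smul, ← mul_smul, ← sub_smul, envMode_commutator, add_smul, smul_assoc]

theorem isField_vbOp (u : A × B) : IsField (Γ.vbOp u) := by
  -- All `u` are treated at once, because commutators bring in modes of other vectors.
  let K : Submodule ℂ Γ.VB :=
    { carrier := {v | ∀ u, ∀ᶠ n in atTop, Γ.vbOp u n v = 0}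
      zero_mem' := by simp
      add_mem' := fun {x y} hx hy u => by
        filter_upwards [hx u, hy u] with n h1 h2
        rw [map_add, h1, h2, add_zero]
      smul_mem' := fun r x hx u => by
        filter_upwards [hx u] with n h1
        rw [map_smul, h1, smul_zero] }
  have hK : K = ⊤ := by
    refine Γ.vb_eq_top K (fun u => ?_) fun u' m v hv u => ?_
    · filter_upwards [eventually_ge_atTop 0] with n hn
      exact Γ.envMode_vbVac u n hn
    · have t1 : Tendsto (fun n : ℤ => n + m) atTop atTop :=
        tendsto_atTop_add_const_right _ _ tendsto_id
      have t2 : Tendsto (fun n : ℤ => n + m - 1) atTop atTop :=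
        tendsto_atTop_add_const_right _ _ t1
      filter_upwards [hv u, t1.eventually (hv _), t2.eventually (hv _)] with n h1 h2 h3
      have := Γ.vbOp_commutator u u' n m v
      rw [← Γ.vbOp_apply u n v, h1, smul_zero, sub_zero] at this
      refine this.trans ?_
      rw [← vbOp_apply, ← vbOp_apply, h2, h3, smul_zero, add_zero]
  intro v
  have : v ∈ K := hK ▸ Submodule.mem_top
  exact this u

/-- The vertex algebra structure of `V_B` exists. -/
theorem exists_isVBStructure : ∃ S : VertexAlgebra Γ.VB, Γ.IsVBStructure S := by
  obtain ⟨D, hD1, hD2⟩ := Γ.exists_vbD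
  obtain ⟨S, h1, h2⟩ := exists_vertexAlgebra Γ.vbVac D Γ.vbOp Γ.isField_vbOp
    (fun u v => isLocal_of_commutator (Γ.isField_vbOp u) (Γ.isField_vbOp v)
      (Γ.vbOp (Γ.anchor u.2 v.1 - Γ.anchor v.2 u.1, Γ.bracket u.2 v.2))
      (Γ.vbOp (Γ.pairing u.2 v.2, 0)) fun m n w => Γ.vbOp_commutator u v m n w)
    Γ.envMode_vbVac hD1 hD2 (fun K h1 h2 => Γ.vb_eq_top K h1 h2)
  exact ⟨S, h1, fun u n v => h2 u n v⟩

variable {Γ}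

/-- The representation of `𝓛` defined by operators with the commutators of the modes. -/
def rep {M : Type*} [AddCommGroup M] [Module ℂ M] (op : ℤ → A × B →ₗ[ℂ] Module.End ℂ M)
    (hdel : ∀ a n, op n (0, Γ.del a) + (n : ℂ) • op (n - 1) (a, 0) = 0)
    (hcomm : ∀ u v m n, op m u * op n v - op n v * op m u =
      op (m + n) (Γ.anchor u.2 v.1 - Γ.anchor v.2 u.1, Γ.bracket u.2 v.2) +
        (m : ℂ) • op (m + n - 1) (Γ.pairing u.2 v.2, 0)) :
    Γ.LieAlg →ₗ⁅ℂ⁆ Module.End ℂ M where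
  toLinearMap := (LinearMap.range Γ.hatDel).liftQ (Finsupp.lsum ℂ op) (by
    rintro _ ⟨f, rfl⟩
    rw [LinearMap.mem_ker]
    induction f using Finsupp.induction_linear with
    | zero => simp
    | add f g hf hg => rw [map_add, map_add, hf, hg, add_zero]
    | single n a =>
      rw [hatDel_single, map_add, map_smul, Finsupp.lsum_single, Finsupp.lsum_single, hdel])
  map_lie' := by
    intro x y
    obtain ⟨f, rfl⟩ := Γ.proj_surjective x
    obtain ⟨g, rfl⟩ := Γ.proj_surjective y
    change Finsupp.lsum ℂ op (Γ.loopBracket f g) = Finsupp.lsum ℂ op f * Finsupp.lsum ℂ op g -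
      Finsupp.lsum ℂ op g * Finsupp.lsum ℂ op f
    induction f using Finsupp.induction_linear with
    | zero => simp
    | add f f' hf hf' =>
      rw [map_add, LinearMap.add_apply, map_add, hf, hf', map_add, add_mul, mul_add]
      abel
    | single m u =>
    induction g using Finsupp.induction_linear with
    | zero => simp
    | add g g' hg hg' =>
      rw [map_add, map_add, hg, hg', map_add, add_mul, mul_add]
      abel
    | single n v =>
      rw [loopBracket_single, map_add, map_smul, Finsupp.lsum_single, Finsupp.lsum_single,
        Finsupp.lsum_single, Finsupp.lsum_single, hcomm]

theorem rep_mode {M : Type*} [AddCommGroup M] [Module ℂ M]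
    (op : ℤ → A × B →ₗ[ℂ] Module.End ℂ M)
    (hdel : ∀ a n, op n (0, Γ.del a) + (n : ℂ) • op (n - 1) (a, 0) = 0)
    (hcomm : ∀ u v m n, op m u * op n v - op n v * op m u =
      op (m + n) (Γ.anchor u.2 v.1 - Γ.anchor v.2 u.1, Γ.bracket u.2 v.2) +
        (m : ℂ) • op (m + n - 1) (Γ.pairing u.2 v.2, 0)) (u : A × B) (n : ℤ) :
    lift ℂ (rep op hdel hcomm) (Γ.envMode u n) = op n u := by
  rw [envMode, lift_ι_apply]
  change Finsupp.lsum ℂ op (Finsupp.single n u) = _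
  rw [Finsupp.lsum_single]

/-- The universal property of `V_B`. -/
theorem exists_vb_map {M : Type*} [AddCommGroup M] [Module ℂ M]
    (op : ℤ → A × B →ₗ[ℂ] Module.End ℂ M)
    (hdel : ∀ a n, op n (0, Γ.del a) + (n : ℂ) • op (n - 1) (a, 0) = 0)
    (hcomm : ∀ u v m n, op m u * op n v - op n v * op m u =
      op (m + n) (Γ.anchor u.2 v.1 - Γ.anchor v.2 u.1, Γ.bracket u.2 v.2) +
        (m : ℂ) • op (m + n - 1) (Γ.pairing u.2 v.2, 0))
    (D : Module.End ℂ M) (hD : ∀ u, IsCovariant D fun n => op n u)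
    (w : M) (hw : ∀ n u, 0 ≤ n → op n u w = 0) (hDw : D w = 0)
    (hone : op (-1) (1, 0) w = w)
    (hmul : ∀ a a', op (-1) (a, 0) (op (-1) (a', 0) w) = op (-1) (a * a', 0) w)
    (hact : ∀ a b, op (-1) (a, 0) (op (-1) (0, b) w) = op (-1) (0, Γ.act a b) w) :
    ∃ φ : Γ.VB →ₗ[ℂ] M, φ Γ.vbVac = w ∧ ∀ u n v, φ (Γ.envMode u n • v) = op n u (φ v) := by
  obtain ⟨ψ, h1, h2⟩ := exists_linearMap_quotient (rep op hdel hcomm) w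
    {x | ∃ (u : A × B) (n : ℤ), 0 ≤ n ∧ x = Γ.envMode u n} (by
      rintro _ ⟨u, n, hn, rfl⟩
      rw [rep_mode, hw n u hn])
  change Γ.VL →ₗ[ℂ] M at ψ
  have ψvac : ψ Γ.vlVac = w := by
    refine (h1 1).trans ?_
    simp
  have ψsmul : ∀ (x : Γ.Env) (v : Γ.VL), ψ (x • v) = lift ℂ (rep op hdel hcomm) x (ψ v) := h2
  have ψmode : ∀ u n (v : Γ.VL), ψ (Γ.envMode u n • v) = op n u (ψ v) := fun u n v => by
    rw [ψsmul, rep_mode]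
  -- Since `ψ` intertwines the translations, killing `E` implies killing all `D^k E`, hence the
  -- whole submodule they generate.
  have ψD : ∀ v, ψ (Γ.vlD v) = D (ψ v) := by
    let K : Submodule ℂ Γ.VL := LinearMap.ker (ψ ∘ₗ Γ.vlD - D ∘ₗ ψ)
    have memK : ∀ v, v ∈ K ↔ ψ (Γ.vlD v) = D (ψ v) := fun v => by
      simp [K, sub_eq_zero]
    have hK : K = ⊤ := by
      refine Γ.vl_eq_top K ?_ fun u n v hv => ?_
      · rw [memK, vlD_vlVac, map_zero, ψvac, hDw]
      · rw [memK] at hv ⊢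
        rw [vlD_smul, map_add, envD_envMode, smul_assoc, map_smul, ψmode, ψmode, ψmode, hv,
          hD u n (ψ v), neg_smul]
        abel
    exact fun v => (memK v).1 (hK ▸ Submodule.mem_top)
  have hE : ∀ e ∈ Γ.relSpace, ψ e = 0 := by
    intro e he
    have : Γ.relSpace ≤ LinearMap.ker ψ := by
      refine Submodule.span_le.2 ?_
      rintro x ((rfl | ⟨a, a', rfl⟩) | ⟨a, b, rfl⟩)
      · change ψ _ = 0
        rw [map_sub, vlVec, ψmode, ψvac, hone, sub_self]
      · change ψ _ = 0
        rw [map_sub, vlVec, vlVec, ψmode, ψmode, ψmode, ψvac, hmul, sub_self]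
      · change ψ _ = 0
        rw [map_sub, vlVec, vlVec, ψmode, ψmode, ψmode, ψvac, hact, sub_self]
    exact this he
  have hDE : ∀ (k : ℕ) (e : Γ.VL), ψ ((Γ.vlD ^ k) e) = (D ^ k) (ψ e) := by
    intro k e
    induction k with
    | zero => simp
    | succ k ih => rw [pow_succ', Module.End.mul_apply, ψD, ih, pow_succ', Module.End.mul_apply]
  have hI : ∀ x ∈ Γ.relIdeal, ψ x = 0 := by
    intro x hx
    induction hx using Submodule.span_induction with
    | zero => simp
    | add x y _ _ hx hy => rw [map_add, hx, hy, add_zero]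
    | smul p x _ hx => rw [ψsmul, hx, map_zero]
    | mem x h =>
      obtain ⟨k, e, he, rfl⟩ := h
      rw [hDE, hE e he, map_zero]
  let φ : Γ.VB →ₗ[ℂ] M :=
    (Γ.relIdeal.restrictScalars ℂ).liftQ ψ (fun x hx => hI x hx) ∘ₗ
      (Submodule.Quotient.restrictScalarsEquiv ℂ Γ.relIdeal).symm.toLinearMap
  have hφ : ∀ v, φ (Submodule.Quotient.mk v) = ψ v := fun v => rfl
  refine ⟨φ, ψvac, fun u n v => ?_⟩
  obtain ⟨v, rfl⟩ := Submodule.Quotient.mk_surjective _ v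
  rw [← Submodule.Quotient.mk_smul, hφ, hφ, ψmode]

end

end VertexAlgebroid

end

noncomputable section

/-! ## The structure of the algebroids -/

namespace VertexAlgebroid

variable {A B : Type*} [CommRing A] [Algebra ℂ A] [AddCommGroup B] [Module ℂ B]

section

variable (Γ : VertexAlgebroid A B)

/-- `B = ℂ b ⊕ ∂(A)`, where `b` generates a Heisenberg algebra of level `β ≠ 0`, the kernel of the
character `χ` of `A` has square zero and contains the image of the derivation `b_0`, and `b_0`
satisfies a quadratic equation `b_0² = 1 + c b_0` on this kernel. -/
structure IsSplit (χ : A →ₐ[ℂ] ℂ) (μ : B →ₗ[ℂ] ℂ) (b : B) (β c : ℂ) : Prop where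
  level_ne_zero : β ≠ 0
  bracket_self : Γ.bracket b b = 0
  pairing_self : Γ.pairing b b = algebraMap ℂ A β
  coeff_del : ∀ a, μ (Γ.del a) = 0
  coeff_self : μ b = 1
  exists_del : ∀ v, ∃ a, v = μ v • b + Γ.del a
  mul_eq_zero : ∀ x y, χ x = 0 → χ y = 0 → x * y = 0
  character_anchor : ∀ a, χ (Γ.anchor b a) = 0
  exists_ne_zero : ∃ x, χ x = 0 ∧ x ≠ 0
  anchor_anchor : ∀ x, χ x = 0 → Γ.anchor b (Γ.anchor b x) = x + c • Γ.anchor b x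

variable {Γ}

theorem del_one : Γ.del 1 = 0 := by
  have h := Γ.del_mul 1 1
  rwa [one_mul, Γ.one_act, left_eq_add] at h

theorem bracket_del_left (a : A) (v : B) : Γ.bracket (Γ.del a) v = 0 := by
  have h := Γ.bracket_add_bracket (Γ.del a) v
  rw [Γ.bracket_del, Γ.pairing_symm, Γ.pairing_del] at h
  simpa using h

theorem pairing_del_left (a : A) (v : B) : Γ.pairing (Γ.del a) v = Γ.anchor v a := by
  rw [Γ.pairing_symm, Γ.pairing_del]

/-- A square-zero subspace complementary to the scalars is the kernel of a character. -/
theorem exists_character [Nontrivial A] (N : Submodule ℂ A) (hN : ∀ x ∈ N, ∀ y ∈ N, x * y = 0)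
    (hsum : ∀ a : A, ∃ k : ℂ, a - algebraMap ℂ A k ∈ N) :
    ∃ χ : A →ₐ[ℂ] ℂ, ∀ a, χ a = 0 ↔ a ∈ N := by
  have h1 : (1 : A) ∉ N := fun h => (one_ne_zero : (1 : A) ≠ 0) (by simpa using hN 1 h 1 h)
  let I : Ideal A :=
    { carrier := N
      zero_mem' := N.zero_mem
      add_mem' := N.add_mem
      -- As `N² = 0`, multiplication by `a` on `N` is multiplication by its scalar part `k`, so `N`
      -- is an ideal.
      smul_mem' := fun a x hx => by
        obtain ⟨k, hk⟩ := hsum a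
        have h := hN _ hk x hx
        rw [sub_mul, sub_eq_zero] at h
        rw [smul_eq_mul, h, ← Algebra.smul_def]
        exact N.smul_mem _ hx }
  have bij : Function.Bijective (Algebra.ofId ℂ (A ⧸ I)) := by
    constructor
    · have : Nontrivial (A ⧸ I) := Ideal.Quotient.nontrivial_iff.2 fun h =>
        h1 ((Ideal.eq_top_iff_one I).1 h)
      exact (algebraMap ℂ (A ⧸ I)).injective
    · intro a
      obtain ⟨a, rfl⟩ := Ideal.Quotient.mk_surjective a
      obtain ⟨k, hk⟩ := hsum a
      refine ⟨k, ?_⟩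
      rw [eq_comm]
      exact Ideal.Quotient.eq.2 hk
  let e := AlgEquiv.ofBijective _ bij
  refine ⟨e.symm.toAlgHom.comp (Ideal.Quotient.mkₐ ℂ I), fun a => ?_⟩
  change e.symm (Ideal.Quotient.mk I a) = 0 ↔ _
  rw [map_eq_zero_iff _ e.symm.injective, Ideal.Quotient.eq_zero_iff_mem]
  rfl

/-- Idempotents are killed by `∂`. -/
theorem del_eq_zero_of_idempotent {e : A} (he : e * e = e) : Γ.del e = 0 := by
  have h1 := Γ.del_mul e e
  have h2 := Γ.act_act e e (Γ.del e)
  rw [he, Γ.anchor_del] at h2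
  simp only [Derivation.coe_zero, Pi.zero_apply, map_zero, LinearMap.zero_apply, add_zero] at h2
  rw [sub_eq_zero] at h2
  rw [he, ← two_smul ℂ] at h1
  -- From `∂e = 2 e·∂e`; acting by `e` once more, where `e·(e·∂e) = e·∂e` because `π ∘ ∂ = 0`, gives
  -- `e·∂e = 2 e·∂e`, so it vanishes.
  have h3 : Γ.act e (Γ.del e) = (2 : ℂ) • Γ.act e (Γ.act e (Γ.del e)) := by
    conv_lhs => rw [h1]
    rw [map_smul]
  rw [h2, two_smul, left_eq_add] at h3
  rw [h1, h3, smul_zero]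

/-- A quadratic equation with distinct roots is only satisfied by elements killed by `∂`. -/
theorem del_eq_zero_of_quadratic {a : A} {r s : ℂ} (hrs : r ≠ s)
    (h : (a - algebraMap ℂ A r) * (a - algebraMap ℂ A s) = 0) : Γ.del a = 0 := by
  have hne : r - s ≠ 0 := sub_ne_zero.2 hrs
  -- The element `(a - s)/(r - s)` is an idempotent.
  have he : ((r - s)⁻¹ • (a - algebraMap ℂ A s)) * ((r - s)⁻¹ • (a - algebraMap ℂ A s)) =
      (r - s)⁻¹ • (a - algebraMap ℂ A s) := by
    have h' : (a - algebraMap ℂ A s) * (a - algebraMap ℂ A s) =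
        (r - s) • (a - algebraMap ℂ A s) := by
      rw [Algebra.smul_def, map_sub]
      linear_combination h
    rw [smul_mul_smul_comm, h', smul_smul, mul_assoc, inv_mul_cancel₀ hne, mul_one]
  have h0 := Γ.del_eq_zero_of_idempotent he
  rw [map_smul, map_sub, Algebra.algebraMap_eq_smul_one, map_smul, del_one, smul_zero, sub_zero,
    smul_eq_zero] at h0
  exact h0.resolve_left (inv_ne_zero hne)

/-- Reduces each case to finding `N`: the remaining normalization of `b` is always achieved by
subtracting some `∂y`, which does not change the derivation `b_0`. -/
theorem exists_isSplit {b : B} {β c : ℂ} (N : Submodule ℂ A)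
    (hβ : β ≠ 0) (hN : ∀ x ∈ N, ∀ y ∈ N, x * y = 0)
    (hsum : ∀ a : A, ∃ k : ℂ, a - algebraMap ℂ A k ∈ N) (hne : N ≠ ⊥)
    (hpair : Γ.pairing b b - algebraMap ℂ A β ∈ N)
    (hspan : ∀ v, ∃ (k : ℂ) (a : A), v = k • b + Γ.del a)
    (hd : ∀ x ∈ N, Γ.anchor b x ∈ N)
    (hd2 : ∀ x ∈ N, Γ.anchor b (Γ.anchor b x) = x + c • Γ.anchor b x) :
    ∃ χ μ b' β c, Γ.IsSplit χ μ b' β c := by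
  obtain ⟨x₁, hx₁, hx₁'⟩ := (Submodule.ne_bot_iff N).1 hne
  have : Nontrivial A := ⟨x₁, 0, hx₁'⟩
  obtain ⟨χ, hχ⟩ := exists_character N hN hsum
  have hdN : ∀ a, Γ.anchor b a ∈ N := by
    intro a
    obtain ⟨k, hk⟩ := hsum a
    have := hd _ hk
    rwa [map_sub, Derivation.map_algebraMap, sub_zero] at this
  set x₀ := Γ.pairing b b - algebraMap ℂ A β with hx₀
  -- Solves `b_0 y = x₀ / 2` by inverting `b_0² - c b_0 = 1` on `N`. This cancels both `[b, b] =
  -- ∂(x₀)/2` and the nilpotent part `x₀` of `⟨b, b⟩`.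
  let y : A := (2⁻¹ : ℂ) • (Γ.anchor b x₀ - c • x₀)
  have hy : Γ.anchor b y = (2⁻¹ : ℂ) • x₀ := by
    simp only [y, Derivation.map_smul, map_sub, hd2 x₀ hpair]
    module
  have hbb : Γ.bracket b b = (2⁻¹ : ℂ) • Γ.del x₀ := by
    have h := Γ.bracket_add_bracket b b
    rw [hx₀, map_sub, Algebra.algebraMap_eq_smul_one, map_smul, del_one, smul_zero, sub_zero, ← h]
    module
  -- The anchor vanishes on `∂(A)`, but not on `b`, since `b_0² = 1 + c b_0` on `N ≠ 0`.
  have hb : b ∉ LinearMap.range Γ.del := by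
    rintro ⟨a, rfl⟩
    have := hd2 x₁ hx₁
    rw [Γ.anchor_del] at this
    simp at this
    exact hx₁' this.symm
  obtain ⟨μ, hμ1, hμ2⟩ : ∃ μ : B →ₗ[ℂ] ℂ, μ b = 1 ∧ ∀ a, μ (Γ.del a) = 0 := by
    obtain ⟨f, hf, hf'⟩ := Submodule.exists_le_ker_of_notMem hb
    refine ⟨(f b)⁻¹ • f, by simp [hf], fun a => ?_⟩
    have : f (Γ.del a) = 0 := hf' ⟨a, rfl⟩
    simp [this]
  have hanchor : Γ.anchor (b - Γ.del y) = Γ.anchor b := by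
    rw [map_sub, Γ.anchor_del, sub_zero]
  refine ⟨χ, μ, b - Γ.del y, β, c, hβ, ?_, ?_, hμ2, ?_, fun v => ?_,
    fun x y hx hy => hN x ((hχ x).1 hx) y ((hχ y).1 hy), fun a => ?_, ⟨x₁, (hχ x₁).2 hx₁, hx₁'⟩,
    fun x hx => ?_⟩
  · rw [map_sub, map_sub, LinearMap.sub_apply, LinearMap.sub_apply, bracket_del_left,
      bracket_del_left, Γ.bracket_del, hy, map_smul, hbb]
    simp
  · rw [map_sub, map_sub, LinearMap.sub_apply, LinearMap.sub_apply, pairing_del_left,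
      pairing_del_left, Γ.pairing_del, Γ.anchor_del, hy]
    simp only [Derivation.coe_zero, Pi.zero_apply, sub_zero, hx₀]
    module
  · rw [map_sub, hμ2, hμ1, sub_zero]
  · obtain ⟨k, a, rfl⟩ := hspan v
    refine ⟨a + k • y, ?_⟩
    simp only [map_add, map_smul, hμ1, hμ2]
    module
  · rw [hanchor]
    exact (hχ _).2 (hdN a)
  · rw [hanchor]
    exact hd2 x ((hχ x).1 hx)

/-- In the situation of `IsCyclicNonLie`, the kernel of `∂` consists of the scalars. -/
theorem IsCyclicNonLie.exists_algebraMap {n : ℕ} (h : Γ.IsCyclicNonLie n) {a : A}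
    (ha : Γ.del a = 0) : ∃ k, a = algebraMap ℂ A k := by
  have : a ∈ LinearMap.ker Γ.del := ha
  rw [h.2.2.2.2, Submodule.mem_span_singleton] at this
  obtain ⟨k, hk⟩ := this
  exact ⟨k, by rw [← hk, Algebra.algebraMap_eq_smul_one]⟩

/-- If `B` is spanned by `b` and by elements of `∂(A)`, then `b` does not occur in `∂(A)`. -/
theorem IsCyclicNonLie.coeff_eq_zero {n : ℕ} (h : Γ.IsCyclicNonLie n) {b : B}
    (hspan : ∀ v, ∃ (k : ℂ) (a : A), v = k • b + Γ.del a) {k : ℂ} {a a' : A}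
    (ha : Γ.del a = k • b + Γ.del a') : k = 0 := by
  by_contra hk
  refine h.2.2.2.1 ((Submodule.eq_top_iff').2 fun v => ?_)
  have mem : ∀ a, Γ.del a ∈ Γ.actDel := fun a =>
    Submodule.subset_span ⟨1, a, (Γ.one_act _).symm⟩
  have hb : b ∈ Γ.actDel := by
    have : k • b ∈ Γ.actDel := by
      rw [← sub_eq_iff_eq_add] at ha
      rw [← ha]
      exact sub_mem (mem _) (mem _)
    exact (Submodule.smul_mem_iff _ hk).1 this
  obtain ⟨r, a, rfl⟩ := hspan v
  exact add_mem (Submodule.smul_mem _ _ hb) (mem a)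

theorem bracket_self_eq (b : B) : Γ.bracket b b = (2⁻¹ : ℂ) • Γ.del (Γ.pairing b b) := by
  rw [← Γ.bracket_add_bracket b b]
  module

/-- Since `Ker ∂ = ℂ`, one has `b_0 a = a + c` for a scalar `c`, and `A = ℂ a ⊕ ℂ`. Differentiating
the equation for `a * a` forces `α₂ = -2c` and `α₁ = -c²`, so `x = a + c` has square zero and `b_0 x
= x`. The level is `-c = α₂/2 ≠ 0`. -/
theorem SolvableTwo.exists_isSplit (h : Γ.SolvableTwo) : ∃ χ μ b β c, Γ.IsSplit χ μ b β c := by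
  obtain ⟨hc, b, a, α₁, α₂, hli, hspan, ha, hbb, haa, hα₂⟩ := h
  rw [bracket_self_eq, ← ha] at hli hspan hbb
  rw [map_smul, Γ.bracket_del] at hbb
  have hda0 : Γ.del a ≠ 0 := by
    intro h0
    have := hli.ne_zero 1
    simp [h0] at this
  obtain ⟨c, hdc⟩ : ∃ c, Γ.anchor b a = a + algebraMap ℂ A c := by
    have : Γ.del (Γ.anchor b a - a) = 0 := by
      rw [map_sub, sub_eq_zero]
      exact smul_right_injective _ (inv_ne_zero (two_ne_zero' ℂ)) hbb
    obtain ⟨c, hc⟩ := hc.exists_algebraMap this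
    exact ⟨c, by rw [← hc]; abel⟩
  have hspan' : ∀ v, ∃ k q : ℂ, v = k • b + Γ.del (q • a) := by
    intro v
    have : v ∈ Submodule.span ℂ {b, (2⁻¹ : ℂ) • Γ.del a} := hspan ▸ Submodule.mem_top
    obtain ⟨k, q, rfl⟩ := Submodule.mem_span_pair.1 this
    exact ⟨k, q * 2⁻¹, by rw [map_smul, smul_smul]⟩
  have hspan'' : ∀ v, ∃ (k : ℂ) (a : A), v = k • b + Γ.del a := fun v => by
    obtain ⟨k, q, h⟩ := hspan' v
    exact ⟨k, _, h⟩
  have hA : ∀ a', ∃ q k : ℂ, a' = q • a + algebraMap ℂ A k := by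
    intro a'
    obtain ⟨k, q, h⟩ := hspan' (Γ.del a')
    have hk := hc.coeff_eq_zero hspan'' h
    rw [hk, zero_smul, zero_add, ← sub_eq_zero, ← map_sub] at h
    obtain ⟨r, hr⟩ := hc.exists_algebraMap h
    exact ⟨q, r, by rw [← hr]; abel⟩
  have indep : ∀ r s : ℂ, r • a + algebraMap ℂ A s = 0 → r = 0 ∧ s = 0 := by
    intro r s h
    have h' := congrArg Γ.del h
    rw [map_add, Algebra.algebraMap_eq_smul_one, map_smul, map_smul, del_one, smul_zero, add_zero,
      map_zero, smul_eq_zero] at h'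
    have hr := h'.resolve_right hda0
    have : Nontrivial A := ⟨a, 0, fun h0 => hda0 (by rw [h0, map_zero])⟩
    rw [hr, zero_smul, zero_add] at h
    exact ⟨hr, (map_eq_zero_iff _ (algebraMap ℂ A).injective).1 h⟩
  have hder : (α₂ + 2 * c) • a + algebraMap ℂ A (2 * α₁ - α₂ * c) = 0 := by
    have h1 := congrArg (Γ.anchor b) haa
    rw [Derivation.leibniz, map_add, Derivation.map_smul, Derivation.map_smul,
      Derivation.map_one_eq_zero, smul_zero, zero_add, hdc, smul_eq_mul] at h1
    simp only [Algebra.smul_def, map_add, map_mul, map_sub, map_ofNat, mul_one] at h1 haa ⊢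
    linear_combination h1 - 2 * haa
  obtain ⟨e1, e2⟩ := indep _ _ hder
  set x := a + algebraMap ℂ A c with hx
  have hx2 : x * x = 0 := by
    have e3 : algebraMap ℂ A α₁ = - algebraMap ℂ A c * algebraMap ℂ A c := by
      rw [← map_neg, ← map_mul]
      congr 1
      linear_combination e2 / 2 + c / 2 * e1
    have e4 : algebraMap ℂ A α₂ = - 2 * algebraMap ℂ A c := by
      rw [show α₂ = -2 * c by linear_combination e1, map_mul, map_neg, map_ofNat]
    simp only [Algebra.smul_def, mul_one] at haa
    rw [hx]
    linear_combination haa + e3 + a * e4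
  have hx0 : x ≠ 0 := fun h0 => one_ne_zero' ℂ (indep 1 c (by rw [one_smul]; exact h0)).1
  have hdx : Γ.anchor b x = x := by rw [hx, map_add, Derivation.map_algebraMap, add_zero, hdc]
  refine Γ.exists_isSplit (b := b) (β := -c) (c := 0) (Submodule.span ℂ {x}) ?_ ?_ ?_ ?_ ?_
    hspan'' ?_ ?_
  · intro h0
    exact hα₂ (by linear_combination e1 + 2 * h0)
  · intro u hu v hv
    obtain ⟨r, rfl⟩ := Submodule.mem_span_singleton.1 hu
    obtain ⟨s, rfl⟩ := Submodule.mem_span_singleton.1 hv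
    rw [smul_mul_smul_comm, hx2, smul_zero]
  · intro a'
    obtain ⟨q, k, rfl⟩ := hA a'
    refine ⟨k - q * c, Submodule.mem_span_singleton.2 ⟨q, ?_⟩⟩
    rw [hx]
    simp only [Algebra.smul_def, map_sub, map_mul]
    ring
  · rw [Ne, Submodule.span_singleton_eq_bot]
    exact hx0
  · rw [← ha, map_neg, sub_neg_eq_add]
    exact Submodule.mem_span_singleton_self x
  · intro u hu
    obtain ⟨r, rfl⟩ := Submodule.mem_span_singleton.1 hu
    rw [Derivation.map_smul, hdx]
    exact hu
  · intro u hu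
    obtain ⟨r, rfl⟩ := Submodule.mem_span_singleton.1 hu
    simp only [Derivation.map_smul, hdx, zero_smul, add_zero]

/-- The consequences of `ThreeData` for `a = b_1 b` and the derivation `b_0`. -/
theorem ThreeData.relations {b : B} {β γ₀ γ₁ c₀ c₁ : ℂ} (h : Γ.ThreeData b β γ₀ γ₁ c₀ c₁) :
    ∃ a d₁ d₂ : A, ∃ k : ℂ, a = Γ.pairing b b ∧ d₁ = Γ.anchor b a ∧ d₂ = Γ.anchor b d₁ ∧
      Γ.IsCyclicNonLie 3 ∧ (∀ v, ∃ (k : ℂ) (a : A), v = k • b + Γ.del a) ∧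
      (∀ a', ∃ p q r : ℂ, a' = p • a + q • d₁ + algebraMap ℂ A r) ∧
      (∀ p q r : ℂ, p • a + q • d₁ + algebraMap ℂ A r = 0 → p = 0 ∧ q = 0 ∧ r = 0) ∧
      d₂ = c₀ • a + c₁ • d₁ + algebraMap ℂ A k ∧
      a * a = β • a + γ₀ • d₁ + (γ₁ + 1) • d₂ ∧
      ∀ a', (a - algebraMap ℂ A β) * Γ.anchor b a' = 0 := by
  obtain ⟨hc, hli, hspan, a, ha, hact, hdd⟩ := h
  have hb2 : Γ.bracket b (Γ.bracket b b) = (2⁻¹ : ℂ) • Γ.del (Γ.anchor b a) := by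
    rw [bracket_self_eq, map_smul, Γ.bracket_del, ha]
  rw [hb2, bracket_self_eq, ← ha] at hli hspan
  rw [Γ.bracket_del] at hdd
  have delind : ∀ p q : ℂ, p • Γ.del a + q • Γ.del (Γ.anchor b a) = 0 → p = 0 ∧ q = 0 := by
    intro p q hpq
    have := Fintype.linearIndependent_iff.1 hli ![0, 2 * p, 2 * q] (by
      rw [← hpq]
      simp only [Fin.sum_univ_three, Matrix.cons_val]
      module)
    exact ⟨by simpa using this 1, by simpa using this 2⟩
  have hspan' : ∀ v, ∃ k p q : ℂ, v = k • b + Γ.del (p • a + q • Γ.anchor b a) := by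
    intro v
    have : v ∈ Submodule.span ℂ {b, (2⁻¹ : ℂ) • Γ.del a, (2⁻¹ : ℂ) • Γ.del (Γ.anchor b a)} :=
      hspan ▸ Submodule.mem_top
    obtain ⟨k, p, q, rfl⟩ := Submodule.mem_span_triple.1 this
    refine ⟨k, p * 2⁻¹, q * 2⁻¹, ?_⟩
    simp only [map_add, map_smul]
    module
  have hspan'' : ∀ v, ∃ (k : ℂ) (a : A), v = k • b + Γ.del a := fun v => by
    obtain ⟨k, p, q, h⟩ := hspan' v
    exact ⟨k, _, h⟩
  obtain ⟨k, hk⟩ : ∃ k, Γ.anchor b (Γ.anchor b a) - (c₀ • a + c₁ • Γ.anchor b a) =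
      algebraMap ℂ A k := hc.exists_algebraMap (by
    rw [map_sub, hdd, map_add, map_smul, map_smul, sub_self])
  refine ⟨a, _, _, k, ha, rfl, rfl, hc, hspan'', fun a' => ?_, fun p q r hpqr => ?_,
    by rw [← hk]; abel, ?_, fun a' => ?_⟩
  · obtain ⟨k, p, q, h⟩ := hspan' (Γ.del a')
    have hk := hc.coeff_eq_zero hspan'' h
    rw [hk, zero_smul, zero_add, ← sub_eq_zero, ← map_sub] at h
    obtain ⟨r, hr⟩ := hc.exists_algebraMap h
    exact ⟨p, q, r, by rw [← hr]; abel⟩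
  · have h' := congrArg Γ.del hpqr
    rw [map_add, map_add, Algebra.algebraMap_eq_smul_one, map_smul, map_smul, map_smul, del_one,
      smul_zero, add_zero, map_zero] at h'
    obtain ⟨rfl, rfl⟩ := delind p q h'
    have : Nontrivial A := ⟨a, 0, fun h0 => one_ne_zero' ℂ (delind 1 0 (by simp [h0])).1⟩
    rw [zero_smul, zero_smul, zero_add, zero_add] at hpqr
    exact ⟨rfl, rfl, (map_eq_zero_iff _ (algebraMap ℂ A).injective).1 hpqr⟩
  · have h1 := Γ.pairing_act a b b
    rw [hact, ← ha] at h1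
    simp only [map_add, map_smul, LinearMap.add_apply, LinearMap.smul_apply, pairing_del_left,
      ← ha] at h1
    rw [eq_sub_iff_add_eq] at h1
    rw [← h1]
    module
  · have h1 := DFunLike.congr_fun (Γ.anchor_act a b) a'
    rw [hact] at h1
    simp only [map_add, map_smul, Γ.anchor_del, smul_zero, add_zero, Derivation.smul_apply,
      smul_eq_mul] at h1
    rw [sub_mul, sub_eq_zero, ← h1, Algebra.smul_def]

/-- With `y = b_0 a` one has `a y = β y`; differentiating the formula for `a * a` and comparing
coefficients gives `β = γ₁ + 1` and `γ₀ = -β c₁`. Then `(a - β)²` is a scalar, which must be zero,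
and `N` is spanned by `x = a - β` and `y`, with `b_0 x = y` and `b_0 y = x + c₁ y`. -/
theorem ThreeData.exists_isSplit {b : B} {β γ₀ γ₁ c₁ : ℂ} (h : Γ.ThreeData b β γ₀ γ₁ 1 c₁)
    (hγ : γ₁ + 1 ≠ 0) : ∃ χ μ b β c, Γ.IsSplit χ μ b β c := by
  obtain ⟨a, y, d₂, k, ha, hy, hd₂, hc, hspan, hA, indep, hd₂', haa, hann⟩ := h.relations
  have hay : a * y = β • y := by
    have := hann a
    rw [← hy, sub_mul, sub_eq_zero] at this
    rw [this, Algebra.smul_def]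
  obtain ⟨e1, e2⟩ : γ₀ + (γ₁ + 1) * c₁ = 0 ∧ β = γ₁ + 1 := by
    have h1 := congrArg (Γ.anchor b) haa
    have h2 := congrArg (Γ.anchor b) hd₂'
    simp only [Derivation.leibniz, map_add, Derivation.map_smul, ← hy, ← hd₂,
      Derivation.map_algebraMap] at h1 h2
    rw [h2, smul_eq_mul, hay, hd₂'] at h1
    have h3 : (γ₀ + (γ₁ + 1) * c₁) • a + ((γ₀ + (γ₁ + 1) * c₁) * c₁ + (γ₁ + 1) - β) • y +
        algebraMap ℂ A ((γ₀ + (γ₁ + 1) * c₁) * k) = 0 := by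
      rw [Algebra.algebraMap_eq_smul_one] at h1 ⊢
      rw [← sub_eq_zero] at h1
      rw [← neg_eq_zero, ← h1]
      module
    obtain ⟨f1, f2, -⟩ := indep _ _ _ h3
    rw [f1, zero_mul, zero_add, sub_eq_zero] at f2
    exact ⟨f1, f2.symm⟩
  have hβ : β ≠ 0 := e2 ▸ hγ
  have hda : Γ.del a ≠ 0 := by
    intro h0
    obtain ⟨r, hr⟩ := hc.exists_algebraMap h0
    exact one_ne_zero' ℂ (indep 1 0 (-r) (by rw [hr]; simp)).1
  have hsq : (a - algebraMap ℂ A β) * (a - algebraMap ℂ A β) = algebraMap ℂ A (β * (β + k)) := by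
    have e3 : algebraMap ℂ A γ₀ = - algebraMap ℂ A β * algebraMap ℂ A c₁ := by
      rw [← map_neg, ← map_mul, e2]
      congr 1
      linear_combination e1
    rw [hd₂', ← e2] at haa
    simp only [Algebra.smul_def, map_add, map_mul, map_one] at haa ⊢
    linear_combination haa + y * e3
  -- Otherwise `a` has the two distinct roots `β ± s`, which forces `∂a = 0`.
  have hk : β * (β + k) = 0 := by
    by_contra hne
    obtain ⟨s, hs⟩ := IsAlgClosed.exists_pow_nat_eq (β * (β + k)) (n := 2) (by norm_num)
    have hs0 : s ≠ 0 := by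
      rintro rfl
      exact hne (by rw [← hs]; ring)
    refine hda (Γ.del_eq_zero_of_quadratic (r := β + s) (s := β - s) ?_ ?_)
    · intro h'
      exact hs0 (by linear_combination h' / 2)
    · rw [← hs] at hsq
      simp only [map_add, map_sub, map_pow] at hsq ⊢
      linear_combination hsq
  have hk' : k = -β := by
    rcases mul_eq_zero.1 hk with h0 | h0
    · exact absurd h0 hβ
    · linear_combination h0
  rw [hk, map_zero] at hsq
  set x := a - algebraMap ℂ A β with hx
  have hdx : Γ.anchor b x = y := by rw [hx, map_sub, Derivation.map_algebraMap, sub_zero, hy]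
  have hdy : Γ.anchor b y = x + c₁ • y := by
    rw [← hd₂, hd₂', hk', hx, map_neg, one_smul]
    abel
  have hxy : x * y = 0 := by
    rw [hy]
    exact hann a
  have hyy : y * y = 0 := by
    have h1 := congrArg (Γ.anchor b) hxy
    rw [Derivation.leibniz, map_zero, hdx, smul_eq_mul, smul_eq_mul, hann, zero_add] at h1
    exact h1
  have hmem : ∀ u ∈ Submodule.span ℂ {x, y}, ∃ p q : ℂ, u = p • x + q • y := fun u hu => by
    obtain ⟨p, q, rfl⟩ := Submodule.mem_span_pair.1 hu
    exact ⟨p, q, rfl⟩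
  refine Γ.exists_isSplit (b := b) (β := β) (c := c₁) (Submodule.span ℂ {x, y}) hβ ?_ ?_ ?_ ?_
    hspan ?_ ?_
  · intro u hu v hv
    obtain ⟨p, q, rfl⟩ := hmem u hu
    obtain ⟨r, s, rfl⟩ := hmem v hv
    simp only [Algebra.smul_def]
    linear_combination (algebraMap ℂ A p * algebraMap ℂ A r) * hsq +
      (algebraMap ℂ A p * algebraMap ℂ A s + algebraMap ℂ A q * algebraMap ℂ A r) * hxy +
      (algebraMap ℂ A q * algebraMap ℂ A s) * hyy
  · intro a'
    obtain ⟨p, q, r, rfl⟩ := hA a'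
    refine ⟨r + p * β, Submodule.mem_span_pair.2 ⟨p, q, ?_⟩⟩
    rw [hx]
    simp only [Algebra.smul_def, map_add, map_mul]
    ring
  · intro h0
    have hy0 : y = 0 := (Submodule.mem_bot ℂ).1 (h0 ▸ Submodule.subset_span (by simp))
    exact one_ne_zero' ℂ (indep 0 1 0 (by simp [hy0])).2.1
  · rw [← ha]
    exact Submodule.subset_span (by simp [hx])
  · intro u hu
    obtain ⟨p, q, rfl⟩ := hmem u hu
    rw [map_add, Derivation.map_smul, Derivation.map_smul, hdx, hdy]
    exact Submodule.mem_span_pair.2 ⟨q, p + q * c₁, by module⟩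
  · intro u hu
    obtain ⟨p, q, rfl⟩ := hmem u hu
    simp only [map_add, Derivation.map_smul, hdx, hdy]
    module

/-- The data of `SolvableThreeThree` force a nontrivial idempotent in `A`, so they do not occur. -/
theorem not_solvableThreeThree : ¬ Γ.SolvableThreeThree := by
  rintro ⟨b, β, γ₀, γ₁, h, hγ⟩
  obtain ⟨a, y, d₂, k, ha, hy, hd₂, hc, hspan, hA, indep, hd₂', haa, hann⟩ := h.relations
  rw [zero_smul, one_smul, zero_add] at hd₂'
  -- `a - β` annihilates the image of `b_0`, and `b_0 (y - a)` is the scalar `k`.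
  have hk : k = 0 := by
    have h1 := hann (y - a)
    rw [map_sub, ← hd₂, ← hy, hd₂', add_sub_cancel_left] at h1
    refine (indep k 0 (-(k * β)) ?_).1
    rw [Algebra.smul_def, map_neg, map_mul, zero_smul]
    linear_combination h1
  rw [hk, map_zero, add_zero] at hd₂'
  have hxy : (a - algebraMap ℂ A β) * y = 0 := by
    rw [hy]
    exact hann a
  have hβ : β = γ₀ + γ₁ + 1 := by
    have h1 := congrArg (Γ.anchor b) haa
    have h3 := congrArg (Γ.anchor b) hd₂'
    simp only [Derivation.leibniz, map_add, Derivation.map_smul, ← hy, ← hd₂] at h1 h3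
    rw [h3, hd₂', smul_eq_mul] at h1
    have h2 : (0 : ℂ) • a + (β - (γ₀ + γ₁ + 1)) • y + algebraMap ℂ A 0 = 0 := by
      simp only [Algebra.smul_def, map_add, map_sub, map_one, map_zero] at h1 ⊢
      linear_combination h1 - 2 * hxy
    linear_combination (indep _ _ _ h2).2.1
  have hβ0 : β ≠ 0 := hβ ▸ hγ
  have haa' : a * a = β • a + β • y := by
    rw [haa, hd₂', hβ]
    module
  -- Here `y² = 0`, `(a - β) y = 0` and `(a - β)² = β (y - (a - β))`, which makes `(y - (a - β))/β`
  -- an idempotent. Being killed by `∂`, it is a scalar, contrary to the independence of `a`, `y`,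
  -- `1`.
  have hidem : (β⁻¹ • (y - (a - algebraMap ℂ A β))) * (β⁻¹ • (y - (a - algebraMap ℂ A β))) =
      β⁻¹ • (y - (a - algebraMap ℂ A β)) := by
    have h0 : Γ.anchor b (y * (a - algebraMap ℂ A β)) = 0 := by
      rw [mul_comm, hxy, map_zero]
    have hyy : y * y = 0 := by
      rw [Derivation.leibniz, map_sub, Derivation.map_algebraMap, ← hy, ← hd₂, hd₂', sub_zero,
        smul_eq_mul, smul_eq_mul, hxy, add_zero] at h0
      exact h0
    rw [smul_mul_smul_comm]
    have : (y - (a - algebraMap ℂ A β)) * (y - (a - algebraMap ℂ A β)) =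
        β • (y - (a - algebraMap ℂ A β)) := by
      simp only [Algebra.smul_def] at haa' ⊢
      linear_combination hyy - 2 * hxy + haa'
    rw [this, smul_smul, mul_assoc, inv_mul_cancel₀ hβ0, mul_one]
  obtain ⟨r, hr⟩ := hc.exists_algebraMap (Γ.del_eq_zero_of_idempotent hidem)
  have : (-1 : ℂ) • a + (1 : ℂ) • y + algebraMap ℂ A (β - β * r) = 0 := by
    have h1 : y - (a - algebraMap ℂ A β) = β • algebraMap ℂ A r := by
      rw [← hr, smul_smul, mul_inv_cancel₀ hβ0, one_smul]
    rw [Algebra.smul_def] at h1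
    rw [map_sub, map_mul, neg_smul, one_smul, one_smul]
    linear_combination h1
  exact one_ne_zero' ℂ (indep _ _ _ this).2.1

theorem exists_isSplit_of_solvable
    (hΓ : Γ.SolvableTwo ∨ Γ.SolvableThreeOne ∨ Γ.SolvableThreeTwo ∨ Γ.SolvableThreeThree) :
    ∃ χ μ b β c, Γ.IsSplit χ μ b β c := by
  rcases hΓ with h | ⟨b, β, γ₀, γ₁, α, s, -, -, -, h, hγ⟩ | ⟨b, β, γ₀, γ₁, h, hγ⟩ | h
  · exact h.exists_isSplit
  · exact h.exists_isSplit hγ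
  · exact h.exists_isSplit hγ
  · exact absurd h not_solvableThreeThree

end

end VertexAlgebroid

end

/-! ### Consequences of the split form: the local ring and the module structure. -/

noncomputable section

namespace VertexAlgebroid

variable {A B : Type*} [CommRing A] [Algebra ℂ A] [AddCommGroup B] [Module ℂ B]
  {Γ : VertexAlgebroid A B} {χ : A →ₐ[ℂ] ℂ} {μ : B →ₗ[ℂ] ℂ} {b : B} {β c : ℂ}

theorem character_sub_smul_one (χ : A →ₐ[ℂ] ℂ) (a : A) : χ (a - χ a • 1) = 0 := by
  simp

theorem del_sub_smul_one (a : A) (k : ℂ) : Γ.del (a - k • 1) = Γ.del a := by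
  rw [map_sub, map_smul, del_one, smul_zero, sub_zero]

namespace IsSplit

theorem anchor_eq (h : Γ.IsSplit χ μ b β c) (u : B) : Γ.anchor u = μ u • Γ.anchor b := by
  obtain ⟨a, ha⟩ := h.exists_del u
  have := congrArg Γ.anchor ha
  rwa [map_add, map_smul, Γ.anchor_del, add_zero] at this

theorem character_anchor_apply (h : Γ.IsSplit χ μ b β c) (u : B) (a : A) :
    χ (Γ.anchor u a) = 0 := by
  rw [h.anchor_eq, Derivation.smul_apply, map_smul, h.character_anchor, smul_zero]

theorem bracket_eq (h : Γ.IsSplit χ μ b β c) (u v : B) :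
    ∃ a, Γ.bracket u v = Γ.del a := by
  obtain ⟨x, hx⟩ := h.exists_del u
  obtain ⟨y, hy⟩ := h.exists_del v
  refine ⟨μ u • Γ.anchor b y, ?_⟩
  conv_lhs => rw [hx, hy]
  simp only [map_add, map_smul, LinearMap.add_apply, LinearMap.smul_apply, bracket_del_left,
    h.bracket_self, Γ.bracket_del, Γ.anchor_del, Derivation.coe_zero, Pi.zero_apply, map_zero]
  module

theorem coeff_bracket (h : Γ.IsSplit χ μ b β c) (u v : B) : μ (Γ.bracket u v) = 0 := by
  obtain ⟨a, ha⟩ := h.bracket_eq u v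
  rw [ha, h.coeff_del]

theorem character_pairing (h : Γ.IsSplit χ μ b β c) (u v : B) :
    χ (Γ.pairing u v) = μ u * μ v * β := by
  obtain ⟨x, hx⟩ := h.exists_del u
  obtain ⟨y, hy⟩ := h.exists_del v
  conv_lhs => rw [hx, hy]
  simp only [map_add, map_smul, LinearMap.add_apply, LinearMap.smul_apply, pairing_del_left,
    h.pairing_self, Γ.pairing_del, Γ.anchor_del, h.character_anchor, AlgHom.commutes,
    Derivation.coe_zero, Pi.zero_apply, map_zero, smul_eq_mul, Algebra.algebraMap_self,
    RingHom.id_apply]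
  ring

theorem eq_zero_of_anchor_eq_zero (h : Γ.IsSplit χ μ b β c) {x : A} (hx : χ x = 0)
    (hdx : Γ.anchor b x = 0) : x = 0 := by
  have := h.anchor_anchor x hx
  rw [hdx, map_zero, smul_zero, add_zero] at this
  exact this.symm

theorem mul_eq_smul (h : Γ.IsSplit χ μ b β c) (a : A) {x : A} (hx : χ x = 0) :
    a * x = χ a • x := by
  have := h.mul_eq_zero _ x (character_sub_smul_one χ a) hx
  rwa [sub_mul, smul_mul_assoc, one_mul, sub_eq_zero] at this

/-- The coefficient of `b` is visible in the anchor: compare both sides of `π(a·v) = a π(v)` on some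
`x` with `b_0 x ≠ 0`. -/
theorem coeff_act (h : Γ.IsSplit χ μ b β c) (a : A) (v : B) : μ (Γ.act a v) = χ a * μ v := by
  obtain ⟨x, hx, hx0⟩ := h.exists_ne_zero
  have h1 := DFunLike.congr_fun (Γ.anchor_act a v) x
  rw [h.anchor_eq, h.anchor_eq v, Derivation.smul_apply, Derivation.smul_apply,
    Derivation.smul_apply, smul_eq_mul, mul_smul_comm, h.mul_eq_smul a (h.character_anchor x),
    smul_smul, mul_comm (μ v)] at h1
  exact smul_left_injective ℂ (fun h0 => hx0 (h.eq_zero_of_anchor_eq_zero hx h0)) h1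

/-- By `coeff_act`, `x·b = ∂y` for some `y ∈ ker χ`, and pairing with `b` gives `b_0 y = (β - r²)
x`. Hence `r y` and `(β - r²) x` have the same image under `b_0`, which is injective on `ker χ`. -/
theorem smul_act_self (h : Γ.IsSplit χ μ b β c) {x : A} {r : ℂ} (hx : χ x = 0)
    (hdx : Γ.anchor b x = r • x) : r • Γ.act x b = Γ.del ((β - r ^ 2) • x) := by
  obtain ⟨n, hn⟩ := h.exists_del (Γ.act x b)
  rw [h.coeff_act, hx, zero_mul, zero_smul, zero_add, ← del_sub_smul_one n (χ n)] at hn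
  set y := n - χ n • 1 with hy
  have hχy : χ y = 0 := character_sub_smul_one χ n
  have h1 := Γ.pairing_act x b b
  rw [hn, pairing_del_left, h.pairing_self, hdx, Derivation.map_smul, hdx, mul_comm,
    ← Algebra.smul_def] at h1
  have h2 : r • y = (β - r ^ 2) • x := by
    rw [← sub_eq_zero]
    refine h.eq_zero_of_anchor_eq_zero (by simp [hχy, hx]) ?_
    rw [map_sub, Derivation.map_smul, Derivation.map_smul, h1, hdx]
    module
  rw [hn, ← map_smul, h2]

/-- The inverse of `k + n` with `n² = 0` is `(k - n)/k²`. -/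
theorem isUnit_iff (h : Γ.IsSplit χ μ b β c) (a : A) : IsUnit a ↔ χ a ≠ 0 := by
  refine ⟨fun ha => (ha.map χ).ne_zero, fun ha => ?_⟩
  refine IsUnit.of_mul_eq_one ((χ a ^ 2)⁻¹ • (χ a • 1 - (a - χ a • 1))) ?_
  have h1 := h.mul_eq_zero _ _ (character_sub_smul_one χ a) (character_sub_smul_one χ a)
  have h2 : a * (χ a • 1 - (a - χ a • 1)) = (χ a ^ 2) • 1 := by
    simp only [Algebra.smul_def, mul_one, map_pow] at h1 ⊢
    linear_combination -h1
  rw [mul_smul_comm, h2, smul_smul, inv_mul_cancel₀ (pow_ne_zero 2 ha), one_smul]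

theorem isLocalRing (h : Γ.IsSplit χ μ b β c) : IsLocalRing A := by
  obtain ⟨x, -, hx⟩ := h.exists_ne_zero
  have : Nontrivial A := ⟨x, 0, hx⟩
  refine IsLocalRing.of_isUnit_or_isUnit_one_sub_self fun a => ?_
  rw [h.isUnit_iff, h.isUnit_iff, map_sub, map_one]
  by_contra! h0
  exact one_ne_zero' ℂ (by linear_combination h0.1 + h0.2)

theorem mem_iff (h : Γ.IsSplit χ μ b β c) {𝔞 : Ideal A} (h𝔞 : 𝔞.IsMaximal) (a : A) :
    a ∈ 𝔞 ↔ χ a = 0 := by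
  refine ⟨fun ha => ?_, fun ha => ?_⟩
  · by_contra h0
    exact h𝔞.ne_top (Ideal.eq_top_of_isUnit_mem _ ha ((h.isUnit_iff a).2 h0))
  · refine (h𝔞.isPrime.mem_or_mem (?_ : a * a ∈ 𝔞)).elim id id
    rw [h.mul_eq_zero a a ha ha]
    exact 𝔞.zero_mem

end IsSplit

end VertexAlgebroid

end

noncomputable section

theorem commutator_smul_one_add {R : Type*} [Ring R] [Algebra ℂ R] (x y : R) (p q r s : ℂ) :
    (p • 1 + r • x) * (q • 1 + s • y) - (q • 1 + s • y) * (p • 1 + r • x) =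
      (r * s) • (x * y - y * x) := by
  simp only [mul_add, add_mul, smul_mul_assoc, mul_smul_comm, mul_one, one_mul]
  module

namespace HeisenbergAlg

/-- A module over the Heisenberg algebra of level `s ^ 2` is rescaled to level one. -/
theorem exists_fock_map_of_level {M : Type*} [AddCommGroup M] [Module ℂ M]
    (E : ℤ → Module.End ℂ M) {s : ℂ} (hs : s ≠ 0)
    (hE : ∀ m n v, E m (E n v) - E n (E m v) = if m + n = 0 then ((m : ℂ) * s ^ 2) • v else 0)
    {w : M} (hw : ∀ n, 0 ≤ n → E n w = 0) :
    ∃ ψ : Fock →ₗ[ℂ] M, ψ fockVac = w ∧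
      ∀ n v, ψ (envMode n • v) = s⁻¹ • E n (ψ v) := by
  refine exists_fock_map (fun n => s⁻¹ • E n) (fun m n => ?_) w fun n hn => ?_
  · ext1 v
    simp only [LinearMap.sub_apply, Module.End.mul_apply, LinearMap.smul_apply, map_smul]
    rw [← smul_sub, ← smul_sub, hE]
    split_ifs
    · simp only [smul_smul, LinearMap.smul_apply, Module.End.one_apply]
      congr 1
      field_simp
    · simp
  · rw [LinearMap.smul_apply, hw n hn, smul_zero]

end HeisenbergAlg

namespace VertexAlgebroid

open VertexField

variable {A B : Type*} [CommRing A] [Algebra ℂ A] [AddCommGroup B] [Module ℂ B]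
  {Γ : VertexAlgebroid A B} {χ : A →ₐ[ℂ] ℂ} {μ : B →ₗ[ℂ] ℂ} {b : B} {β c : ℂ}

/-! ### Relations in `V_B` -/

theorem mkQ_relSpace {e : Γ.VL} (he : e ∈ Γ.relSpace) : Γ.relIdeal.mkQ e = 0 :=
  (Submodule.Quotient.mk_eq_zero _).2 (Submodule.subset_span ⟨0, e, he, rfl⟩)

theorem vbVec_one : Γ.vbVec (1, 0) = Γ.vbVac := by
  have := mkQ_relSpace (Γ := Γ) (Submodule.subset_span (Or.inl (Or.inl rfl)))
  rwa [map_sub, sub_eq_zero, vlVec, map_smul] at this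

theorem envMode_vbVec_fst (a a' : A) :
    Γ.envMode (a, 0) (-1) • Γ.vbVec (a', 0) = Γ.vbVec (a * a', 0) := by
  have := mkQ_relSpace (Γ := Γ) (Submodule.subset_span (Or.inl (Or.inr ⟨a, a', rfl⟩)))
  rwa [map_sub, sub_eq_zero, map_smul, vlVec, vlVec, map_smul, map_smul] at this

theorem envMode_vbVec_snd (a : A) (v : B) :
    Γ.envMode (a, 0) (-1) • Γ.vbVec (0, v) = Γ.vbVec (0, Γ.act a v) := by
  have := mkQ_relSpace (Γ := Γ) (Submodule.subset_span (Or.inr ⟨a, v, rfl⟩))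
  rwa [map_sub, sub_eq_zero, map_smul, vlVec, vlVec, map_smul, map_smul] at this

theorem envMode_add (u v : A × B) (n : ℤ) :
    Γ.envMode (u + v) n = Γ.envMode u n + Γ.envMode v n :=
  map_add (Γ.envModeL n) u v

theorem envMode_smul (r : ℂ) (u : A × B) (n : ℤ) :
    Γ.envMode (r • u) n = r • Γ.envMode u n :=
  map_smul (Γ.envModeL n) r u

namespace IsVBStructure

variable {S : VertexAlgebra Γ.VB}

theorem prod_vbVec (hS : Γ.IsVBStructure S) (u : A × B) (n : ℤ) (v : Γ.VB) :
    S.prod n (Γ.vbVec u) v = Γ.envMode u n • v := hS.2 u n v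

theorem generates (hS : Γ.IsVBStructure S) : S.Generates (Set.range Γ.vbVec) := by
  intro K hvac hK
  refine Γ.vb_eq_top K (hS.1 ▸ hvac) fun u n v hv => ?_
  rw [← hS.prod_vbVec]
  exact hK _ ⟨u, rfl⟩ n v hv

theorem envMode_one (hS : Γ.IsVBStructure S) (n : ℤ) (v : Γ.VB) :
    Γ.envMode (1, 0) n • v = if n = -1 then v else 0 := by
  rw [← hS.prod_vbVec, vbVec_one, ← hS.1, S.vac_prod]

theorem envMode_mem (hS : Γ.IsVBStructure S) {I : Submodule ℂ Γ.VB} (hI : S.IsIdeal I)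
    (u : A × B) (n : ℤ) {v : Γ.VB} (hv : v ∈ I) : Γ.envMode u n • v ∈ I := by
  rw [← hS.prod_vbVec]
  exact (hI n _ v hv).1

theorem envMode_mem_of_vbVec_mem (hS : Γ.IsVBStructure S) {I : Submodule ℂ Γ.VB}
    (hI : S.IsIdeal I) {u : A × B} (hu : Γ.vbVec u ∈ I) (n : ℤ) (v : Γ.VB) :
    Γ.envMode u n • v ∈ I := by
  rw [← hS.prod_vbVec]
  exact (hI n v _ hu).2

end IsVBStructure

/-! ### The homomorphism from `V_B` onto `M(1)` and its kernel. -/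

namespace IsSplit

variable {S : VertexAlgebra Γ.VB}

/-- A subspace of `V_B` stable under the modes of `ker χ` and of `b` is stable under all modes. -/
theorem envMode_mem (h : Γ.IsSplit χ μ b β c) (hS : Γ.IsVBStructure S) {K : Submodule ℂ Γ.VB}
    (hx : ∀ x, χ x = 0 → ∀ n, ∀ v ∈ K, Γ.envMode (x, 0) n • v ∈ K)
    (hb : ∀ n, ∀ v ∈ K, Γ.envMode (0, b) n • v ∈ K) (u : A × B) (n : ℤ) {v : Γ.VB} (hv : v ∈ K) :
    Γ.envMode u n • v ∈ K := by
  obtain ⟨a, w⟩ := u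
  obtain ⟨a', ha'⟩ := h.exists_del w
  rw [← del_sub_smul_one a' (χ a')] at ha'
  have hu : ((a, w) : A × B) = (a - χ a • 1, 0) + χ a • (1, 0) + μ w • (0, b) +
      (0, Γ.del (a' - χ a' • 1)) := by
    ext
    · simp
    · simpa using ha'
  rw [hu, envMode_add, envMode_add, envMode_add, envMode_smul, envMode_smul, envMode_del,
    add_smul, add_smul, add_smul, smul_assoc, smul_assoc, smul_assoc, hS.envMode_one]
  refine add_mem (add_mem (add_mem (hx _ (character_sub_smul_one χ a) n v hv) ?_)
    (K.smul_mem _ (hb n v hv))) (K.smul_mem _ (hx _ (character_sub_smul_one χ a') _ v hv))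
  refine K.smul_mem _ ?_
  split_ifs
  exacts [hv, K.zero_mem]

/-- A module over the Heisenberg algebra with a vacuum vector is the target of a map from `V_B`. -/
theorem exists_map_of_modes (h : Γ.IsSplit χ μ b β c) {M : Type*} [AddCommGroup M] [Module ℂ M]
    (E : ℤ → Module.End ℂ M)
    (hE : ∀ m n, E m * E n - E n * E m = if m + n = 0 then (m : ℂ) • 1 else 0)
    {D : Module.End ℂ M} (hD : IsCovariant D E) {w : M} (hw : ∀ n, 0 ≤ n → E n w = 0)
    (hDw : D w = 0) {s : ℂ} (hs : s ^ 2 = β) :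
    ∃ φ : Γ.VB →ₗ[ℂ] M, φ Γ.vbVac = w ∧ ∀ u n v, φ (Γ.envMode u n • v) =
      (if n = -1 then χ u.1 else 0) • φ v + (μ u.2 * s) • E n (φ v) := by
  -- `A` acts through `χ` in mode `-1` only, and `b` by `s E n`; the factor `s² = β` turns level one
  -- into the pairing of `b` with itself.
  let op : ℤ → A × B →ₗ[ℂ] Module.End ℂ M := fun n =>
    LinearMap.toSpanSingleton ℂ _ (if n = -1 then 1 else 0) ∘ₗ χ.toLinearMap ∘ₗ
        LinearMap.fst ℂ A B +
      LinearMap.toSpanSingleton ℂ _ (s • E n) ∘ₗ μ ∘ₗ LinearMap.snd ℂ A B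
  have hop : ∀ n u, op n u = (if n = -1 then χ u.1 else 0) • 1 + (μ u.2 * s) • E n := by
    intro n u
    simp only [op, LinearMap.add_apply, LinearMap.comp_apply, LinearMap.toSpanSingleton_apply,
      smul_smul]
    split_ifs <;> simp
  have hop' : ∀ n u v, op n u v = (if n = -1 then χ u.1 else 0) • v + (μ u.2 * s) • E n v :=
    fun n u v => by rw [hop]; rfl
  have hdel : ∀ a n, op n (0, Γ.del a) + (n : ℂ) • op (n - 1) (a, 0) = 0 := by
    intro a n
    rw [hop, hop, h.coeff_del]
    rcases eq_or_ne n 0 with rfl | hn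
    · simp
    · have : n - 1 ≠ -1 := by omega
      simp [this]
  have hcomm : ∀ u v m n, op m u * op n v - op n v * op m u =
      op (m + n) (Γ.anchor u.2 v.1 - Γ.anchor v.2 u.1, Γ.bracket u.2 v.2) +
        (m : ℂ) • op (m + n - 1) (Γ.pairing u.2 v.2, 0) := by
    intro u v m n
    rw [hop, hop, hop, hop, commutator_smul_one_add, hE, h.coeff_bracket, map_sub,
      h.character_anchor_apply, h.character_anchor_apply, h.character_pairing, ← hs]
    have hiff : m + n - 1 = -1 ↔ m + n = 0 := by omega
    simp only [hiff, map_zero]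
    split_ifs <;> module
  have hcov : ∀ u, IsCovariant D fun n => op n u := by
    intro u n v
    simp only [hop']
    rw [map_add, map_smul, map_smul, hD n v]
    rcases eq_or_ne n 0 with rfl | hn
    · simp
    · rw [if_neg (show n - 1 ≠ -1 by omega)]
      module
  obtain ⟨φ, h1, h2⟩ := Γ.exists_vb_map op hdel hcomm D hcov w
    (fun n u hn => by
      rw [hop', if_neg (by omega), hw n hn]
      simp) hDw (by simp [hop'])
    (fun a a' => by simp [hop', smul_smul])
    (fun a v => by
      simp only [hop', h.coeff_act]
      simp [smul_smul, mul_assoc])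
  exact ⟨φ, h1, fun u n v => by rw [h2, hop']⟩

open HeisenbergAlg in
/-- The homomorphism from `V_B` to the Heisenberg vertex algebra. -/
theorem exists_map (h : Γ.IsSplit χ μ b β c) {s : ℂ} (hs : s ^ 2 = β) :
    ∃ φ : Γ.VB →ₗ[ℂ] Fock, φ Γ.vbVac = fockVac ∧ ∀ u n v, φ (Γ.envMode u n • v) =
      (if n = -1 then χ u.1 else 0) • φ v + (μ u.2 * s) • HeisenbergAlg.envMode n • φ v := by
  obtain ⟨D, hD1, hD2⟩ := exists_transl
  refine h.exists_map_of_modes modeOp (fun m n => ?_) hD2 mode_vac hD1 hs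
  refine LinearMap.ext fun v => (mode_commutator m n v).trans ?_
  split_ifs <;> rfl

theorem envMode_self_commutator (h : Γ.IsSplit χ μ b β c) (hS : Γ.IsVBStructure S) (m n : ℤ)
    (v : Γ.VB) : Γ.envMode (0, b) m • Γ.envMode (0, b) n • v -
      Γ.envMode (0, b) n • Γ.envMode (0, b) m • v = if m + n = 0 then ((m : ℂ) * β) • v else 0 := by
  have e : ((algebraMap ℂ A β, 0) : A × B) = β • (1, 0) := by
    ext <;> simp [Algebra.algebraMap_eq_smul_one]
  have e' : Γ.envMode (Γ.anchor b 0 - Γ.anchor b 0, 0) (m + n) = 0 := by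
    rw [sub_self]
    exact map_zero (Γ.envModeL (m + n))
  rw [vbOp_commutator, h.bracket_self, h.pairing_self, e, e', envMode_smul, smul_assoc,
    hS.envMode_one, zero_smul, zero_add, smul_smul]
  have hiff : m + n - 1 = -1 ↔ m + n = 0 := by omega
  simp only [hiff, smul_ite, smul_zero]

open HeisenbergAlg in
/-- The subspace `M(1)` of `V_B` generated by the modes of `b`. -/
theorem exists_section (h : Γ.IsSplit χ μ b β c) (hS : Γ.IsVBStructure S) {s : ℂ} (hs0 : s ≠ 0)
    (hs : s ^ 2 = β) :
    ∃ ψ : Fock →ₗ[ℂ] Γ.VB, ψ fockVac = Γ.vbVac ∧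
      ∀ n v, ψ (HeisenbergAlg.envMode n • v) = s⁻¹ • Γ.envMode (0, b) n • ψ v :=
  exists_fock_map_of_level (Γ.vbOp (0, b)) hs0
    (fun m n v => hs ▸ h.envMode_self_commutator hS m n v) fun _ hn => Γ.envMode_vbVac _ _ hn

open HeisenbergAlg in
/-- The ideal of `V_B` generated by the maximal ideal of `A` is the kernel of a homomorphism onto
the Heisenberg vertex algebra. -/
theorem exists_hom (h : Γ.IsSplit χ μ b β c) (hS : Γ.IsVBStructure S)
    {T : VertexAlgebra Fock} (hT : IsFockStructure T) :
    ∃ (φ : Γ.VB →ₗ[ℂ] Fock) (s : ℂ), s ≠ 0 ∧ φ S.vac = T.vac ∧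
      (∀ n u v, φ (S.prod n u v) = T.prod n (φ u) (φ v)) ∧
      (∀ n v, φ (Γ.envMode (0, b) n • v) = s • HeisenbergAlg.envMode n • φ v) ∧
      Function.Surjective φ ∧
      LinearMap.ker φ = S.idealSpan {v | ∃ x, χ x = 0 ∧ v = Γ.vbVec (x, 0)} := by
  obtain ⟨s, hs⟩ := IsAlgClosed.exists_pow_nat_eq β (n := 2) (by norm_num)
  have hs0 : s ≠ 0 := by
    rintro rfl
    exact h.level_ne_zero (by rw [← hs]; ring)
  obtain ⟨φ, φvac, hφ⟩ := h.exists_map hs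
  obtain ⟨ψ, ψvac, hψ⟩ := h.exists_section hS hs0 hs
  have hφb : ∀ n v, φ (Γ.envMode (0, b) n • v) = s • HeisenbergAlg.envMode n • φ v := by
    intro n v
    rw [hφ]
    simp [h.coeff_self]
  have hvac : φ S.vac = T.vac := by rw [hS.1, hT.1, φvac]
  have hprod : ∀ n u v, φ (S.prod n u v) = T.prod n (φ u) (φ v) := by
    refine hS.generates.map_prod φ hvac ?_
    rintro _ ⟨u, rfl⟩ n v
    rw [hS.prod_vbVec, hφ, vbVec, hφ, φvac, if_pos rfl, map_add, map_smul, map_smul,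
      LinearMap.add_apply, LinearMap.smul_apply, LinearMap.smul_apply, hT.2, ← hT.1, T.vac_prod,
      ite_smul, zero_smul, smul_ite, smul_zero]
  have hφψ : ∀ f, φ (ψ f) = f := by
    have : LinearMap.eqLocus (φ ∘ₗ ψ) LinearMap.id = ⊤ := by
      refine fock_eq_top _ ?_ fun n v hv => ?_
      · change φ (ψ fockVac) = fockVac
        rw [ψvac, φvac]
      · change φ (ψ _) = _
        have hv' : φ (ψ v) = v := hv
        rw [hψ, map_smul, hφb, hv', smul_smul, inv_mul_cancel₀ hs0, one_smul]
        rfl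
    intro f
    have hf : f ∈ LinearMap.eqLocus (φ ∘ₗ ψ) LinearMap.id := this ▸ Submodule.mem_top
    exact hf
  set I := S.idealSpan {v | ∃ x, χ x = 0 ∧ v = Γ.vbVec (x, 0)} with hI
  have idI : S.IsIdeal I := S.isIdeal_idealSpan _
  have memI : ∀ x, χ x = 0 → Γ.vbVec (x, 0) ∈ I := fun x hx =>
    (Submodule.mem_sInf).2 fun K hK => hK.2 ⟨x, hx, rfl⟩
  have hle : I ≤ LinearMap.ker φ := by
    refine sInf_le ⟨fun n u v hv => ?_, ?_⟩
    · rw [LinearMap.mem_ker] at hv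
      rw [LinearMap.mem_ker, LinearMap.mem_ker, hprod, hprod, hv]
      simp
    · rintro _ ⟨x, hx, rfl⟩
      change φ _ = 0
      rw [vbVec, hφ]
      simp [hx]
  -- Modes of `ker χ` map everything into `I`, and modes of `b` preserve both summands. Together
  -- with `φ ∘ ψ = id` and `I ≤ ker φ` this gives `ker φ = I`.
  have htop : LinearMap.range ψ ⊔ I = ⊤ := by
    refine Γ.vb_eq_top _ (Submodule.mem_sup_left ⟨_, ψvac⟩) fun u n v hv => ?_
    refine h.envMode_mem hS (fun x hx n v _ => ?_) (fun n v hv => ?_) u n hv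
    · exact Submodule.mem_sup_right (hS.envMode_mem_of_vbVec_mem idI (memI x hx) n v)
    · obtain ⟨_, ⟨f, rfl⟩, y, hy, rfl⟩ := Submodule.mem_sup.1 hv
      rw [smul_add]
      refine add_mem (Submodule.mem_sup_left ⟨s • HeisenbergAlg.envMode n • f, ?_⟩)
        (Submodule.mem_sup_right (hS.envMode_mem idI _ n hy))
      rw [map_smul, hψ, smul_smul, mul_inv_cancel₀ hs0, one_smul]
  refine ⟨φ, s, hs0, hvac, hprod, hφb, fun f => ⟨ψ f, hφψ f⟩, le_antisymm (fun v hv => ?_) hle⟩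
  have hv' : v ∈ LinearMap.range ψ ⊔ I := htop ▸ Submodule.mem_top
  obtain ⟨_, ⟨f, rfl⟩, y, hy, rfl⟩ := Submodule.mem_sup.1 hv'
  rw [LinearMap.mem_ker, map_add, hφψ, LinearMap.mem_ker.1 (hle hy), add_zero] at hv
  rw [hv, map_zero, zero_add]
  exact hy

open HeisenbergAlg in
-- A strictly larger ideal has nonzero image in `M(1)`, so its image contains the vacuum; a preimage
-- differs from `𝟏` by an element of `ker φ`, so the ideal contains `𝟏`.
theorem isMaximalIdeal (h : Γ.IsSplit χ μ b β c) (hS : Γ.IsVBStructure S) :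
    S.IsMaximalIdeal (S.idealSpan {v | ∃ x, χ x = 0 ∧ v = Γ.vbVec (x, 0)}) := by
  obtain ⟨T, hT⟩ := exists_isFockStructure
  obtain ⟨φ, s, hs0, hvac, -, hφb, -, hker⟩ := h.exists_hom hS hT
  refine ⟨S.isIdeal_idealSpan _, fun h0 => ?_, fun J hJ hle htop => ?_⟩
  · have : S.vac ∈ LinearMap.ker φ := by
      rw [hker, h0]
      exact Submodule.mem_top
    rw [LinearMap.mem_ker, hvac, hT.1] at this
    exact fockVac_ne_zero this
  · rw [← hker] at hle ⊢
    by_contra hne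
    have hK : J.map φ ≠ ⊥ := fun h0 =>
      hne (le_antisymm (fun v hv => (Submodule.mem_bot ℂ).1 (h0 ▸ Submodule.mem_map_of_mem hv)) hle)
    obtain ⟨v, hv, hφv⟩ := fockVac_mem (J.map φ) (by
      rintro n - _ ⟨v, hv, rfl⟩
      refine ⟨s⁻¹ • Γ.envMode (0, b) n • v, J.smul_mem _ (hS.envMode_mem hJ _ n hv), ?_⟩
      rw [map_smul, hφb, smul_smul, inv_mul_cancel₀ hs0, one_smul]) hK
    refine htop (hJ.eq_top ?_)
    have : v - S.vac ∈ J := hle (by rw [LinearMap.mem_ker, map_sub, hφv, hvac, hT.1, sub_self])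
    exact (Submodule.sub_mem_iff_right _ hv).1 this

open HeisenbergAlg in
theorem isomorphic (h : Γ.IsSplit χ μ b β c) (hS : Γ.IsVBStructure S) {T : VertexAlgebra Fock}
    (hT : IsFockStructure T) :
    (S.quotient (S.idealSpan {v | ∃ x, χ x = 0 ∧ v = Γ.vbVec (x, 0)})
      (S.isIdeal_idealSpan _)).Isomorphic T := by
  obtain ⟨φ, -, -, hvac, hprod, -, hsurj, hker⟩ := h.exists_hom hS hT
  let e := (Submodule.quotEquivOfEq _ _ hker.symm).trans (φ.quotKerEquivOfSurjective hsurj)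
  have he : ∀ v, e (Submodule.mkQ _ v) = φ v := fun v => rfl
  refine ⟨e, (he _).trans hvac, fun n u v => ?_⟩
  obtain ⟨u, rfl⟩ := Submodule.mkQ_surjective _ u
  obtain ⟨v, rfl⟩ := Submodule.mkQ_surjective _ v
  rw [he, he, ← hprod, ← he]
  exact congrArg e (S.quotientProd_mk _ (S.isIdeal_idealSpan _) n u v)

end IsSplit

end VertexAlgebroid

end

noncomputable section

/-! ## Uniqueness of the maximal ideal -/

section

variable {V : Type*} [AddCommGroup V] [Module ℂ V]

/-- The vectors carried into `J` by a product of operators `N - r` with `r ∈ R`. -/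
inductive IsAttracted (N : Module.End ℂ V) (J : Submodule ℂ V) (R : Set ℂ) : V → Prop
  | of_mem {v : V} : v ∈ J → IsAttracted N J R v
  | of_sub {r : ℂ} {v : V} : r ∈ R → IsAttracted N J R (N v - r • v) → IsAttracted N J R v

variable {N : Module.End ℂ V} {J : Submodule ℂ V} {R : Set ℂ}

namespace IsAttracted

theorem map_of_commute {T : Module.End ℂ V} (hT : ∀ v, N (T v) = T (N v)) (hJ : ∀ v ∈ J, T v ∈ J)
    {v : V} (hv : IsAttracted N J R v) : IsAttracted N J R (T v) := by
  induction hv with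
  | of_mem hv => exact of_mem (hJ _ hv)
  | of_sub hr _ ih => exact of_sub hr (by rwa [hT, ← map_smul, ← map_sub])

theorem smul (k : ℂ) {v : V} (hv : IsAttracted N J R v) : IsAttracted N J R (k • v) :=
  hv.map_of_commute (T := k • 1) (fun v => by simp) fun _ hv => J.smul_mem k hv

theorem add (hJ : ∀ v ∈ J, N v ∈ J) {v w : V} (hv : IsAttracted N J R v)
    (hw : IsAttracted N J R w) : IsAttracted N J R (v + w) := by
  induction hv generalizing w with
  | @of_mem v hv =>
    induction hw generalizing v with
    | of_mem hw => exact of_mem (add_mem hv hw)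
    | @of_sub r w hr _ ih =>
      refine of_sub hr ?_
      have := ih (sub_mem (hJ v hv) (J.smul_mem r hv))
      rwa [show N (v + w) - r • (v + w) = N v - r • v + (N w - r • w) by rw [map_add]; module]
  | @of_sub r v hr _ ih =>
    refine of_sub hr ?_
    rw [show N (v + w) - r • (v + w) = N v - r • v + (N w - r • w) by rw [map_add]; module]
    exact ih (hw.map_of_commute (T := N - r • 1) (fun v => by simp)
      fun v hv => sub_mem (hJ v hv) (J.smul_mem r hv))

/-- Stability under an operator `T` with `[N, T] = t T + T'`. -/
theorem map_of_commutator (hJ : ∀ v ∈ J, N v ∈ J) {T T' : Module.End ℂ V} {t : ℂ}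
    (hT : ∀ v, N (T v) = T (N v) + t • T v + T' v) (hTJ : ∀ v ∈ J, T v ∈ J)
    (ht : ∀ r ∈ R, r + t ∈ R) (hT' : ∀ v, IsAttracted N J R v → IsAttracted N J R (T' v))
    {v : V} (hv : IsAttracted N J R v) : IsAttracted N J R (T v) := by
  induction hv with
  | of_mem hv => exact of_mem (hTJ _ hv)
  | @of_sub r v hr h ih =>
    refine of_sub (ht r hr) ?_
    rw [show N (T v) - (r + t) • T v = T (N v - r • v) + T' v by
      rw [hT, map_sub, map_smul]; module]
    exact ih.add hJ (hT' v (of_sub hr h))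

/-- Each factor `N - r` multiplies `w` by `-r ≠ 0`. The scalar `k` is left free because the
induction changes it. -/
theorem smul_mem_of_sub_mem (hJ : ∀ v ∈ J, N v ∈ J) (hR : 0 ∉ R) {w : V} (hw : N w = 0) {v : V}
    (hv : IsAttracted N J R v) : ∀ k : ℂ, v - k • w ∈ J → k • w ∈ J := by
  induction hv with
  | of_mem hv => exact fun k h => (Submodule.sub_mem_iff_right _ hv).1 h
  | @of_sub r v hr h ih =>
    intro k hk
    have := ih (-r * k) (by
      have := sub_mem (hJ _ hk) (J.smul_mem r hk)
      rw [map_sub, map_smul, hw] at this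
      convert this using 1
      module)
    rw [mul_smul] at this
    exact (Submodule.smul_mem_iff _ (neg_ne_zero.2 fun h0 : r = 0 => hR (h0 ▸ hr))).1 this

theorem mem_of_apply_eq_zero (hJ : ∀ v ∈ J, N v ∈ J) (hR : 0 ∉ R) {w : V} (hw : N w = 0)
    (h : IsAttracted N J R w) : w ∈ J := by
  simpa using h.smul_mem_of_sub_mem hJ hR hw 1 (by simp)

end IsAttracted

/-- The vectors that are attracted to `J` form a subspace. -/
def attractedSubmodule (hJ : ∀ v ∈ J, N v ∈ J) (R : Set ℂ) : Submodule ℂ V where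
  carrier := {v | IsAttracted N J R v}
  zero_mem' := .of_mem J.zero_mem
  add_mem' := fun hv hw => hv.add hJ hw
  smul_mem' := fun k _ hv => hv.smul k

theorem mem_attractedSubmodule {hJ : ∀ v ∈ J, N v ∈ J} {v : V} :
    v ∈ attractedSubmodule hJ R ↔ IsAttracted N J R v := Iff.rfl

end

/-! ### Leading exponents of products of eigenvectors. -/

namespace VertexAlgebra

variable {V : Type*} [AddCommGroup V] [Module ℂ V]

open VertexField

/-- If `r b_{-1} x` is `k` times the derivative of `x` and `y` is an eigenvector of weight `t`
for `b`, then the leading coefficient of `Y(x,z) y` has exponent `r t / k`. -/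
theorem mul_eq_of_prod_eq_zero (S : VertexAlgebra V) {b x y x' : V} {r t k : ℂ}
    (hx : r • S.prod (-1) b x = k • x')
    (hx' : ∀ n, S.prod n x' y = (-(n : ℂ)) • S.prod (n - 1) x y) (h0 : S.prod 0 b y = t • y)
    (hpos : ∀ i, 0 < i → S.prod i b y = 0) {m : ℤ} (hm : ∀ i, m < i → S.prod i x y = 0)
    (hne : S.prod m x y ≠ 0) : r * t = -((m : ℂ) + 1) * k := by
  -- In the expansion of `(b_{-1} x)_{m+1} y` only `x_m b_0 y` survives: the `x_i y` with `i > m`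
  -- and the `b_i y` with `i > 0` vanish.
  have h1 : S.prod (m + 1) (S.prod (-1) b x) y = t • S.prod m x y := by
    rw [prod_prod, borcherds, finsum_eq_single _ 0]
    · rw [hm _ (by simp)]
      simp [h0]
    · intro i hi
      rw [hm _ (by omega), hpos _ (by omega)]
      simp
  have h2 := congrArg (fun z => S.prod (m + 1) z y) hx
  simp only [map_smul, LinearMap.smul_apply, hx', h1] at h2
  rw [smul_smul, smul_smul, add_sub_cancel_right] at h2
  have := smul_left_injective ℂ hne h2
  rw [this]
  push_cast
  ring

theorem exists_prod_ne_zero_of_prod_ne_zero (S : VertexAlgebra V) {x y : V} {n : ℤ}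
    (hn : S.prod n x y ≠ 0) : ∃ m, S.prod m x y ≠ 0 ∧ ∀ i, m < i → S.prod i x y = 0 := by
  obtain ⟨N, hN⟩ := S.truncation x y
  obtain ⟨m, hm, hmax⟩ := Int.exists_greatest_of_bdd (P := fun n => S.prod n x y ≠ 0)
    ⟨N, fun z hz => by
      by_contra! h
      exact hz (hN z h.le)⟩ ⟨n, hn⟩
  exact ⟨m, hm, fun i hi => by
    by_contra h
    exact absurd (hmax i h) (by omega)⟩

end VertexAlgebra

namespace VertexAlgebroid

variable {A B : Type*} [CommRing A] [Algebra ℂ A] [AddCommGroup B] [Module ℂ B]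
  {Γ : VertexAlgebroid A B} {χ : A →ₐ[ℂ] ℂ} {μ : B →ₗ[ℂ] ℂ} {b : B} {β c : ℂ}
  {S : VertexAlgebra Γ.VB}

theorem envMode_zero (n : ℤ) : Γ.envMode 0 n = 0 := map_zero (Γ.envModeL n)

theorem envMode_snd_fst (v : B) (x : A) (m n : ℤ) (w : Γ.VB) :
    Γ.envMode (0, v) m • Γ.envMode (x, 0) n • w =
      Γ.envMode (x, 0) n • Γ.envMode (0, v) m • w + Γ.envMode (Γ.anchor v x, 0) (m + n) • w := by
  have := Γ.vbOp_commutator (0, v) (x, 0) m n w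
  simp only [map_zero, sub_zero] at this
  rw [← Prod.zero_eq_mk, envMode_zero, zero_smul, smul_zero, add_zero] at this
  rw [← this]
  abel

theorem envMode_fst_fst (x y : A) (m n : ℤ) (w : Γ.VB) :
    Γ.envMode (x, 0) m • Γ.envMode (y, 0) n • w =
      Γ.envMode (y, 0) n • Γ.envMode (x, 0) m • w := by
  have := Γ.vbOp_commutator (x, 0) (y, 0) m n w
  simp only [map_zero, Derivation.coe_zero, Pi.zero_apply, sub_zero] at this
  rw [← Prod.zero_eq_mk, envMode_zero, envMode_zero, zero_smul, smul_zero, add_zero,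
    sub_eq_zero] at this
  exact this

theorem envMode_snd_vbVec (v : B) (x : A) (i : ℤ) (hi : 0 ≤ i) :
    Γ.envMode (0, v) i • Γ.vbVec (x, 0) = Γ.envMode (Γ.anchor v x, 0) (i - 1) • Γ.vbVac := by
  rw [vbVec, envMode_snd_fst, envMode_vbVac _ _ _ hi, smul_zero, zero_add, sub_eq_add_neg]

theorem vbVec_del (x : A) : Γ.vbVec (0, Γ.del x) = Γ.envMode (x, 0) (-2) • Γ.vbVac := by
  rw [vbVec, envMode_del]
  simp

/-! ### Eigenvectors of `b_0` modulo a maximal ideal. -/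

namespace IsSplit

/-- Exchanging modes, `b_{-1} x = x·b + r ∂x`; after multiplication by `r` the contribution `(β -
r²) ∂x` of `smul_act_self` and `r² ∂x` add up to `β ∂x`. -/
theorem smul_envMode_vbVec (h : Γ.IsSplit χ μ b β c) {x : A} {r : ℂ} (hx : χ x = 0)
    (hdx : Γ.anchor b x = r • x) :
    r • Γ.envMode (0, b) (-1) • Γ.vbVec (x, 0) = β • Γ.vbVec (0, Γ.del x) := by
  have e : ∀ (t : ℂ) (u : A × B), Γ.vbVec (t • u) = t • Γ.vbVec u := fun t u => by
    rw [vbVec, envMode_smul, smul_assoc, vbVec]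
  rw [vbVec, envMode_snd_fst, ← vbVec, envMode_vbVec_snd, smul_add, ← e, hdx]
  have e1 : r • ((0, Γ.act x b) : A × B) = (β - r ^ 2) • (0, Γ.del x) := by
    rw [Prod.smul_mk, Prod.smul_mk, h.smul_act_self hx hdx, map_smul, smul_zero, smul_zero]
  have e2 : ((r • x, 0) : A × B) = r • (x, 0) := by simp
  rw [e1, e2, envMode_smul, smul_assoc, e, show (-1 + -1 : ℤ) = -2 by norm_num, ← vbVec_del]
  module

/-- The exponent of the leading coefficient of `Y(x,z) y` modulo a maximal ideal. -/
theorem exists_mul_eq (h : Γ.IsSplit χ μ b β c) (hS : Γ.IsVBStructure S) {J : Submodule ℂ Γ.VB}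
    (hJ : S.IsMaximalIdeal J) {x y : A} {r t : ℂ} (hx : χ x = 0) (hy : χ y = 0)
    (hdx : Γ.anchor b x = r • x) (hdy : Γ.anchor b y = t • y) (hxJ : Γ.vbVec (x, 0) ∉ J)
    (hyJ : Γ.vbVec (y, 0) ∉ J) : ∃ n : ℕ, 0 < n ∧ r * t = n * β := by
  obtain ⟨n, hn⟩ : ∃ n, S.prod n (Γ.vbVec (x, 0)) (Γ.vbVec (y, 0)) ∉ J := by
    by_contra! h0
    exact (hJ.mem_or_mem h0).elim hxJ hyJ
  let Q := S.quotient J hJ.1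
  have hQ : ∀ n u v, Q.prod n (J.mkQ u) (J.mkQ v) = J.mkQ (S.prod n u v) :=
    S.quotientProd_mk J hJ.1
  have hmk : ∀ v, J.mkQ v = 0 ↔ v ∈ J := fun v => Submodule.Quotient.mk_eq_zero J
  obtain ⟨m, hm, hmax⟩ := Q.exists_prod_ne_zero_of_prod_ne_zero (x := J.mkQ (Γ.vbVec (x, 0)))
    (y := J.mkQ (Γ.vbVec (y, 0))) (n := n) (by rwa [hQ, Ne, hmk])
  -- `x_{-1} y = x * y = 0`, and the nonnegative modes of `A` vanish on `A`; hence the exponent `-(m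
  -- + 1)` is positive.
  have hlt : m < -1 := by
    by_contra! h0
    rw [hQ, hS.prod_vbVec] at hm
    rcases h0.eq_or_lt with rfl | h0
    · rw [envMode_vbVec_fst, h.mul_eq_zero x y hx hy, ← Prod.zero_eq_mk, vbVec, envMode_zero,
        zero_smul, map_zero] at hm
      exact hm rfl
    · rw [vbVec, envMode_fst_fst, envMode_vbVac _ _ _ (by omega), smul_zero, map_zero] at hm
      exact hm rfl
  have e : ((t • y, 0) : A × B) = t • (y, 0) := by simp
  have key : r * t = -((m : ℂ) + 1) * β :=
    Q.mul_eq_of_prod_eq_zero (b := J.mkQ (Γ.vbVec (0, b))) (x' := J.mkQ (Γ.vbVec (0, Γ.del x)))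
      (by rw [hQ, hS.prod_vbVec, ← map_smul, h.smul_envMode_vbVec hx hdx, map_smul])
      (fun n => by
        rw [hQ, hQ, hS.prod_vbVec, hS.prod_vbVec, envMode_del, smul_assoc, map_smul])
      (by rw [hQ, hS.prod_vbVec, envMode_snd_vbVec _ _ _ le_rfl, hdy, e, envMode_smul,
        smul_assoc, map_smul, zero_sub, vbVec])
      (fun i hi => by
        rw [hQ, hS.prod_vbVec, envMode_snd_vbVec _ _ _ hi.le, envMode_vbVac _ _ _ (by omega),
          map_zero]) hmax hm
  refine ⟨(-(m + 1)).toNat, by omega, ?_⟩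
  have hcast : (((-(m + 1)).toNat : ℤ) : ℂ) = ((-(m + 1) : ℤ) : ℂ) := by
    rw [Int.toNat_of_nonneg (by omega)]
  rw [Int.cast_natCast] at hcast
  rw [key, hcast]
  push_cast
  ring

/-- If the eigenvalues of `b_0` that occur modulo `J` lie in `R`, then `ker χ` lies in `J`. -/
theorem vbVec_mem_of_forall (h : Γ.IsSplit χ μ b β c) (hS : Γ.IsVBStructure S)
    {J : Submodule ℂ Γ.VB} (hJ : S.IsMaximalIdeal J) {R : Set ℂ} (hR : 0 ∉ R)
    (hadd : ∀ r ∈ R, ∀ t ∈ R, r + t ∈ R) {r t : ℂ} (hsum : r + t = c) (hprod : r * t = -1)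
    (ht : t ∈ R)
    (hr : r ∈ R ∨ ∀ x, χ x = 0 → Γ.anchor b x = r • x → Γ.vbVec (x, 0) ∈ J) (x : A)
    (hx : χ x = 0) : Γ.vbVec (x, 0) ∈ J := by
  set N := Γ.vbOp (0, b) 0 with hN
  have hNJ : ∀ v ∈ J, N v ∈ J := fun v hv => hS.envMode_mem hJ.1 _ 0 hv
  set W := attractedSubmodule hNJ R with hW
  have hJW : J ≤ W := fun v hv => .of_mem hv
  have hNvac : N Γ.vbVac = 0 := Γ.envMode_vbVac _ 0 le_rfl
  let good : A → Prop := fun y =>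
    (∀ n v, v ∈ W → Γ.envMode (y, 0) n • v ∈ W) ∧ Γ.vbVec (y, 0) ∈ W
  have good_of_mem : ∀ y, Γ.vbVec (y, 0) ∈ J → good y := fun y hy =>
    ⟨fun n v _ => hJW (hS.envMode_mem_of_vbVec_mem hJ.1 hy n v), hJW hy⟩
  -- Because `[b(0), y(n)] = (b_0 y)(n)`, the modes of `y` shift the shifts in `R` by `q`, up to
  -- modes of `b_0 y - q y`. Starting from zero, or from eigenvectors in `J`, one climbs to all of
  -- `ker χ`.
  have good_of_sub : ∀ y, ∀ q ∈ R, good (Γ.anchor b y - q • y) → good y := by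
    intro y q hq hy
    have comm : ∀ n v, N (Γ.vbOp (y, 0) n v) = Γ.vbOp (y, 0) n (N v) + q • Γ.vbOp (y, 0) n v +
        Γ.vbOp (Γ.anchor b y - q • y, 0) n v := by
      intro n v
      have e : ((Γ.anchor b y, 0) : A × B) = q • (y, 0) + (Γ.anchor b y - q • y, 0) := by
        ext <;> simp
      rw [hN, vbOp_apply, vbOp_apply, envMode_snd_fst, zero_add, e, envMode_add, envMode_smul,
        add_smul, smul_assoc, add_assoc]
      rfl
    refine ⟨fun n v hv => ?_, ?_⟩
    · exact IsAttracted.map_of_commutator hNJ (comm n) (fun v hv => hS.envMode_mem hJ.1 _ n hv)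
        (fun p hp => hadd p hp q hq) (hy.1 n) hv
    · refine .of_sub hq ?_
      have : N (Γ.vbVec (y, 0)) - q • Γ.vbVec (y, 0) = Γ.vbVec (Γ.anchor b y - q • y, 0) := by
        have := comm (-1) Γ.vbVac
        rw [hNvac, map_zero, zero_add] at this
        exact sub_eq_iff_eq_add'.2 this
      rw [this]
      exact hy.2
  have good_zero : good 0 := good_of_mem 0 (by
    rw [← Prod.zero_eq_mk, vbVec, envMode_zero, zero_smul]
    exact J.zero_mem)
  have hgood : ∀ y, χ y = 0 → good y := by
    intro y hy
    refine good_of_sub y t ht ?_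
    set z := Γ.anchor b y - t • y with hz
    have hχz : χ z = 0 := by rw [hz, map_sub, map_smul, hy, h.character_anchor]; simp
    -- This is `(b_0 - r)(b_0 - t) = 0` on `ker χ`.
    have hdz : Γ.anchor b z = r • z := by
      rw [hz, map_sub, Derivation.map_smul, h.anchor_anchor y hy, ← hsum]
      have : y = (-(r * t)) • y := by rw [hprod]; simp
      nth_rewrite 1 [this]
      module
    rcases hr with hr | hr
    · refine good_of_sub z r hr ?_
      rw [hdz, sub_self]
      exact good_zero
    · exact good_of_mem z (hr z hχz hdz)
  have hWb : ∀ n v, v ∈ W → Γ.envMode (0, b) n • v ∈ W := by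
    intro n v hv
    refine IsAttracted.map_of_commute (T := Γ.vbOp (0, b) n) (fun v => ?_)
      (fun v hv => hS.envMode_mem hJ.1 _ n hv) hv
    have := h.envMode_self_commutator hS 0 n v
    rw [Int.cast_zero, zero_mul, zero_smul, ite_self, sub_eq_zero] at this
    exact this
  have hWideal : S.IsIdeal W := by
    refine S.isIdeal_of_left (fun v hv => ?_) fun n u v hv => ?_
    · refine IsAttracted.map_of_commute (T := S.transl) (fun v => ?_)
        (fun v hv => hJ.1.transl_mem hv) hv
      have := S.transl_prod (Γ.vbVec (0, b)) v 0
      rw [Int.cast_zero, zero_smul, sub_zero, hS.prod_vbVec, hS.prod_vbVec] at this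
      exact this.symm
    · refine hS.generates.prod_mem ?_ n u v hv
      rintro _ ⟨u, rfl⟩ n v hv
      rw [hS.prod_vbVec]
      exact h.envMode_mem hS (fun x hx n v hv => (hgood x hx).1 n v hv) hWb u n hv
  -- `b(0)` kills `𝟏` and `0 ∉ R`, so an attracted `𝟏` would lie in `J` already.
  have hWtop : W ≠ ⊤ := by
    intro h0
    have : IsAttracted N J R Γ.vbVac := by
      rw [← mem_attractedSubmodule (hJ := hNJ), ← hW, h0]
      exact Submodule.mem_top
    have := this.mem_of_apply_eq_zero hNJ hR hNvac
    rw [← hS.1] at this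
    exact hJ.2.1 (hJ.1.eq_top this)
  rw [← hJ.2.2 W hWideal hJW hWtop]
  exact (hgood x hx).2

/-- The point is to find an additive semigroup without `0` that contains every eigenvalue still
alive modulo `J`. A positive ray does, since two surviving eigenvalues have a positive rational
quotient. -/
theorem vbVec_mem (h : Γ.IsSplit χ μ b β c) (hS : Γ.IsVBStructure S)
    {J : Submodule ℂ Γ.VB} (hJ : S.IsMaximalIdeal J) {x : A} (hx : χ x = 0) :
    Γ.vbVec (x, 0) ∈ J := by
  obtain ⟨r, t, hsum, hprod⟩ : ∃ r t : ℂ, r + t = c ∧ r * t = -1 := by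
    obtain ⟨s, hs⟩ := IsAlgClosed.exists_pow_nat_eq (c ^ 2 + 4) (n := 2) (by norm_num)
    exact ⟨(c + s) / 2, (c - s) / 2, by ring, by linear_combination -hs / 4⟩
  have hr0 : r ≠ 0 := by
    rintro rfl
    simp at hprod
  have ht0 : t ≠ 0 := by
    rintro rfl
    simp at hprod
  let ray : ℂ → Set ℂ := fun z => {w | ∃ q : ℝ, 0 < q ∧ w = q * z}
  have ray_zero : ∀ z, z ≠ 0 → 0 ∉ ray z := by
    rintro z hz ⟨q, hq, h0⟩
    exact (mul_ne_zero (Complex.ofReal_ne_zero.2 hq.ne') hz) h0.symm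
  have ray_add : ∀ z, ∀ p ∈ ray z, ∀ q ∈ ray z, p + q ∈ ray z := by
    rintro z _ ⟨p, hp, rfl⟩ _ ⟨q, hq, rfl⟩
    exact ⟨p + q, add_pos hp hq, by push_cast; ring⟩
  have ray_self : ∀ z, z ∈ ray z := fun z => ⟨1, one_pos, by simp⟩
  by_cases h1 : ∀ x, χ x = 0 → Γ.anchor b x = r • x → Γ.vbVec (x, 0) ∈ J
  · exact h.vbVec_mem_of_forall hS hJ (ray_zero t ht0) (ray_add t) hsum hprod (ray_self t)
      (Or.inr h1) x hx
  by_cases h2 : ∀ x, χ x = 0 → Γ.anchor b x = t • x → Γ.vbVec (x, 0) ∈ J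
  · exact h.vbVec_mem_of_forall hS hJ (ray_zero r hr0) (ray_add r) ((add_comm t r).trans hsum)
      ((mul_comm t r).trans hprod) (ray_self r) (Or.inr h2) x hx
  push Not at h1 h2
  obtain ⟨x₁, hx₁, hd₁, hJ₁⟩ := h1
  obtain ⟨x₂, hx₂, hd₂, hJ₂⟩ := h2
  obtain ⟨m, hm, e1⟩ := h.exists_mul_eq hS hJ hx₁ hx₁ hd₁ hd₁ hJ₁ hJ₁
  obtain ⟨n, hn, e2⟩ := h.exists_mul_eq hS hJ hx₁ hx₂ hd₁ hd₂ hJ₁ hJ₂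
  refine h.vbVec_mem_of_forall hS hJ (ray_zero t ht0) (ray_add t) hsum hprod (ray_self t)
    (Or.inl ⟨m / n, by positivity, ?_⟩) x hx
  have hn0 : (n : ℂ) ≠ 0 := Nat.cast_ne_zero.2 hn.ne'
  -- Eliminating `β` from `r r = m β` and `r t = n β` gives `r = (m / n) t`.
  have : r * (n * r) = r * (m * t) := by linear_combination n * e1 - m * e2
  have := mul_left_cancel₀ hr0 this
  push_cast
  field_simp
  linear_combination this

end IsSplit

end VertexAlgebroid

end

theorem mainTheorem1 {A B : Type*} [CommRing A] [Algebra ℂ A] [AddCommGroup B] [Module ℂ B]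
    (Γ : VertexAlgebroid A B)
    (hΓ : Γ.SolvableTwo ∨ Γ.SolvableThreeOne ∨ Γ.SolvableThreeTwo ∨ Γ.SolvableThreeThree) :
    -- `A` is local, and `V_B` and `M(1)` carry their vertex algebra structures
    IsLocalRing A ∧
    (∃ S : VertexAlgebra Γ.VB, Γ.IsVBStructure S) ∧
    (∃ T : VertexAlgebra HeisenbergAlg.Fock, HeisenbergAlg.IsFockStructure T) ∧
    ∀ (S : VertexAlgebra Γ.VB) (T : VertexAlgebra HeisenbergAlg.Fock) (𝔞 : Ideal A),
      Γ.IsVBStructure S → HeisenbergAlg.IsFockStructure T → 𝔞.IsMaximal →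
      -- the ideal `(𝔞)` is the unique maximal ideal of `V_B`
      (S.IsMaximalIdeal (S.idealSpan {v | ∃ a ∈ 𝔞, v = Γ.vbVec (a, 0)}) ∧
        ∀ J : Submodule ℂ Γ.VB, S.IsMaximalIdeal J →
          J = S.idealSpan {v | ∃ a ∈ 𝔞, v = Γ.vbVec (a, 0)}) ∧
      -- the quotient `V_B / (𝔞)` is isomorphic to `M(1)`
      (S.quotient (S.idealSpan {v | ∃ a ∈ 𝔞, v = Γ.vbVec (a, 0)})
        (S.isIdeal_idealSpan _)).Isomorphic T := by
  obtain ⟨χ, μ, b, β, c, h⟩ := VertexAlgebroid.exists_isSplit_of_solvable hΓ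
  refine ⟨h.isLocalRing, Γ.exists_isVBStructure, HeisenbergAlg.exists_isFockStructure, ?_⟩
  intro S T 𝔞 hS hT h𝔞
  have hset : {v | ∃ a ∈ 𝔞, v = Γ.vbVec (a, 0)} = {v | ∃ x, χ x = 0 ∧ v = Γ.vbVec (x, 0)} := by
    simp only [h.mem_iff h𝔞]
  rw [hset]
  refine ⟨⟨h.isMaximalIdeal hS, fun J hJ => ?_⟩, h.isomorphic hS hT⟩
  -- A maximal ideal containing the maximal ideal `(𝔞)` equals it, so it is enough that `J` contains
  -- the generators.
  refine (h.isMaximalIdeal hS).2.2 J hJ.1 (sInf_le ⟨hJ.1, ?_⟩) hJ.2.1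
  rintro _ ⟨x, hx, rfl⟩
  exact h.vbVec_mem hS hJ hx
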